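/- Let $\alpha:[0,\infty)\to(0,1)$ be a measurable transition function: the limits $\lim_{t\to0+}\alpha(t)$ and $\lim_{t\to\infty}\alpha(t)$ exist and belong to $(0,1)$. Let $A(s)=\int_0^\infty e^{-st}\alpha(t)\,dt$ be its Laplace transform, and let $\lambda>0$, $u_0\in\mathbb R$. Write $s=\rho e^{i\theta}$, $\rho>0$, $|\theta|\le\pi$, for the points of the plane cut along the negative real axis, the two edges $\theta=\pm\pi$ of the cut included; powers of $s$ are taken with $\log s=\log\rho+i\theta$. Assume: (a) $A$ extends from $\mathrm{Re}\,s>0$ to the cut plane including both edges as a meromorphic function of $\log s$, that is, meromorphic in a neighbourhood of every point of the strip $|\mathrm{Im}\log s|\le\pi$; (b) $sA(s)$ has a limit as $|s|\to\infty$ and a limit as $|s|\to0$ in the closed cut plane; (c) $s^{sA(s)}+\lambda\ne0$ at all points of the two edges at which $A$ is analytic. Then there is a function $\varphi_\alpha$ with (absolutely convergent) Laplace transform $s^{sA(s)-1}$ in some right half-plane; it is the kernel of the Scarpi derivative ${}^SD_0^{\alpha(t)}f(t)=\int_0^t\varphi_\alpha(t-\tau)f'(\tau)\,d\tau$. The Cauchy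 problem $${}^SD_0^{\alpha(t)}u(t)=-\lambda u(t)\quad(t>0),\qquad u(0)=u_0,$$ has exactly one solution $u$ on $[0,\infty)$ among the functions that are absolutely continuous on bounded intervals and for which the integral defining ${}^SD_0^{\alpha(t)}u(t)$ converges absolutely for every $t>0$. Let $P$ be the set of poles of $s^{sA(s)-1}/(s^{sA(s)}+\lambda)$ in the open cut plane, i.e. of the zeros of $s^{sA(s)}+\lambda$ at points where $A$ is analytic. There is $s_0>0$ with $\mathrm{Re}\,p<s_0$ for all $p\in P$. Fix any such $s_0$ and let $\Gamma=\Gamma_{R,\varepsilon}$ be the keyhole contour formed by the segment from $s_0-iR$ to $s_0+iR$, the segments from $s_0\pm iR$ to $\pm iR$, the arcs of the circle $|s|=R$ from $\pm iR$ to $-R$, the two edges of the cut between $-R$ and $-\varepsilon$, and the circle $|s|=\varepsilon$. Then for all sufficiently large $R$, for all sufficiently small $\varepsilon>0$, and for all $t>0$, $$u(t)=\frac{u_0}{2\pi i}\Bigg(\mathfrak R+\int_0^\infty\frac{\rho^{-\rho A(\rho e^{-i\pi})-1}e^{i\pi(\rho A(\rho e^{-i\pi})+1)}}{\rho^{-\rho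 A(\rho e^{-i\pi})}e^{i\pi\rho A(\rho e^{-i\pi})}+\lambda}e^{-\rho t}\,d\rho-\int_0^\infty\frac{\rho^{-\rho A(\rho e^{i\pi})-1}e^{-i\pi(\rho A(\rho e^{i\pi})+1)}}{\rho^{-\rho A(\rho e^{i\pi})}e^{-i\pi\rho A(\rho e^{i\pi})}+\lambda}e^{-\rho t}\,d\rho\Bigg),$$ where $\mathfrak R$ is $2\pi i$ times the sum, which converges absolutely, of the residues of $\dfrac{s^{sA(s)-1}}{s^{sA(s)}+\lambda}\,e^{st}$ at the points of $P$ inside $\Gamma$, and both integrals converge absolutely. -/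

import Mathlib

open Set Filter Topology MeasureTheory

noncomputable section

/-- The Laplace transform `∫₀^∞ e^{-st} f(t) dt`. -/
def laplaceTransform (f : ℝ → ℝ) (s : ℂ) : ℂ :=
  ∫ t in Ioi (0 : ℝ), Complex.exp (-(s * t)) * (f t : ℂ)

/-- `F` is the Laplace transform of `f`, that is `f = ℒ⁻¹[F]`: for all `s` in some right half-plane
the Laplace integral of `f` converges absolutely and has the value `F s`. -/
def HasLaplaceTransform (f : ℝ → ℝ) (F : ℂ → ℂ) : Prop :=
  ∃ σ : ℝ, ∀ s : ℂ, σ < s.re →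
    IntegrableOn (fun t : ℝ => Complex.exp (-(s * t)) * (f t : ℂ)) (Ioi 0) ∧
      laplaceTransform f s = F s

/-- Transition functions `α : [0,∞) → (0,1)`, with an initial state and a final state in `(0,1)`.
As `α` is bounded, measurability says exactly that its Laplace transform exists (for `Re s > 0`). -/
structure IsTransitionFunction (α : ℝ → ℝ) : Prop where
  mem_Ioo : ∀ t, 0 ≤ t → α t ∈ Ioo (0 : ℝ) 1
  aemeasurable : AEMeasurable α (volume.restrict (Ioi 0))
  initial_state : ∃ a ∈ Ioo (0 : ℝ) 1, Tendsto α (𝓝[>] 0) (𝓝 a)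
  final_state : ∃ a ∈ Ioo (0 : ℝ) 1, Tendsto α atTop (𝓝 a)

/-- `φ = ℒ⁻¹[s^{sA(s)-1}]`, where `A = ℒ[α]`, is the kernel of the Scarpi derivative of variable
order `α`. It is determined by `α` up to a null set, which the derivative does not see. -/
def IsScarpiKernel (α φ : ℝ → ℝ) : Prop :=
  HasLaplaceTransform φ (fun s => s ^ (s * laplaceTransform α s - 1))

/-- The Scarpi derivative `∫₀ᵗ φ(t - τ) f'(τ) dτ` with kernel `φ`. -/
def scarpiDerivative (φ f : ℝ → ℝ) (t : ℝ) : ℝ :=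
  ∫ τ in (0 : ℝ)..t, φ (t - τ) * deriv f τ

/-- `u` solves the relaxation equation `ˢD₀^α u = -λ u` on `(0,∞)` with `u(0) = u₀`; it is absolutely
continuous on bounded intervals and the integral defining its Scarpi derivative converges. -/
structure IsRelaxationSolution (φ : ℝ → ℝ) (lam u₀ : ℝ) (u : ℝ → ℝ) : Prop where
  absolutelyContinuous : ∀ T, 0 < T → AbsolutelyContinuousOnInterval u 0 T
  initial : u 0 = u₀
  integrable : ∀ t, 0 < t →
    IntervalIntegrable (fun τ => φ (t - τ) * deriv u τ) volume 0 t
  equation : ∀ t, 0 < t → scarpiDerivative φ u t = -lam * u t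

/-- The closed strip `|Im z| ≤ π`. Under `s = e^z` it is the plane cut along the negative real axis,
with the two edges of the cut added: `s = ρe^{iθ}` corresponds to `z = log ρ + iθ`, `|θ| ≤ π`. -/
def cutStrip : Set ℂ := {z | |z.im| ≤ Real.pi}

/-- `A` is the analytic expression of `ℒ[α]` on the cut plane including both edges of the cut, as a
function of the logarithm `z` of `s = e^z`. It is meromorphic (in normal form: analytic wherever it
has no pole) and agrees with the Laplace integral for `Re s > 0`. -/
structure IsTransformOnCutPlane (α : ℝ → ℝ) (A : ℂ → ℂ) : Prop where
  meromorphic : MeromorphicNFOn A cutStrip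
  eq_laplace : ∀ z : ℂ, |z.im| < Real.pi / 2 → A z = laplaceTransform α (Complex.exp z)

/-- `s^{sA(s)-1} / (s^{sA(s)} + λ)` for `s` in the cut plane. -/
def relaxationTransform (A : ℂ → ℂ) (lam : ℝ) (s : ℂ) : ℂ :=
  s ^ (s * A (Complex.log s) - 1) / (s ^ (s * A (Complex.log s)) + lam)

/-- The poles of `s^{sA(s)-1} / (s^{sA(s)} + λ)` in the cut plane. -/
def relaxationPoles (A : ℂ → ℂ) (lam : ℝ) : Set ℂ :=
  {s | s ∈ Complex.slitPlane ∧ AnalyticAt ℂ A (Complex.log s) ∧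
    s ^ (s * A (Complex.log s)) + lam = 0}

/-- The residue of `f` at an isolated singularity `a`. -/
def residueAt (f : ℂ → ℂ) (a : ℂ) : ℂ :=
  limUnder (𝓝[>] (0 : ℝ)) (fun r : ℝ => (2 * Real.pi * Complex.I)⁻¹ * ∮ z in C(a, r), f z)

/-- The interior of the keyhole contour `Γ` with parameters `s₀`, `R`, `ε`: it is bounded by the
segment from `s₀ - iR` to `s₀ + iR`, the segments from `± iR` to `s₀ ± iR`, the arcs of radius `R`
from `± iR` to the negative real axis, the two edges of the cut and the circle of radius `ε`. -/
def keyholeInterior (s₀ R ε : ℝ) : Set ℂ :=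
  {s | s ∈ Complex.slitPlane ∧ ε < ‖s‖ ∧
    ((s.re ≤ 0 ∧ ‖s‖ < R) ∨ (0 < s.re ∧ s.re < s₀ ∧ |s.im| < R))}

/-- The denominator `s^{sA(s)} + λ` at the edge point `s = ρe^{iθ}`, `θ = π` or `θ = -π`. -/
def edgeDenominator (A : ℂ → ℂ) (lam θ ρ : ℝ) : ℂ :=
  (ρ : ℂ) ^ (-ρ * A (Real.log ρ + θ * Complex.I)) *
    Complex.exp (-Complex.I * θ * (ρ * A (Real.log ρ + θ * Complex.I))) + lam

/-- The integrand of the branch cut integral along the edge `s = ρe^{iθ}`, `θ = π` or `θ = -π`. -/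
def edgeIntegrand (A : ℂ → ℂ) (lam θ t ρ : ℝ) : ℂ :=
  (ρ : ℂ) ^ (-ρ * A (Real.log ρ + θ * Complex.I) - 1) *
    Complex.exp (-Complex.I * θ * (ρ * A (Real.log ρ + θ * Complex.I) + 1)) /
      edgeDenominator A lam θ ρ * Complex.exp (-(ρ * t))

end

/-!
The work takes place in the plane of `z = log s`, where the closed cut plane is the strip
`|Im z| ≤ π` and the two edges of the cut are its boundary lines. Put `g z = s^{sA(s)}`
(`scarpiPower`).

*The Cauchy problem.* By the initial and final value theorems the limits of `sA(s)` at infinity and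
at the origin are those of `α` at `0` and `∞`, so they lie in `(0, 1)`. Hence `|g|` grows like a
power of `|s|` at infinity and tends to `0` at the origin, and `A` is analytic near both ends. A
symbol that decays like a negative power of `s` far out is the Laplace transform of an integral
along a Hankel contour (`DecaysOnStrip.isLaplace_hankel`). This yields the Scarpi kernel `φ`, with
transform `g / s`, a function `v` with transform `1 / (g + λ)`, and the solution
`u₀ (1 - λ ∫₀ᵗ v)`, whose transform is `u₀ (g / s) / (g + λ)`. The convolution identities hold for
every `t > 0`, and not only almost everywhere, because both sides are continuous. Uniqueness follows
on convolving the equation for the difference of two solutions with `v`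
(`IsTransformOnCutPlane.exists_solution`).

*The residues.* The zeros of `g + λ` lie in an annulus, but there may be infinitely many of them,
accumulating at the poles of `A`, which may even lie on the edges of the cut. In terms of
`X = (z s A - log λ - iπ) / (2πi)` they are the points where `X` is an integer, and
`g / (g + λ) = e^{2πiX} / (e^{2πiX} - 1) = 1/2 + (2πi)⁻¹ π cot (π X)`. The cotangent is the sum of
the partial fractions `1 / (X - n) + 1 / (X + n)`. At a pole of `A` each of them has a removable
singularity, so that the finite residue theorem applies to each separately
(`rectIntegral_eq_sum_residues`). The sum over `n` may be taken under the integral sign since the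
sum of the absolute values of the partial fractions is at most a constant times
`|X|^η + 1 / dist (X, ℤ)` (`exists_tsum_enorm_cotSummand_le`). This is integrable along the edges,
also near a pole of `X`: there either the distance is bounded below, or it is at least a geometric
mean of `|Im X|`, which is not smaller than a power of the distance to the pole, and of the distance
of `Re X` to the integers, and the variable `y = Re X` makes the integral converge
(`exists_lowerBound_dist_int_ray`). Here the absence of zeros of `g + λ` on the edges enters: it
excludes that `X` is real on an edge near a pole.

The residues themselves are absolutely summable: near a pole of order `m` the point where `X = n`
has a residue of size `|n|^{-1-1/m}`, and there are at most `m` such points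
(`HasPoleAt.exists_summable_residueAt`). So the residue theorem holds on rectangles of the strip
(`IsAdmissibleRect.rectIntegral_eq_tsum_residueAt`). As the left side of the rectangle moves to `-∞`
its contribution vanishes, and the Hankel integral for `u` becomes the asserted formula
(`IsSeparated.two_pi_I_mul_hankel`).
-/


/-! ### Laplace transforms of complex-valued functions -/

/-- `F` is the Laplace transform of `f : ℝ → ℂ` on the half-plane `σ < Re s`, where the Laplace
integral converges absolutely. -/
def IsLaplace (f : ℝ → ℂ) (σ : ℝ) (F : ℂ → ℂ) : Prop :=
  ∀ s : ℂ, σ < s.re →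
    IntegrableOn (fun t : ℝ => Complex.exp (-(s * t)) * f t) (Ioi 0) ∧
      ∫ t in Ioi (0 : ℝ), Complex.exp (-(s * t)) * f t = F s

namespace IsLaplace

variable {f g : ℝ → ℂ} {σ τ : ℝ} {F G : ℂ → ℂ}

theorem mono (h : IsLaplace f σ F) (hle : σ ≤ τ) : IsLaplace f τ F :=
  fun s hs => h s (hle.trans_lt hs)

theorem congr_right (h : IsLaplace f σ F) (hFG : ∀ s : ℂ, σ < s.re → F s = G s) :
    IsLaplace f σ G :=
  fun s hs => ⟨(h s hs).1, (h s hs).2.trans (hFG s hs)⟩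

theorem congr_left (h : IsLaplace f σ F) (hfg : ∀ t : ℝ, 0 < t → f t = g t) :
    IsLaplace g σ F := by
  intro s hs
  have heq : EqOn (fun t : ℝ => Complex.exp (-(s * t)) * f t)
      (fun t : ℝ => Complex.exp (-(s * t)) * g t) (Ioi 0) := fun t ht => by
    simp only [hfg t ht]
  exact ⟨(h s hs).1.congr_fun heq measurableSet_Ioi,
    (setIntegral_congr_fun measurableSet_Ioi heq).symm.trans (h s hs).2⟩

theorem sub (hf : IsLaplace f σ F) (hg : IsLaplace g σ G) :
    IsLaplace (fun t => f t - g t) σ (fun s => F s - G s) := by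
  intro s hs
  simp only [mul_sub]
  exact ⟨(hf s hs).1.sub (hg s hs).1, by
    rw [integral_sub (hf s hs).1 (hg s hs).1, (hf s hs).2, (hg s hs).2]⟩

theorem const_mul (c : ℂ) (hf : IsLaplace f σ F) :
    IsLaplace (fun t => c * f t) σ (fun s => c * F s) := by
  intro s hs
  have heq : ∀ t : ℝ, Complex.exp (-(s * t)) * (c * f t) = c * (Complex.exp (-(s * t)) * f t) :=
    fun t => by ring
  simp only [heq]
  exact ⟨(hf s hs).1.const_mul c, by rw [integral_const_mul, (hf s hs).2]⟩

/-- Conjugating `f` conjugates its transform, reflected in the real axis. -/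
theorem conj (hf : IsLaplace f σ F) :
    IsLaplace (fun t => (starRingEnd ℂ) (f t)) σ
      (fun s => (starRingEnd ℂ) (F ((starRingEnd ℂ) s))) := by
  intro s hs
  have hs' : σ < ((starRingEnd ℂ) s).re := by simpa using hs
  obtain ⟨h1, h2⟩ := hf _ hs'
  have heq : ∀ t : ℝ, Complex.exp (-(s * t)) * (starRingEnd ℂ) (f t) =
      (starRingEnd ℂ) (Complex.exp (-((starRingEnd ℂ) s * t)) * f t) := fun t => by
    rw [map_mul, ← Complex.exp_conj]
    simp
  simp only [heq]
  refine ⟨?_, by rw [integral_conj, h2]⟩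
  exact (Complex.conjCLE.toContinuousLinearMap.integrable_comp h1 :)

/-- If the transform is real on reflection, the real part of `f` has the same transform. -/
theorem re (hf : IsLaplace f σ F)
    (hF : ∀ s : ℂ, σ < s.re → (starRingEnd ℂ) (F ((starRingEnd ℂ) s)) = F s) :
    IsLaplace (fun t => ((f t).re : ℂ)) σ F := by
  have h := ((hf.const_mul (1 / 2)).sub (hf.conj.const_mul (-1 / 2)))
  refine (h.congr_left fun t _ => ?_).congr_right fun s hs => ?_
  · rw [Complex.re_eq_add_conj]; ring
  · simp only [hF s hs]; ring

theorem ae_eq_zero_of_real {d : ℝ → ℝ} {σ : ℝ}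
    (h : IsLaplace (fun t => (d t : ℂ)) σ 0) :
    ∀ᵐ t ∂(volume.restrict (Ioi (0 : ℝ))), d t = 0 := by
  set ν : Measure ℝ := volume.restrict (Ioi (0 : ℝ)) with hν
  set D : ℝ → ℝ := fun t => Real.exp (-((σ + 1) * t)) * d t with hD
  have key : ∀ x : ℝ, Integrable (fun t : ℝ => Complex.exp (t * x * Complex.I) * (D t : ℂ)) ν ∧
      ∫ t, Complex.exp (t * x * Complex.I) * (D t : ℂ) ∂ν = 0 := by
    intro x
    have := h ((σ + 1 : ℝ) - x * Complex.I) (by simp)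
    have heq : ∀ t : ℝ, Complex.exp (-(((σ + 1 : ℝ) - x * Complex.I) * t)) * (d t : ℂ) =
        Complex.exp (t * x * Complex.I) * (D t : ℂ) := fun t => by
      simp only [hD]; push_cast
      rw [← mul_assoc, ← Complex.exp_add]; ring_nf
    simp only [heq] at this
    exact this
  have hDint : Integrable D ν := by
    have := (key 0).1.re
    simpa using this
  have hpos : ∀ s : ℝ, ∀ D : ℝ → ℝ, Integrable D ν → charFun (ν.withDensity fun t => ENNReal.ofReal (D t)) s =
      ∫ t, ((max (D t) 0 : ℝ) : ℂ) * Complex.exp (t * s * Complex.I) ∂ν := by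
    intro s D hDint
    rw [charFun_apply_real, integral_withDensity_eq_integral_toReal_smul₀]
    · refine integral_congr_ae (Eventually.of_forall fun t => ?_)
      simp only [ENNReal.toReal_ofReal', Complex.real_smul]
      congr 2; ring
    · exact hDint.1.aemeasurable.ennreal_ofReal
    · exact Eventually.of_forall fun t => ENNReal.ofReal_lt_top
  have hfin : ∀ D : ℝ → ℝ, Integrable D ν →
      IsFiniteMeasure (ν.withDensity fun t => ENNReal.ofReal (D t)) := fun D hD =>
    isFiniteMeasure_withDensity_ofReal hD.2
  have := hfin D hDint
  have hneg : Integrable (fun t => -D t) ν := hDint.neg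
  have := hfin (fun t => -D t) hneg
  have hbd : ∀ s : ℝ, ∀ D : ℝ → ℝ, Integrable D ν →
      Integrable (fun t : ℝ => ((max (D t) 0 : ℝ) : ℂ) * Complex.exp (t * s * Complex.I)) ν := by
    intro s D hD
    refine Integrable.mul_bdd (c := 1) hD.pos_part.ofReal (by fun_prop) ?_
    refine Eventually.of_forall fun t => ?_
    rw [← Complex.ofReal_mul, Complex.norm_exp_ofReal_mul_I]
  have hmeas : (ν.withDensity fun t => ENNReal.ofReal (D t)) =
      ν.withDensity fun t => ENNReal.ofReal (-D t) := by
    refine Measure.ext_of_charFun ?_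
    funext s
    rw [hpos s D hDint, hpos s _ hneg, ← sub_eq_zero,
      ← integral_sub (hbd s D hDint) (hbd s _ hneg), ← (key s).2]
    refine integral_congr_ae (Eventually.of_forall fun t => ?_)
    simp only
    rw [← sub_mul, ← Complex.ofReal_sub, mul_comm]
    congr 2
    rcases le_total (D t) 0 with h0 | h0
    · rw [max_eq_right h0, max_eq_left (by linarith)]; ring
    · rw [max_eq_left h0, max_eq_right (by linarith)]; ring
  have hae := (withDensity_eq_iff_of_sigmaFinite hDint.1.aemeasurable.ennreal_ofReal
    hneg.1.aemeasurable.ennreal_ofReal).1 hmeas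
  filter_upwards [hae] with t ht
  have hDt : D t = 0 := by
    rcases lt_trichotomy (D t) 0 with h0 | h0 | h0
    · rw [ENNReal.ofReal_of_nonpos h0.le] at ht
      have := ENNReal.ofReal_eq_zero.1 ht.symm
      linarith
    · exact h0
    · rw [ENNReal.ofReal_of_nonpos (by linarith : -D t ≤ 0)] at ht
      have := ENNReal.ofReal_eq_zero.1 ht
      linarith
  exact (mul_eq_zero.1 hDt).resolve_left (Real.exp_ne_zero _)

/-- A function is determined almost everywhere by its Laplace transform. -/
theorem ae_eq (hf : IsLaplace f σ F) (hg : IsLaplace g σ F) :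
    ∀ᵐ t ∂(volume.restrict (Ioi (0 : ℝ))), f t = g t := by
  have h0 : IsLaplace (fun t => f t - g t) σ 0 :=
    (hf.sub hg).congr_right fun s _ => by simp
  have hre := ae_eq_zero_of_real (h0.re fun s _ => by simp)
  have him := ae_eq_zero_of_real (d := fun t => (-Complex.I * (f t - g t)).re)
    (((h0.const_mul (-Complex.I)).congr_right (G := 0) fun s _ => by simp).re fun s _ => by simp)
  filter_upwards [hre, him] with t h1 h2
  rw [← sub_eq_zero]
  apply Complex.ext
  · simpa using h1
  · simpa using h2

/-- Functions continuous on `(0, ∞)` are determined there by their Laplace transform. -/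
theorem eqOn (hf : IsLaplace f σ F) (hg : IsLaplace g σ F) (hfc : ContinuousOn f (Ioi 0))
    (hgc : ContinuousOn g (Ioi 0)) : EqOn f g (Ioi 0) :=
  Measure.eqOn_open_of_ae_eq (hf.ae_eq hg) isOpen_Ioi hfc hgc

/-- The Laplace transform of a convolution is the product of the transforms. -/
theorem conv (hf : IsLaplace f σ F) (hg : IsLaplace g σ G) :
    IsLaplace (fun t => ∫ τ in (0 : ℝ)..t, f τ * g (t - τ)) σ (fun s => F s * G s) := by
  intro s hs
  obtain ⟨hf1, hf2⟩ := hf s hs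
  obtain ⟨hg1, hg2⟩ := hg s hs
  have heq : ∀ t : ℝ, Complex.exp (-(s * t)) * ∫ τ in (0 : ℝ)..t, f τ * g (t - τ) =
      ∫ τ in (0 : ℝ)..t, ContinuousLinearMap.mul ℝ ℂ (Complex.exp (-(s * τ)) * f τ)
        (Complex.exp (-(s * (t - τ : ℝ))) * g (t - τ)) := fun t => by
    rw [← intervalIntegral.integral_const_mul]
    refine intervalIntegral.integral_congr fun τ _ => ?_
    simp only [ContinuousLinearMap.mul_apply']
    have : Complex.exp (-(s * t)) = Complex.exp (-(s * τ)) * Complex.exp (-(s * (t - τ : ℝ))) := by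
      rw [← Complex.exp_add]; push_cast; ring_nf
    rw [this]; ring
  simp only [heq]
  constructor
  · have := (integrable_posConvolution hf1 hg1 (ContinuousLinearMap.mul ℝ ℂ)).integrableOn
      (s := Ioi 0)
    refine this.congr_fun (fun t ht => ?_) measurableSet_Ioi
    rw [posConvolution, indicator_of_mem ht]
  · rw [integral_posConvolution hf1 hg1 (ContinuousLinearMap.mul ℝ ℂ), hf2, hg2]
    rfl

/-- The constant function `1` has the Laplace transform `1 / s`. -/
theorem one : IsLaplace (fun _ => 1) 0 (fun s => 1 / s) := by
  intro s hs
  have heq : ∀ t : ℝ, Complex.exp (-(s * t)) * 1 = Complex.exp (-s * t) := fun t => by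
    rw [mul_one, neg_mul]
  simp only [heq]
  have hs' : (-s).re < 0 := by simpa using hs
  refine ⟨integrableOn_exp_mul_complex_Ioi hs' 0, ?_⟩
  rw [integral_exp_mul_complex_Ioi hs' 0]
  simp

/-- The Laplace transform of a primitive. -/
theorem primitive (hf : IsLaplace f σ F) (hσ : 0 ≤ σ) :
    IsLaplace (fun t => ∫ τ in (0 : ℝ)..t, f τ) σ (fun s => F s / s) := by
  refine ((hf.conv (one.mono hσ)).congr_left fun t _ => ?_).congr_right fun s _ => ?_
  · simp
  · ring

theorem of_integrableOn (h : ∀ s : ℂ, σ < s.re →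
    IntegrableOn (fun t : ℝ => Complex.exp (-(s * t)) * f t) (Ioi 0)) :
    IsLaplace f σ (fun s => ∫ t in Ioi (0 : ℝ), Complex.exp (-(s * t)) * f t) :=
  fun s hs => ⟨h s hs, rfl⟩

end IsLaplace

/-! ### Convolutions of functions with integrable power singularities -/

/-- The bound `‖f t‖ ≤ C t^(a-1)` on every interval `(0, T]`. -/
def PowerBounded (f : ℝ → ℂ) (a : ℝ) : Prop :=
  ∀ T : ℝ, 0 < T → ∃ C : ℝ, ∀ t ∈ Ioc 0 T, ‖f t‖ ≤ C * t ^ (a - 1)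

theorem intervalIntegrable_beta {a b : ℝ} (ha : 0 < a) (hb : 0 < b) :
    IntervalIntegrable (fun x : ℝ => x ^ (a - 1) * (1 - x) ^ (b - 1)) volume 0 1 := by
  have h := (Complex.betaIntegral_convergent (u := a) (v := b) (by simpa) (by simpa)).norm
  refine h.congr_ae ?_
  rw [uIoc_of_le zero_le_one, ← restrict_Ioo_eq_restrict_Ioc]
  filter_upwards [ae_restrict_mem measurableSet_Ioo] with x hx
  have h1 : (1 : ℂ) - x = ((1 - x : ℝ) : ℂ) := by push_cast; ring
  rw [norm_mul, h1, Complex.norm_cpow_eq_rpow_re_of_pos hx.1,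
    Complex.norm_cpow_eq_rpow_re_of_pos (by linarith [hx.2])]
  simp

section conv

variable {f g : ℝ → ℂ} {a b : ℝ}

theorem PowerBounded.conv_bound (hf : PowerBounded f a) (hg : PowerBounded g b) {T : ℝ}
    (hT : 0 < T) : ∃ C : ℝ, 0 ≤ C ∧ ∀ t ∈ Ioc 0 T, ∀ x ∈ Ioo (0 : ℝ) 1,
      ‖f (t * x) * g (t - t * x)‖ ≤
        C * t ^ (a + b - 2) * (x ^ (a - 1) * (1 - x) ^ (b - 1)) := by
  obtain ⟨C₁, h₁⟩ := hf T hT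
  obtain ⟨C₂, h₂⟩ := hg T hT
  refine ⟨|C₁| * |C₂|, by positivity, fun t ht x hx => ?_⟩
  have hx1 : 0 < 1 - x := by linarith [hx.2]
  have e1 : ‖f (t * x)‖ ≤ |C₁| * (t ^ (a - 1) * x ^ (a - 1)) := by
    rw [← Real.mul_rpow ht.1.le hx.1.le]
    refine (h₁ (t * x) ⟨mul_pos ht.1 hx.1, by nlinarith [ht.1, ht.2, hx.2]⟩).trans ?_
    exact mul_le_mul_of_nonneg_right (le_abs_self _) (Real.rpow_nonneg (mul_pos ht.1 hx.1).le _)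
  have e2 : ‖g (t - t * x)‖ ≤ |C₂| * (t ^ (b - 1) * (1 - x) ^ (b - 1)) := by
    rw [← Real.mul_rpow ht.1.le hx1.le, show t - t * x = t * (1 - x) by ring]
    refine (h₂ (t * (1 - x)) ⟨mul_pos ht.1 hx1, by nlinarith [ht.1, ht.2, hx.1]⟩).trans ?_
    exact mul_le_mul_of_nonneg_right (le_abs_self _) (Real.rpow_nonneg (mul_pos ht.1 hx1).le _)
  rw [norm_mul]
  refine (mul_le_mul e1 e2 (norm_nonneg _) ?_).trans_eq ?_
  · have := Real.rpow_nonneg ht.1.le (a - 1)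
    have := Real.rpow_nonneg hx.1.le (a - 1)
    positivity
  · rw [show a + b - 2 = (a - 1) + (b - 1) by ring, Real.rpow_add ht.1]; ring

theorem aestronglyMeasurable_conv (hfc : ContinuousOn f (Ioi 0)) (hgc : ContinuousOn g (Ioi 0))
    {t : ℝ} (ht : 0 < t) :
    AEStronglyMeasurable (fun x => f (t * x) * g (t - t * x)) (volume.restrict (uIoc 0 1)) := by
  rw [uIoc_of_le zero_le_one, ← restrict_Ioo_eq_restrict_Ioc]
  refine ContinuousOn.aestronglyMeasurable ?_ measurableSet_Ioo
  refine (hfc.comp (by fun_prop) fun x hx => mul_pos ht hx.1).mul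
    (hgc.comp (by fun_prop) fun x hx => ?_)
  have := mul_pos ht (sub_pos.2 hx.2)
  simp only [mem_Ioi]; linarith

theorem PowerBounded.intervalIntegrable_conv (hf : PowerBounded f a) (hg : PowerBounded g b)
    (ha : 0 < a) (hb : 0 < b) (hfc : ContinuousOn f (Ioi 0)) (hgc : ContinuousOn g (Ioi 0))
    {t : ℝ} (ht : 0 < t) : IntervalIntegrable (fun τ => f τ * g (t - τ)) volume 0 t := by
  obtain ⟨C, hC, h⟩ := hf.conv_bound hg ht
  have h1 : IntervalIntegrable (fun x => f (t * x) * g (t - t * x)) volume 0 1 := by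
    refine ((intervalIntegrable_beta ha hb).const_mul (C * t ^ (a + b - 2))).mono_fun
      (aestronglyMeasurable_conv hfc hgc ht) ?_
    rw [uIoc_of_le zero_le_one, ← restrict_Ioo_eq_restrict_Ioc]
    filter_upwards [ae_restrict_mem measurableSet_Ioo] with x hx
    exact (h t ⟨ht, le_rfl⟩ x hx).trans (Real.le_norm_self _)
  have h2 := h1.comp_mul_left (c := t⁻¹)
  simp only [zero_div, one_div, inv_inv] at h2
  refine h2.congr_ae (Eventually.of_forall fun τ => ?_)
  simp only [mul_inv_cancel_left₀ ht.ne']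

/-- The convolution of two functions with integrable power singularities at `0` is continuous;
after scaling to the unit interval this is dominated convergence. -/
theorem PowerBounded.continuousOn_conv (hf : PowerBounded f a) (hg : PowerBounded g b)
    (ha : 0 < a) (hb : 0 < b) (hfc : ContinuousOn f (Ioi 0)) (hgc : ContinuousOn g (Ioi 0)) :
    ContinuousOn (fun t => ∫ τ in (0 : ℝ)..t, f τ * g (t - τ)) (Ioi 0) := by
  have hscale : ∀ t : ℝ, t • ∫ x in (0 : ℝ)..1, f (t * x) * g (t - t * x) =
      ∫ τ in (0 : ℝ)..t, f τ * g (t - τ) := fun t => by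
    have := intervalIntegral.smul_integral_comp_mul_left (a := 0) (b := 1)
      (fun τ => f τ * g (t - τ)) t
    simpa using this
  simp only [← hscale]
  intro t₀ ht₀
  have ht₀ : 0 < t₀ := ht₀
  refine (continuousAt_id.smul ?_).continuousWithinAt
  obtain ⟨C, hC, h⟩ := hf.conv_bound hg (T := 2 * t₀) (by linarith)
  have hnear : ∀ᶠ t in 𝓝 t₀, t ∈ Ioc 0 (2 * t₀) ∧ t ^ (a + b - 2) < t₀ ^ (a + b - 2) + 1 := by
    have h1 : ∀ᶠ t in 𝓝 t₀, t ∈ Ioc 0 (2 * t₀) := Ioc_mem_nhds ht₀ (by linarith)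
    refine h1.and ((Real.continuousAt_rpow_const t₀ (a + b - 2) (Or.inl ht₀.ne')).eventually_lt
      continuousAt_const (by linarith))
  refine intervalIntegral.continuousAt_of_dominated_interval (bound := fun x =>
    C * (t₀ ^ (a + b - 2) + 1) * (x ^ (a - 1) * (1 - x) ^ (b - 1))) ?_ ?_ ?_ ?_
  · filter_upwards [hnear] with t ht using aestronglyMeasurable_conv hfc hgc ht.1.1
  · filter_upwards [hnear] with t ht
    rw [← ae_restrict_iff' measurableSet_uIoc, uIoc_of_le zero_le_one,
      ← restrict_Ioo_eq_restrict_Ioc]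
    filter_upwards [ae_restrict_mem measurableSet_Ioo] with x hx
    refine (h t ht.1 x hx).trans ?_
    have hx1 : 0 < 1 - x := by linarith [hx.2]
    have := Real.rpow_nonneg hx.1.le (a - 1)
    have := Real.rpow_nonneg hx1.le (b - 1)
    gcongr
    exact ht.2.le
  · exact (intervalIntegrable_beta ha hb).const_mul _
  · rw [← ae_restrict_iff' measurableSet_uIoc, uIoc_of_le zero_le_one,
      ← restrict_Ioo_eq_restrict_Ioc]
    filter_upwards [ae_restrict_mem measurableSet_Ioo] with x hx
    have h2 : 0 < t₀ - t₀ * x := by nlinarith [hx.2]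
    exact ((hfc.continuousAt (Ioi_mem_nhds (mul_pos ht₀ hx.1))).comp
      (f := fun t : ℝ => t * x) (by fun_prop)).mul
      ((hgc.continuousAt (Ioi_mem_nhds h2)).comp (f := fun t : ℝ => t - t * x) (by fun_prop))

end conv

/-! ### Residues -/

theorem AnalyticAt.dslope_self {f : ℂ → ℂ} {p : ℂ} (hf : AnalyticAt ℂ f p) :
    AnalyticAt ℂ (dslope f p) p :=
  let ⟨_, h⟩ := hf
  ⟨_, h.has_fpower_series_dslope_fslope⟩

/-- `c` is the residue of `f` at `p`: after subtraction of `c / (z - p)` the function has a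
primitive in a punctured neighbourhood of `p`. -/
def HasResidue (f : ℂ → ℂ) (p c : ℂ) : Prop :=
  ∃ M : ℂ → ℂ, ∀ᶠ z in 𝓝[≠] p, HasDerivAt M (f z - c / (z - p)) z

namespace HasResidue

variable {f g : ℂ → ℂ} {p c d : ℂ}

theorem congr (h : HasResidue f p c) (hfg : f =ᶠ[𝓝[≠] p] g) : HasResidue g p c := by
  obtain ⟨M, hM⟩ := h
  refine ⟨M, ?_⟩
  filter_upwards [hM, hfg] with z hz hz'
  rwa [← hz']

theorem add (hf : HasResidue f p c) (hg : HasResidue g p d) :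
    HasResidue (fun z => f z + g z) p (c + d) := by
  obtain ⟨M, hM⟩ := hf
  obtain ⟨N, hN⟩ := hg
  refine ⟨fun z => M z + N z, ?_⟩
  filter_upwards [hM, hN] with z hz hz'
  refine (hz.fun_add hz').congr_deriv ?_
  ring

theorem const_mul (a : ℂ) (hf : HasResidue f p c) : HasResidue (fun z => a * f z) p (a * c) := by
  obtain ⟨M, hM⟩ := hf
  refine ⟨fun z => a * M z, ?_⟩
  filter_upwards [hM] with z hz
  refine (hz.const_mul a).congr_deriv ?_
  ring

theorem of_analyticAt (hf : AnalyticAt ℂ f p) : HasResidue f p 0 := by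
  obtain ⟨r, hr, hd⟩ := hf.exists_ball_analyticOnNhd
  obtain ⟨M, hM⟩ := hd.differentiableOn.isExactOn_ball
  refine ⟨M, eventually_nhdsWithin_of_eventually_nhds ?_⟩
  filter_upwards [Metric.ball_mem_nhds p hr] with z hz
  simpa using hM z hz

theorem of_hasDerivAt {M : ℂ → ℂ} (hM : ∀ᶠ z in 𝓝[≠] p, HasDerivAt M (f z) z) :
    HasResidue f p 0 := ⟨M, by simpa using hM⟩

theorem const_div_sub (p c : ℂ) : HasResidue (fun z => c / (z - p)) p c :=
  ⟨fun _ => 0, Eventually.of_forall fun z => by simpa using hasDerivAt_const z (0 : ℂ)⟩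

theorem div_sub_self (hf : AnalyticAt ℂ f p) : HasResidue (fun z => f z / (z - p)) p (f p) := by
  have h := (const_div_sub p (f p)).add (of_analyticAt hf.dslope_self)
  rw [add_zero] at h
  refine h.congr ?_
  filter_upwards [self_mem_nhdsWithin] with z hz
  have hz' : z - p ≠ 0 := sub_ne_zero.2 hz
  rw [dslope_of_ne _ hz, slope_def_field]
  field_simp
  ring

/-- The residue of a quotient at a simple zero of the denominator. -/
theorem div_of_simple_zero {D : ℂ → ℂ} (hf : AnalyticAt ℂ f p) (hD : AnalyticAt ℂ D p)
    (h0 : D p = 0) (h1 : deriv D p ≠ 0) :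
    HasResidue (fun z => f z / D z) p (f p / deriv D p) := by
  have hds : AnalyticAt ℂ (fun z => f z / dslope D p z) p :=
    hf.div hD.dslope_self (by rwa [dslope_same])
  have h := div_sub_self hds
  simp only [dslope_same] at h
  refine h.congr ?_
  filter_upwards [self_mem_nhdsWithin] with z hz
  have hz' : z - p ≠ 0 := sub_ne_zero.2 hz
  rw [dslope_of_ne _ hz, slope_def_field, h0, sub_zero, div_div, div_mul_cancel₀ _ hz']

theorem circleIntegral_eq (h : HasResidue f p c) :
    ∀ᶠ r in 𝓝[>] (0 : ℝ), ∮ z in C(p, r), f z = 2 * Real.pi * Complex.I * c := by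
  obtain ⟨M, hM⟩ := h
  rw [eventually_nhdsWithin_iff, Metric.eventually_nhds_iff_ball] at hM
  obtain ⟨δ, hδ, hM⟩ := hM
  have hball : Ioo 0 δ ∈ 𝓝[>] (0 : ℝ) := Ioo_mem_nhdsGT hδ
  filter_upwards [hball] with r hr
  set U : Set ℂ := Metric.ball p δ \ {p} with hU
  have hUo : IsOpen U := Metric.isOpen_ball.sdiff isClosed_singleton
  have hsub : Metric.sphere p r ⊆ U := fun z hz => by
    refine ⟨Metric.sphere_subset_ball hr.2 hz, ?_⟩
    rintro rfl
    simp at hz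
    exact hr.1.ne' hz.symm
  have hMU : ∀ z ∈ U, HasDerivAt M (f z - c / (z - p)) z := fun z hz => hM z hz.1 hz.2
  have hMd : DifferentiableOn ℂ M U := fun z hz =>
    (hMU z hz).differentiableAt.differentiableWithinAt
  have hcont : ContinuousOn (fun z => f z - c / (z - p)) U :=
    (hMd.deriv hUo).continuousOn.congr fun z hz => (hMU z hz).deriv.symm
  have hcont2 : ContinuousOn (fun z => c / (z - p)) U :=
    continuousOn_const.div (by fun_prop) fun z hz => sub_ne_zero.2 hz.2
  have h1 : ∮ z in C(p, r), (f z - c / (z - p)) = 0 :=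
    circleIntegral.integral_eq_zero_of_hasDerivWithinAt hr.1.le
      fun z hz => (hMU z (hsub hz)).hasDerivWithinAt
  have h2 : ∮ z in C(p, r), c / (z - p) = 2 * Real.pi * Complex.I * c := by
    simp only [div_eq_mul_inv]
    rw [circleIntegral.integral_const_mul, circleIntegral.integral_sub_center_inv p hr.1.ne']
    ring
  have h3 := circleIntegral.integral_add
    ((hcont.mono hsub).circleIntegrable hr.1.le) ((hcont2.mono hsub).circleIntegrable hr.1.le)
  rw [h1, h2, zero_add] at h3
  rw [← h3]
  simp

theorem residueAt_eq (h : HasResidue f p c) : residueAt f p = c := by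
  refine Tendsto.limUnder_eq (tendsto_const_nhds.congr' ?_)
  filter_upwards [h.circleIntegral_eq] with r hr
  rw [hr, inv_mul_cancel_left₀ (by simp [Real.pi_ne_zero])]

theorem unique (hc : HasResidue f p c) (hd : HasResidue f p d) : c = d :=
  hc.residueAt_eq.symm.trans hd.residueAt_eq

/-- Residues are those of the differential `f(s) ds`: here `s = e^z`. -/
theorem comp_exp {F : ℂ → ℂ} {z₀ : ℂ} (h : HasResidue F (Complex.exp z₀) c) :
    HasResidue (fun z => F (Complex.exp z) * Complex.exp z) z₀ c := by
  obtain ⟨M, hM⟩ := h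
  have ht : Tendsto Complex.exp (𝓝[≠] z₀) (𝓝[≠] (Complex.exp z₀)) :=
    (Complex.hasDerivAt_exp z₀).tendsto_nhdsNE (Complex.exp_ne_zero _)
  have h1 : HasResidue (fun z => (F (Complex.exp z) - c / (Complex.exp z - Complex.exp z₀)) *
      Complex.exp z) z₀ 0 := by
    refine of_hasDerivAt (M := fun z => M (Complex.exp z)) ?_
    filter_upwards [ht.eventually hM] with z hz
    exact hz.comp z (Complex.hasDerivAt_exp z)
  have hd : deriv (fun z => Complex.exp z - Complex.exp z₀) z₀ = Complex.exp z₀ := by simp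
  have h2 := div_of_simple_zero (f := Complex.exp) (D := fun z => Complex.exp z - Complex.exp z₀)
    (p := z₀) (by fun_prop) (by fun_prop) (by simp) (by rw [hd]; exact Complex.exp_ne_zero _)
  rw [hd, div_self (Complex.exp_ne_zero _)] at h2
  have h3 := h1.add (h2.const_mul c)
  rw [mul_one, zero_add] at h3
  refine h3.congr (Eventually.of_forall fun z => ?_)
  simp only
  ring

end HasResidue

/-- The principal part of a meromorphic function: up to an analytic function it is the sum of a
simple pole and of the derivative of a function that is holomorphic off the pole. -/
theorem MeromorphicAt.exists_principal_part {f : ℂ → ℂ} {p : ℂ} (hf : MeromorphicAt f p) :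
    ∃ (c : ℂ) (M N : ℂ → ℂ), (∀ z, z ≠ p → DifferentiableAt ℂ M z) ∧ AnalyticAt ℂ N p ∧
      ∀ᶠ z in 𝓝[≠] p, f z = c / (z - p) + deriv M z + N z := by
  have key : ∀ (n : ℕ) (G : ℂ → ℂ), AnalyticAt ℂ G p →
      ∃ (c : ℂ) (M N : ℂ → ℂ), (∀ z, z ≠ p → DifferentiableAt ℂ M z) ∧ AnalyticAt ℂ N p ∧
      ∀ᶠ z in 𝓝[≠] p, G z / (z - p) ^ n = c / (z - p) + deriv M z + N z := by
    intro n
    induction n with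
    | zero =>
      intro G hG
      exact ⟨0, fun _ => 0, G, fun z _ => differentiableAt_const _, hG,
        Eventually.of_forall fun z => by simp⟩
    | succ n ih =>
      intro G hG
      obtain ⟨c, M, N, hM, hN, h⟩ := ih _ hG.dslope_self
      have hsplit : ∀ z, z ≠ p → G z / (z - p) ^ (n + 1) =
          G p / (z - p) ^ (n + 1) + dslope G p z / (z - p) ^ n := fun z hz => by
        have hz' : z - p ≠ 0 := sub_ne_zero.2 hz
        rw [dslope_of_ne _ hz, slope_def_field]
        field_simp
        ring
      rcases Nat.eq_zero_or_pos n with rfl | hn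
      · refine ⟨G p + c, M, N, hM, hN, ?_⟩
        filter_upwards [h, self_mem_nhdsWithin] with z hz hzp
        rw [hsplit z hzp, hz]
        ring
      · have hd : ∀ z, z ≠ p → HasDerivAt (fun z => -(G p / n) * ((z - p) ^ n)⁻¹)
            (G p / (z - p) ^ (n + 1)) z := fun z hz => by
          have hz' : z - p ≠ 0 := sub_ne_zero.2 hz
          have hn' : (n : ℂ) ≠ 0 := by exact_mod_cast hn.ne'
          have h1 := (((((hasDerivAt_id' z).sub_const p).fun_pow n).fun_inv
            (pow_ne_zero n hz')).const_mul (-(G p / n)))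
          refine h1.congr_deriv ?_
          obtain ⟨k, rfl⟩ : ∃ k, n = k + 1 := ⟨n - 1, by omega⟩
          rw [Nat.add_sub_cancel]
          field_simp
          ring
        refine ⟨c, fun z => -(G p / n) * ((z - p) ^ n)⁻¹ + M z, N,
          fun z hz => (hd z hz).differentiableAt.add (hM z hz), hN, ?_⟩
        filter_upwards [h, self_mem_nhdsWithin] with z hz hzp
        rw [hsplit z hzp, hz, ((hd z hzp).fun_add (hM z hzp).hasDerivAt).deriv]
        ring
  obtain ⟨n, hn⟩ := hf
  obtain ⟨c, M, N, hM, hN, h⟩ := key n _ hn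
  refine ⟨c, M, N, hM, hN, ?_⟩
  filter_upwards [h, self_mem_nhdsWithin] with z hz hzp
  rw [← hz, smul_eq_mul, mul_div_cancel_left₀ _ (pow_ne_zero n (sub_ne_zero.2 hzp))]

theorem HasResidue.of_principal_part {f M N : ℂ → ℂ} {p c : ℂ}
    (hM : ∀ z, z ≠ p → DifferentiableAt ℂ M z) (hN : AnalyticAt ℂ N p)
    (h : ∀ᶠ z in 𝓝[≠] p, f z = c / (z - p) + deriv M z + N z) : HasResidue f p c := by
  have h1 : HasResidue (deriv M) p 0 := HasResidue.of_hasDerivAt (M := M) <| by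
    filter_upwards [self_mem_nhdsWithin] with z hz using (hM z hz).hasDerivAt
  have h2 := ((HasResidue.const_div_sub p c).add h1).add (HasResidue.of_analyticAt hN)
  rw [add_zero, add_zero] at h2
  exact h2.congr (h.mono fun z hz => hz.symm)

theorem MeromorphicAt.exists_hasResidue {f : ℂ → ℂ} {p : ℂ} (hf : MeromorphicAt f p) :
    ∃ c, HasResidue f p c :=
  let ⟨c, _, _, hM, hN, h⟩ := hf.exists_principal_part
  ⟨c, HasResidue.of_principal_part hM hN h⟩

/-! ### The residue theorem for rectangles -/

/-- The integral of `f` along the boundary of the rectangle `[a, b] × [c, d]`, counterclockwise. -/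
noncomputable def rectIntegral (f : ℂ → ℂ) (a b c d : ℝ) : ℂ :=
  (∫ x in a..b, f (x + c * Complex.I)) - (∫ x in a..b, f (x + d * Complex.I)) +
    Complex.I * (∫ y in c..d, f (b + y * Complex.I)) -
      Complex.I * ∫ y in c..d, f (a + y * Complex.I)

/-- The boundary of the rectangle `[a, b] × [c, d]`. -/
def rectBoundary (a b c d : ℝ) : Set ℂ :=
  {z | z ∈ Icc a b ×ℂ Icc c d ∧ (z.re = a ∨ z.re = b ∨ z.im = c ∨ z.im = d)}

section rect

variable {f g : ℂ → ℂ} {a b c d : ℝ}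

theorem re_add_mul_I (x y : ℝ) : ((x : ℂ) + y * Complex.I).re = x := by simp

theorem im_add_mul_I (x y : ℝ) : ((x : ℂ) + y * Complex.I).im = y := by simp

theorem mem_rectBoundary_iff_horizontal {x y : ℝ} (hx : x ∈ Icc a b) (hy : y = c ∨ y = d)
    (hcd : c ≤ d) : (x + y * Complex.I : ℂ) ∈ rectBoundary a b c d := by
  refine ⟨⟨by simpa using hx, ?_⟩, ?_⟩
  · rcases hy with rfl | rfl <;> simp [hcd]
  · rcases hy with rfl | rfl <;> simp

theorem mem_rectBoundary_iff_vertical {x y : ℝ} (hy : y ∈ Icc c d) (hx : x = a ∨ x = b)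
    (hab : a ≤ b) : (x + y * Complex.I : ℂ) ∈ rectBoundary a b c d := by
  refine ⟨⟨?_, by simpa using hy⟩, ?_⟩
  · rcases hx with rfl | rfl <;> simp [hab]
  · rcases hx with rfl | rfl <;> simp

theorem continuousOn_horizontal (hcd : c ≤ d) (hf : ∀ z ∈ rectBoundary a b c d, ContinuousAt f z)
    {y : ℝ} (hy : y = c ∨ y = d) : ContinuousOn (fun x : ℝ => f (x + y * Complex.I)) (Icc a b) :=
  fun x hx => (ContinuousAt.comp (g := f) (f := fun x : ℝ => (x + y * Complex.I : ℂ))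
    (hf _ (mem_rectBoundary_iff_horizontal hx hy hcd)) (by fun_prop)).continuousWithinAt

theorem continuousOn_vertical (hab : a ≤ b) (hf : ∀ z ∈ rectBoundary a b c d, ContinuousAt f z)
    {x : ℝ} (hx : x = a ∨ x = b) : ContinuousOn (fun y : ℝ => f (x + y * Complex.I)) (Icc c d) :=
  fun y hy => (ContinuousAt.comp (g := f) (f := fun y : ℝ => (x + y * Complex.I : ℂ))
    (hf _ (mem_rectBoundary_iff_vertical hy hx hab)) (by fun_prop)).continuousWithinAt

theorem rectIntegral_add (hab : a ≤ b) (hcd : c ≤ d)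
    (hf : ∀ z ∈ rectBoundary a b c d, ContinuousAt f z)
    (hg : ∀ z ∈ rectBoundary a b c d, ContinuousAt g z) :
    rectIntegral (fun z => f z + g z) a b c d = rectIntegral f a b c d + rectIntegral g a b c d := by
  have H : ∀ {f : ℂ → ℂ}, (∀ z ∈ rectBoundary a b c d, ContinuousAt f z) → ∀ {y : ℝ},
      (y = c ∨ y = d) → IntervalIntegrable (fun x : ℝ => f (x + y * Complex.I)) volume a b :=
    fun hf _ hy => ContinuousOn.intervalIntegrable_of_Icc hab (continuousOn_horizontal hcd hf hy)
  have V : ∀ {f : ℂ → ℂ}, (∀ z ∈ rectBoundary a b c d, ContinuousAt f z) → ∀ {x : ℝ},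
      (x = a ∨ x = b) → IntervalIntegrable (fun y : ℝ => f (x + y * Complex.I)) volume c d :=
    fun hf _ hx => ContinuousOn.intervalIntegrable_of_Icc hcd (continuousOn_vertical hab hf hx)
  unfold rectIntegral
  rw [intervalIntegral.integral_add (H hf (Or.inl rfl)) (H hg (Or.inl rfl)),
    intervalIntegral.integral_add (H hf (Or.inr rfl)) (H hg (Or.inr rfl)),
    intervalIntegral.integral_add (V hf (Or.inl rfl)) (V hg (Or.inl rfl)),
    intervalIntegral.integral_add (V hf (Or.inr rfl)) (V hg (Or.inr rfl))]
  ring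

theorem rectIntegral_const_mul (k : ℂ) :
    rectIntegral (fun z => k * f z) a b c d = k * rectIntegral f a b c d := by
  unfold rectIntegral
  simp only [intervalIntegral.integral_const_mul]
  ring

theorem rectIntegral_congr (hab : a ≤ b) (hcd : c ≤ d) (h : EqOn f g (rectBoundary a b c d)) :
    rectIntegral f a b c d = rectIntegral g a b c d := by
  unfold rectIntegral
  congr 1; congr 1; congr 1
  · exact intervalIntegral.integral_congr fun x hx =>
      h (mem_rectBoundary_iff_horizontal (by rwa [uIcc_of_le hab] at hx) (Or.inl rfl) hcd)
  · exact intervalIntegral.integral_congr fun x hx =>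
      h (mem_rectBoundary_iff_horizontal (by rwa [uIcc_of_le hab] at hx) (Or.inr rfl) hcd)
  · congr 1
    exact intervalIntegral.integral_congr fun x hx =>
      h (mem_rectBoundary_iff_vertical (by rwa [uIcc_of_le hcd] at hx) (Or.inr rfl) hab)
  · congr 1
    exact intervalIntegral.integral_congr fun x hx =>
      h (mem_rectBoundary_iff_vertical (by rwa [uIcc_of_le hcd] at hx) (Or.inl rfl) hab)

theorem integral_horizontal_eq_sub {M : ℂ → ℂ} (hab : a ≤ b) {y : ℝ}
    (hM : ∀ x ∈ Icc a b, HasDerivAt M (f (x + y * Complex.I)) (x + y * Complex.I))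
    (hc : ContinuousOn (fun x : ℝ => f (x + y * Complex.I)) (Icc a b)) :
    ∫ x in a..b, f (x + y * Complex.I) = M (b + y * Complex.I) - M (a + y * Complex.I) := by
  refine intervalIntegral.integral_eq_sub_of_hasDerivAt
    (f := fun x : ℝ => M (x + y * Complex.I)) (fun x hx => ?_)
    (hc.intervalIntegrable_of_Icc hab)
  rw [uIcc_of_le hab] at hx
  have h1 : HasDerivAt (fun x : ℝ => (x + y * Complex.I : ℂ)) 1 x :=
    (Complex.ofRealCLM.hasDerivAt (x := x)).add_const _
  exact ((hM x hx).comp x h1).congr_deriv (mul_one _)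

theorem integral_vertical_eq_sub {M : ℂ → ℂ} (hcd : c ≤ d) {x : ℝ}
    (hM : ∀ y ∈ Icc c d, HasDerivAt M (f (x + y * Complex.I)) (x + y * Complex.I))
    (hc : ContinuousOn (fun y : ℝ => f (x + y * Complex.I)) (Icc c d)) :
    Complex.I * ∫ y in c..d, f (x + y * Complex.I) =
      M (x + d * Complex.I) - M (x + c * Complex.I) := by
  rw [← intervalIntegral.integral_const_mul]
  refine intervalIntegral.integral_eq_sub_of_hasDerivAt
    (f := fun y : ℝ => M (x + y * Complex.I)) (fun y hy => ?_)
    ((continuousOn_const.mul hc).intervalIntegrable_of_Icc hcd)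
  rw [uIcc_of_le hcd] at hy
  have h1 : HasDerivAt (fun y : ℝ => (x + y * Complex.I : ℂ)) Complex.I y := by
    simpa using ((Complex.ofRealCLM.hasDerivAt (x := y)).mul_const Complex.I).const_add (x : ℂ)
  exact ((hM y hy).comp y h1).congr_deriv (mul_comm _ _)

theorem rectIntegral_eq_zero_of_hasDerivAt {M : ℂ → ℂ} (hab : a ≤ b) (hcd : c ≤ d)
    (hM : ∀ z ∈ rectBoundary a b c d, HasDerivAt M (f z) z)
    (hf : ∀ z ∈ rectBoundary a b c d, ContinuousAt f z) : rectIntegral f a b c d = 0 := by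
  unfold rectIntegral
  rw [integral_horizontal_eq_sub hab
      (fun x hx => hM _ (mem_rectBoundary_iff_horizontal hx (Or.inl rfl) hcd))
      (continuousOn_horizontal hcd hf (Or.inl rfl)),
    integral_horizontal_eq_sub hab
      (fun x hx => hM _ (mem_rectBoundary_iff_horizontal hx (Or.inr rfl) hcd))
      (continuousOn_horizontal hcd hf (Or.inr rfl)),
    integral_vertical_eq_sub hcd
      (fun x hx => hM _ (mem_rectBoundary_iff_vertical hx (Or.inl rfl) hab))
      (continuousOn_vertical hab hf (Or.inl rfl)),
    integral_vertical_eq_sub hcd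
      (fun x hx => hM _ (mem_rectBoundary_iff_vertical hx (Or.inr rfl) hab))
      (continuousOn_vertical hab hf (Or.inr rfl))]
  ring

/-- On the bottom, right and top sides `log (z - p)` is a primitive, on the left side
`log (p - z)` is. -/
theorem rectIntegral_inv_sub {p : ℂ} (hp : p ∈ Ioo a b ×ℂ Ioo c d) :
    rectIntegral (fun z => (z - p)⁻¹) a b c d = 2 * Real.pi * Complex.I := by
  obtain ⟨⟨ha, hb⟩, hc, hd⟩ := hp
  have hab := (ha.trans hb).le
  have hcd := (hc.trans hd).le
  have hne : ∀ z ∈ rectBoundary a b c d, z - p ≠ 0 := by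
    rintro z ⟨-, h⟩ h0
    rw [sub_eq_zero] at h0
    subst h0
    rcases h with h | h | h | h <;> linarith
  have hf : ∀ z ∈ rectBoundary a b c d, ContinuousAt (fun z => (z - p)⁻¹) z := fun z hz =>
    ContinuousAt.inv₀ (by fun_prop) (hne z hz)
  have hlog : ∀ z, z - p ∈ Complex.slitPlane →
      HasDerivAt (fun z => Complex.log (z - p)) ((z - p)⁻¹) z := fun z hz => by
    simpa using ((hasDerivAt_id z).sub_const p).clog hz
  have hlog' : ∀ z, p - z ∈ Complex.slitPlane →
      HasDerivAt (fun z => Complex.log (p - z)) ((z - p)⁻¹) z := fun z hz => by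
    refine (((hasDerivAt_id' z).const_sub p).clog hz).congr_deriv ?_
    rw [← neg_sub p z, inv_neg, neg_div, one_div]
  unfold rectIntegral
  rw [integral_horizontal_eq_sub hab (f := fun z => (z - p)⁻¹) (M := fun z => Complex.log (z - p)) (y := c)
      (fun x _ => hlog _ (Or.inr (by simp [sub_ne_zero]; linarith)))
      (continuousOn_horizontal hcd hf (Or.inl rfl)),
    integral_horizontal_eq_sub hab (f := fun z => (z - p)⁻¹) (M := fun z => Complex.log (z - p)) (y := d)
      (fun x _ => hlog _ (Or.inr (by simp [sub_ne_zero]; linarith)))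
      (continuousOn_horizontal hcd hf (Or.inr rfl)),
    integral_vertical_eq_sub hcd (f := fun z => (z - p)⁻¹) (M := fun z => Complex.log (z - p)) (x := b)
      (fun x _ => hlog _ (Or.inl (by simp; linarith)))
      (continuousOn_vertical hab hf (Or.inr rfl)),
    integral_vertical_eq_sub hcd (f := fun z => (z - p)⁻¹) (M := fun z => Complex.log (p - z)) (x := a)
      (fun x _ => hlog' _ (Or.inl (by simp; linarith)))
      (continuousOn_vertical hab hf (Or.inl rfl))]
  have key : ∀ w : ℂ, 0 < w.im → Complex.log w - Complex.log (-w) = Real.pi * Complex.I := by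
    intro w hw
    simp only [Complex.log, norm_neg, Complex.arg_neg_eq_arg_sub_pi_of_im_pos hw]
    push_cast; ring
  have k1 := key (a + d * Complex.I - p) (by simp; linarith)
  have k2 := key (p - (a + c * Complex.I)) (by simp; linarith)
  simp only [neg_sub] at k1 k2
  linear_combination k1 + k2

/-- The residue theorem for a rectangle, with finitely many poles in its interior. -/
theorem rectIntegral_eq_sum_residues (hab : a < b) (hcd : c < d) (S : Finset ℂ)
    (hS : ∀ p ∈ S, p ∈ Ioo a b ×ℂ Ioo c d) (hmer : ∀ p ∈ S, MeromorphicAt f p)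
    (han : ∀ z ∈ Icc a b ×ℂ Icc c d, z ∉ S → AnalyticAt ℂ f z) (res : ℂ → ℂ)
    (hres : ∀ p ∈ S, HasResidue f p (res p)) :
    rectIntegral f a b c d = 2 * Real.pi * Complex.I * ∑ p ∈ S, res p := by
  classical
  induction S using Finset.induction_on generalizing f with
  | empty =>
    have h := Complex.integral_boundary_rect_eq_zero_of_differentiableOn f (a + c * Complex.I)
      (b + d * Complex.I) (by
        simp only [re_add_mul_I, im_add_mul_I, uIcc_of_le hab.le, uIcc_of_le hcd.le]
        exact fun z hz => (han z hz (by simp)).differentiableAt.differentiableWithinAt)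
    simp only [re_add_mul_I, im_add_mul_I, smul_eq_mul] at h
    rw [rectIntegral, h]
    simp
  | insert p S hpS ih =>
    obtain ⟨k, M, N, hM, hN, hf⟩ := (hmer p (by simp)).exists_principal_part
    have hk : k = res p := (HasResidue.of_principal_part hM hN hf).unique (hres p (by simp))
    have hpI := hS p (by simp)
    have hMan : ∀ z, z ≠ p → AnalyticAt ℂ (deriv M) z := fun z hz =>
      (DifferentiableOn.analyticAt (s := {p}ᶜ) (fun w hw => (hM w hw).differentiableWithinAt)
        (isOpen_compl_singleton.mem_nhds hz)).deriv
    have hinv : ∀ z, z ≠ p → AnalyticAt ℂ (fun z => (z - p)⁻¹) z := fun z hz =>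
      AnalyticAt.inv (by fun_prop) (sub_ne_zero.2 hz)
    set P : ℂ → ℂ := fun z => k * (z - p)⁻¹ + deriv M z with hP
    have hPan : ∀ z, z ≠ p → AnalyticAt ℂ P z := fun z hz =>
      (analyticAt_const.mul (hinv z hz)).add (hMan z hz)
    set f₁ : ℂ → ℂ := Function.update (fun z => f z - P z) p (N p) with hf₁
    have hf₁ne : ∀ z, z ≠ p → f₁ =ᶠ[𝓝 z] fun z => f z - P z := fun z hz => by
      filter_upwards [isOpen_compl_singleton.mem_nhds hz] with w hw
      exact Function.update_of_ne hw _ _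
    have hf₁p : AnalyticAt ℂ f₁ p := by
      refine hN.congr ?_
      filter_upwards [eventually_nhdsWithin_iff.1 hf] with z hz
      by_cases hzp : z = p
      · rw [hzp, hf₁, Function.update_self]
      · rw [hf₁, Function.update_of_ne hzp, hz hzp, hP]
        simp only [div_eq_mul_inv]
        ring
    have hne : ∀ z ∈ rectBoundary a b c d, z ≠ p := by
      rintro z ⟨-, h⟩ rfl
      obtain ⟨⟨h1, h2⟩, h3, h4⟩ := hpI
      rcases h with h | h | h | h <;> linarith
    have hneS : ∀ q ∈ S, q ≠ p := fun q hq h => hpS (h ▸ hq)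
    have hbd : ∀ z ∈ rectBoundary a b c d, z ∉ insert p S := by
      intro z hz hzS
      obtain ⟨⟨h1, h2⟩, h3, h4⟩ := hS z hzS
      rcases hz.2 with h | h | h | h <;> linarith
    have hI := ih (f := f₁) (fun q hq => hS q (by simp [hq]))
      (fun q hq => ((hmer q (by simp [hq])).sub (hPan q (hneS q hq)).meromorphicAt).congr
        ((hf₁ne q (hneS q hq)).symm.filter_mono nhdsWithin_le_nhds))
      (fun z hz hzS => by
        by_cases hzp : z = p
        · rwa [hzp]
        · exact ((han z hz (by simp [hzp, hzS])).sub (hPan z hzp)).congr (hf₁ne z hzp).symm)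
      (fun q hq => by
        have h := (hres q (by simp [hq])).add
          ((HasResidue.of_analyticAt (hPan q (hneS q hq))).const_mul (-1))
        rw [mul_zero, add_zero] at h
        refine h.congr ?_
        filter_upwards [(hf₁ne q (hneS q hq)).filter_mono nhdsWithin_le_nhds] with z hz
        rw [hz]; ring)
    have hMint : rectIntegral (deriv M) a b c d = 0 :=
      rectIntegral_eq_zero_of_hasDerivAt hab.le hcd.le
        (fun z hz => (hM z (hne z hz)).hasDerivAt) fun z hz => (hMan z (hne z hz)).continuousAt
    have hPint : rectIntegral P a b c d = 2 * Real.pi * Complex.I * k := by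
      rw [hP, rectIntegral_add (f := fun z => k * (z - p)⁻¹) hab.le hcd.le
        (fun z hz => (analyticAt_const.mul (hinv z (hne z hz))).continuousAt)
        fun z hz => (hMan z (hne z hz)).continuousAt, hMint, rectIntegral_const_mul,
        rectIntegral_inv_sub hpI]
      ring
    have hsum : rectIntegral f a b c d = rectIntegral (fun z => f₁ z + P z) a b c d :=
      rectIntegral_congr hab.le hcd.le fun z hz => by
        simp only [hf₁, Function.update_of_ne (hne z hz)]
        ring
    rw [hsum, rectIntegral_add hab.le hcd.le
      (fun z hz => ((han z hz.1 (hbd z hz)).sub (hPan z (hne z hz))).congr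
        (hf₁ne z (hne z hz)).symm |>.continuousAt)
      (fun z hz => (hPan z (hne z hz)).continuousAt), hI, hPint, hk, Finset.sum_insert hpS]
    ring

end rect

/-! ### Inversion of Laplace transforms along a Hankel contour -/

/-- The Laplace transform of a superposition of exponentials `e^{tζ}`. -/
theorem isLaplace_integral_exp {Ω : Type*} [MeasurableSpace Ω] {μ : Measure Ω} [SFinite μ]
    {ζ k : Ω → ℂ} {c : ℝ} (hζ : AEStronglyMeasurable ζ μ) (hk : AEStronglyMeasurable k μ)
    (hc : ∀ᵐ p ∂μ, (ζ p).re ≤ c)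
    (hint : ∀ σ, c < σ → Integrable (fun p => ‖k p‖ / (σ - (ζ p).re)) μ) :
    IsLaplace (fun t => ∫ p, Complex.exp (t * ζ p) * k p ∂μ) c (fun s => ∫ p, k p / (s - ζ p) ∂μ) := by
  intro s hs
  have heq : ∀ (t : ℝ) p, Complex.exp (-(s * t)) * (Complex.exp (t * ζ p) * k p) =
      Complex.exp ((ζ p - s) * t) * k p := fun t p => by
    rw [← mul_assoc, ← Complex.exp_add]; ring_nf
  have hmeas : AEStronglyMeasurable (fun q : ℝ × Ω => Complex.exp ((ζ q.2 - s) * q.1) * k q.2)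
      ((volume.restrict (Ioi 0)).prod μ) := by
    refine AEStronglyMeasurable.mul ?_ hk.comp_snd
    refine Complex.continuous_exp.comp_aestronglyMeasurable ?_
    refine (hζ.comp_snd.sub aestronglyMeasurable_const).mul ?_
    exact (Complex.measurable_ofReal.comp measurable_fst).aestronglyMeasurable
  have hexp : ∀ p, (ζ p).re ≤ c → (ζ p - s).re < 0 := fun p hp => by
    simp only [Complex.sub_re]; linarith
  have hI : Integrable (fun q : ℝ × Ω => Complex.exp ((ζ q.2 - s) * q.1) * k q.2)
      ((volume.restrict (Ioi 0)).prod μ) := by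
    rw [integrable_prod_iff' hmeas]
    constructor
    · filter_upwards [hc] with p hp
      exact (integrableOn_exp_mul_complex_Ioi (hexp p hp) 0).mul_const _
    · refine (hint s.re hs).congr ?_
      filter_upwards [hc] with p hp
      have h1 : ∀ t : ℝ, ‖Complex.exp ((ζ p - s) * t) * k p‖ =
          Real.exp ((ζ p - s).re * t) * ‖k p‖ := fun t => by
        rw [norm_mul, Complex.norm_exp]; simp
      simp only [h1]
      rw [integral_mul_const, integral_exp_mul_Ioi (hexp p hp) 0]
      simp only [mul_zero, Real.exp_zero, Complex.sub_re]
      have : s.re - (ζ p).re ≠ 0 := by linarith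
      have : (ζ p).re - s.re ≠ 0 := by linarith
      field_simp
      ring
  have h2 : ∀ t : ℝ, Complex.exp (-(s * t)) * ∫ p, Complex.exp (t * ζ p) * k p ∂μ =
      ∫ p, Complex.exp ((ζ p - s) * t) * k p ∂μ := fun t => by
    rw [← integral_const_mul]
    simp only [heq]
  simp only [h2]
  refine ⟨hI.integral_prod_left, ?_⟩
  rw [integral_integral_swap hI]
  refine integral_congr_ae ?_
  filter_upwards [hc] with p hp
  rw [integral_mul_const, integral_exp_mul_complex_Ioi (hexp p hp) 0]
  have : s - ζ p ≠ 0 := fun h => by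
    have := hexp p hp
    rw [← neg_sub s (ζ p), h] at this
    simp at this
  have : ζ p - s ≠ 0 := fun h => by
    have := hexp p hp
    rw [h] at this
    simp at this
  simp only [Complex.ofReal_zero, mul_zero, Complex.exp_zero]
  field_simp
  ring

theorem Real.exp_neg_le_rpow_neg {y γ : ℝ} (hy : 0 < y) (h0 : 0 ≤ γ) (h1 : γ ≤ 1) :
    Real.exp (-y) ≤ y ^ (-γ) := by
  rw [Real.exp_neg, Real.rpow_neg hy.le]
  refine inv_anti₀ (Real.rpow_pos_of_pos hy γ) ?_
  rcases le_total y 1 with h | h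
  · exact (Real.rpow_le_one hy.le h h0).trans (Real.one_le_exp hy.le)
  · calc y ^ γ ≤ y ^ (1 : ℝ) := Real.rpow_le_rpow_of_exponent_le h h1
      _ ≤ Real.exp y := by rw [Real.rpow_one]; linarith [Real.add_one_le_exp y]

namespace PowerBounded

variable {f g : ℝ → ℂ} {a : ℝ}

theorem add (hf : PowerBounded f a) (hg : PowerBounded g a) :
    PowerBounded (fun t => f t + g t) a := by
  intro T hT
  obtain ⟨C₁, h₁⟩ := hf T hT
  obtain ⟨C₂, h₂⟩ := hg T hT
  exact ⟨C₁ + C₂, fun t ht => by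
    rw [add_mul]; exact (norm_add_le _ _).trans (add_le_add (h₁ t ht) (h₂ t ht))⟩

theorem const_mul (c : ℂ) (hf : PowerBounded f a) : PowerBounded (fun t => c * f t) a := by
  intro T hT
  obtain ⟨C₁, h₁⟩ := hf T hT
  exact ⟨‖c‖ * C₁, fun t ht => by
    rw [norm_mul, mul_assoc]; exact mul_le_mul_of_nonneg_left (h₁ t ht) (norm_nonneg _)⟩

theorem of_bounded (ha : a ≤ 1) (h : ∀ T : ℝ, 0 < T → ∃ C : ℝ, ∀ t ∈ Ioc 0 T, ‖f t‖ ≤ C) :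
    PowerBounded f a := by
  intro T hT
  obtain ⟨C, hC⟩ := h T hT
  refine ⟨|C| * T ^ (1 - a), fun t ht => (hC t ht).trans ?_⟩
  have h1 : 1 ≤ T ^ (1 - a) * t ^ (a - 1) := by
    rw [show a - 1 = -(1 - a) by ring, Real.rpow_neg ht.1.le, ← div_eq_mul_inv, ← Real.div_rpow hT.le ht.1.le]
    exact Real.one_le_rpow ((one_le_div ht.1).2 ht.2) (by linarith)
  calc C ≤ |C| * 1 := by rw [mul_one]; exact le_abs_self C
    _ ≤ |C| * (T ^ (1 - a) * t ^ (a - 1)) := by gcongr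
    _ = _ := by ring

theorem mono_norm (hf : PowerBounded f a) (h : ∀ t, ‖g t‖ ≤ ‖f t‖) : PowerBounded g a := by
  intro T hT
  obtain ⟨C, hC⟩ := hf T hT
  exact ⟨C, fun t ht => (h t).trans (hC t ht)⟩

end PowerBounded

/-- The contribution of the edge `s = e^{x+iθ}`, `x > L`, to the inverse Laplace transform of
`s ↦ K (log s)`; the integration variable is `x = log |s|`. -/
noncomputable def hankelEdge (K : ℂ → ℂ) (L θ t : ℝ) : ℂ :=
  ∫ x in Ioi L, Complex.exp (t * Complex.exp (x + θ * Complex.I)) *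
    (Complex.exp (x + θ * Complex.I) * K (x + θ * Complex.I))

/-- The contribution of the circle `|s| = e^L` to the inverse Laplace transform of
`s ↦ K (log s)`. -/
noncomputable def hankelArc (K : ℂ → ℂ) (L t : ℝ) : ℂ :=
  ∫ y in (-Real.pi)..Real.pi, Complex.exp (t * Complex.exp (L + y * Complex.I)) *
    (Complex.I * (Complex.exp (L + y * Complex.I) * K (L + y * Complex.I)))

/-- The inverse Laplace transform of `s ↦ K (log s)`, as an integral along the Hankel contour which
comes in along the lower edge of the cut, runs around the circle `|s| = e^L` and leaves along the
upper edge. -/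
noncomputable def hankel (K : ℂ → ℂ) (L t : ℝ) : ℂ :=
  (2 * Real.pi * Complex.I)⁻¹ *
    (hankelArc K L t + (hankelEdge K L Real.pi t + -1 * hankelEdge K L (-Real.pi) t))

theorem exp_edge {θ : ℝ} (hθ : θ = Real.pi ∨ θ = -Real.pi) (x : ℝ) :
    Complex.exp (x + θ * Complex.I) = -(Real.exp x : ℂ) := by
  rw [Complex.exp_add, Complex.ofReal_exp]
  rcases hθ with rfl | rfl
  · rw [Complex.exp_pi_mul_I]; ring
  · rw [Complex.ofReal_neg, neg_mul, Complex.exp_neg, Complex.exp_pi_mul_I]; norm_num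

theorem abs_le_pi_of_edge {θ : ℝ} (hθ : θ = Real.pi ∨ θ = -Real.pi) : |θ| ≤ Real.pi := by
  rcases hθ with rfl | rfl
  · exact (abs_of_pos Real.pi_pos).le
  · rw [abs_neg]; exact (abs_of_pos Real.pi_pos).le

/-- On the part `Re z ≥ L` of the closed strip `|Im z| ≤ π` the function `K` is analytic and
decays like `e^{-β Re z}`. In terms of `s = e^z` this is decay like `|s|^{-β}` on the cut plane,
the edges of the cut included. -/
structure DecaysOnStrip (K : ℂ → ℂ) (L β C : ℝ) : Prop where
  analyticAt : ∀ z : ℂ, L ≤ z.re → |z.im| ≤ Real.pi → AnalyticAt ℂ K z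
  bound : ∀ z : ℂ, L ≤ z.re → |z.im| ≤ Real.pi → ‖K z‖ ≤ C * Real.exp (-β * z.re)

namespace DecaysOnStrip

variable {K : ℂ → ℂ} {L β C : ℝ} {θ : ℝ}

theorem nonneg (h : DecaysOnStrip K L β C) : 0 ≤ C := by
  have h1 := (norm_nonneg _).trans (h.bound L (by simp) (by simp [Real.pi_nonneg]))
  exact nonneg_of_mul_nonneg_left h1 (Real.exp_pos _)

theorem continuousOn_edge (h : DecaysOnStrip K L β C) (hθ : |θ| ≤ Real.pi) :
    ContinuousOn (fun x : ℝ => K (x + θ * Complex.I)) (Ici L) := fun x hx =>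
  (ContinuousAt.comp (g := K) (f := fun x : ℝ => (x + θ * Complex.I : ℂ))
    (h.analyticAt _ (by simpa using hx) (by simpa using hθ)).continuousAt
    (by fun_prop)).continuousWithinAt

theorem continuousOn_arc (h : DecaysOnStrip K L β C) :
    ContinuousOn (fun y : ℝ => K (L + y * Complex.I)) (Icc (-Real.pi) Real.pi) := fun y hy =>
  (ContinuousAt.comp (g := K) (f := fun y : ℝ => (L + y * Complex.I : ℂ))
    (h.analyticAt _ (by simp) (by simpa using abs_le.2 hy)).continuousAt
    (by fun_prop)).continuousWithinAt

theorem norm_edge_le (h : DecaysOnStrip K L β C) (hθ : θ = Real.pi ∨ θ = -Real.pi) {x : ℝ}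
    (hx : L ≤ x) : ‖Complex.exp (x + θ * Complex.I) * K (x + θ * Complex.I)‖ ≤
      C * (Real.exp x * Real.exp (-β * x)) := by
  have h1 := h.bound (x + θ * Complex.I) (by simpa using hx)
    (by simpa using abs_le_pi_of_edge hθ)
  rw [re_add_mul_I] at h1
  rw [norm_mul, exp_edge hθ, norm_neg, Complex.norm_real, Real.norm_of_nonneg (Real.exp_pos x).le]
  calc _ ≤ Real.exp x * (C * Real.exp (-β * x)) := by gcongr
    _ = _ := by ring

theorem continuousOn_edge' (h : DecaysOnStrip K L β C) (hθ : |θ| ≤ Real.pi) :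
    ContinuousOn (fun x : ℝ => Complex.exp (x + θ * Complex.I) * K (x + θ * Complex.I)) (Ici L) :=
  (by fun_prop : Continuous fun x : ℝ => Complex.exp (x + θ * Complex.I)).continuousOn.mul
    (h.continuousOn_edge hθ)

theorem continuousOn_arc' (h : DecaysOnStrip K L β C) :
    ContinuousOn (fun y : ℝ => Complex.I * (Complex.exp (L + y * Complex.I) *
      K (L + y * Complex.I))) (Icc (-Real.pi) Real.pi) :=
  continuousOn_const.mul ((by fun_prop :
    Continuous fun y : ℝ => Complex.exp (L + y * Complex.I)).continuousOn.mul h.continuousOn_arc)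

/-- The edge integrand at time `t` is at most `t^{β/2-1} e^{-βx/2}`, up to a constant. -/
theorem norm_edge_integrand_le (h : DecaysOnStrip K L β C) (hβ : 0 < β) (hβ1 : β < 1)
    (hθ : θ = Real.pi ∨ θ = -Real.pi) {x t : ℝ} (hx : L ≤ x) (ht : 0 < t) :
    ‖Complex.exp (t * Complex.exp (x + θ * Complex.I)) *
      (Complex.exp (x + θ * Complex.I) * K (x + θ * Complex.I))‖ ≤
      C * t ^ (β / 2 - 1) * Real.exp (-(β / 2) * x) := by
  rw [norm_mul]
  have hex := Real.exp_pos x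
  have h1 : ‖Complex.exp (t * Complex.exp (x + θ * Complex.I))‖ ≤
      t ^ (β / 2 - 1) * Real.exp ((β / 2 - 1) * x) := by
    rw [exp_edge hθ, Complex.norm_exp]
    have := Real.exp_neg_le_rpow_neg (y := t * Real.exp x) (γ := 1 - β / 2) (by positivity)
      (by linarith) (by linarith)
    rw [neg_sub, Real.mul_rpow ht.le hex.le, ← Real.exp_mul] at this
    convert this using 2
    · simp [Complex.exp_ofReal_re]
    · ring_nf
  refine (mul_le_mul h1 (h.norm_edge_le hθ hx) (norm_nonneg _) ?_).trans_eq ?_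
  · have := Real.rpow_nonneg ht.le (β / 2 - 1)
    positivity
  · have : Real.exp (-(β / 2) * x) =
        Real.exp ((β / 2 - 1) * x) * (Real.exp x * Real.exp (-β * x)) := by
      rw [← Real.exp_add, ← Real.exp_add]; ring_nf
    rw [this]; ring

theorem aestronglyMeasurable_edge (h : DecaysOnStrip K L β C) (hθ : |θ| ≤ Real.pi) (t : ℝ) :
    AEStronglyMeasurable (fun x : ℝ => Complex.exp (t * Complex.exp (x + θ * Complex.I)) *
      (Complex.exp (x + θ * Complex.I) * K (x + θ * Complex.I))) (volume.restrict (Ioi L)) :=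
  (ContinuousOn.mul (by fun_prop) ((h.continuousOn_edge' hθ).mono
    Ioi_subset_Ici_self)).aestronglyMeasurable measurableSet_Ioi

theorem integrableOn_exp_edge (hβ : 0 < β) (L : ℝ) :
    IntegrableOn (fun x : ℝ => Real.exp (-β * x)) (Ioi L) :=
  integrableOn_exp_mul_Ioi (by linarith) L

theorem integrableOn_edge (h : DecaysOnStrip K L β C) (hβ : 0 < β) (hβ1 : β < 1)
    (hθ : θ = Real.pi ∨ θ = -Real.pi) {t : ℝ} (ht : 0 < t) :
    IntegrableOn (fun x : ℝ => Complex.exp (t * Complex.exp (x + θ * Complex.I)) *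
      (Complex.exp (x + θ * Complex.I) * K (x + θ * Complex.I))) (Ioi L) := by
  refine ((integrableOn_exp_edge (half_pos hβ) L).const_mul (C * t ^ (β / 2 - 1))).mono'
    (h.aestronglyMeasurable_edge (abs_le_pi_of_edge hθ) t) ?_
  filter_upwards [ae_restrict_mem measurableSet_Ioi] with x hx
  exact h.norm_edge_integrand_le hβ hβ1 hθ (le_of_lt hx) ht

theorem powerBounded_edge (h : DecaysOnStrip K L β C) (hβ : 0 < β) (hβ1 : β < 1)
    (hθ : θ = Real.pi ∨ θ = -Real.pi) : PowerBounded (hankelEdge K L θ) (β / 2) := by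
  intro T _
  refine ⟨∫ x in Ioi L, C * Real.exp (-(β / 2) * x), fun t ht => ?_⟩
  rw [← integral_mul_const]
  refine norm_integral_le_of_norm_le
    (((integrableOn_exp_edge (half_pos hβ) L).const_mul C).mul_const _) ?_
  filter_upwards [ae_restrict_mem measurableSet_Ioi] with x hx
  refine (h.norm_edge_integrand_le hβ hβ1 hθ (le_of_lt hx) ht.1).trans_eq ?_
  ring

theorem continuousOn_hankelEdge (h : DecaysOnStrip K L β C) (hβ : 0 < β) (hβ1 : β < 1)
    (hθ : θ = Real.pi ∨ θ = -Real.pi) : ContinuousOn (hankelEdge K L θ) (Ioi 0) := by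
  intro t₀ ht₀
  have ht₀ : 0 < t₀ := ht₀
  refine ContinuousAt.continuousWithinAt ?_
  refine continuousAt_of_dominated
    (bound := fun x => C * (t₀ / 2) ^ (β / 2 - 1) * Real.exp (-(β / 2) * x))
    (Eventually.of_forall fun t => h.aestronglyMeasurable_edge (abs_le_pi_of_edge hθ) t) ?_
    ((integrableOn_exp_edge (half_pos hβ) L).const_mul _)
    (Eventually.of_forall fun x => by fun_prop)
  filter_upwards [lt_mem_nhds (half_lt_self ht₀)] with t ht
  filter_upwards [ae_restrict_mem measurableSet_Ioi] with x hx
  refine (h.norm_edge_integrand_le hβ hβ1 hθ (le_of_lt hx) (by linarith)).trans ?_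
  have := h.nonneg
  gcongr ?_ * _
  exact mul_le_mul_of_nonneg_left
    (Real.rpow_le_rpow_of_nonpos (by linarith) ht.le (by linarith)) this

theorem continuous_hankelArc (h : DecaysOnStrip K L β C) : Continuous (hankelArc K L) := by
  obtain ⟨D, hD⟩ := isCompact_Icc.exists_bound_of_continuousOn h.continuousOn_arc'
  refine continuous_iff_continuousAt.2 fun t₀ => ?_
  unfold hankelArc
  simp only [intervalIntegral.integral_of_le (neg_le_self Real.pi_nonneg)]
  have hmeas := (h.continuousOn_arc'.mono Ioc_subset_Icc_self).aestronglyMeasurable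
    (μ := volume) measurableSet_Ioc
  refine continuousAt_of_dominated
    (bound := fun _ => Real.exp ((|t₀| + 1) * Real.exp L) * D)
    (Eventually.of_forall fun t => ?_) ?_ (integrable_const _)
    (Eventually.of_forall fun x => by fun_prop)
  · exact (Continuous.aestronglyMeasurable (by fun_prop)).mul hmeas
  filter_upwards [Metric.ball_mem_nhds t₀ one_pos] with t ht
  filter_upwards [ae_restrict_mem measurableSet_Ioc] with y hy
  rw [norm_mul]
  refine mul_le_mul ?_ (hD y (Ioc_subset_Icc_self hy)) (norm_nonneg _) (Real.exp_pos _).le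
  refine (Complex.norm_exp_le_exp_norm _).trans (Real.exp_le_exp.2 ?_)
  rw [norm_mul, Complex.norm_exp, re_add_mul_I, Complex.norm_real]
  gcongr
  have : ‖t - t₀‖ < 1 := by simpa [dist_eq_norm] using ht
  have h2 := norm_add_le (t - t₀) t₀
  rw [sub_add_cancel] at h2
  rw [Real.norm_eq_abs, Real.norm_eq_abs, Real.norm_eq_abs] at h2
  rw [Real.norm_eq_abs] at this
  rw [Real.norm_eq_abs]
  linarith

theorem continuousOn_hankel (h : DecaysOnStrip K L β C) (hβ : 0 < β) (hβ1 : β < 1) :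
    ContinuousOn (hankel K L) (Ioi 0) :=
  continuousOn_const.mul (h.continuous_hankelArc.continuousOn.add
    ((h.continuousOn_hankelEdge hβ hβ1 (Or.inl rfl)).add
      (continuousOn_const.mul (h.continuousOn_hankelEdge hβ hβ1 (Or.inr rfl)))))

theorem powerBounded_hankel (h : DecaysOnStrip K L β C) (hβ : 0 < β) (hβ1 : β < 1) :
    PowerBounded (hankel K L) (β / 2) := by
  refine ((PowerBounded.of_bounded (by linarith) fun T _ => ?_).add
    ((h.powerBounded_edge hβ hβ1 (Or.inl rfl)).add
      ((h.powerBounded_edge hβ hβ1 (Or.inr rfl)).const_mul (-1)))).const_mul _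
  obtain ⟨D, hD⟩ := (isCompact_Icc (a := (0 : ℝ)) (b := T)).exists_bound_of_continuousOn
    h.continuous_hankelArc.continuousOn
  exact ⟨D, fun t ht => hD t (Ioc_subset_Icc_self ht)⟩

/-- The kernel of the transform of the contour integral. -/
theorem exp_sub_ne_zero {s z : ℂ} (hs : 0 < s.re) (hz : |z.im| ≤ Real.pi)
    (hne : z ≠ Complex.log s) : s - Complex.exp z ≠ 0 := by
  intro h0
  have hs0 : s ≠ 0 := fun h => by simp [h] at hs
  rw [sub_eq_zero, ← Complex.exp_log hs0, Complex.exp_eq_exp_iff_exists_int] at h0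
  obtain ⟨n, hn⟩ := h0
  have harg : |(Complex.log s).im| < Real.pi / 2 := by
    rw [Complex.log_im]; exact Complex.abs_arg_lt_pi_div_two_iff.2 (Or.inl hs)
  have him := congrArg Complex.im hn
  simp only [Complex.add_im, Complex.mul_im, Complex.intCast_re, Complex.intCast_im] at him
  simp at him
  have hn0 : n = 0 := by
    by_contra hn0
    have h1 : (1 : ℝ) ≤ |(n : ℝ)| := by exact_mod_cast Int.one_le_abs hn0
    have h2 : (n : ℝ) * (2 * Real.pi) = (Complex.log s).im - z.im := by
      rw [him]; ring
    have h3 := abs_sub (Complex.log s).im z.im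
    rw [← h2, abs_mul, abs_of_pos (by positivity : 0 < 2 * Real.pi)] at h3
    nlinarith [Real.pi_pos]
  subst hn0
  apply hne
  simp at hn
  exact hn.symm

theorem isLaplace_hankel (h : DecaysOnStrip K L β C) (hβ : 0 < β) (hβ1 : β < 1) :
    IsLaplace (hankel K L) (Real.exp L) (fun s => K (Complex.log s)) := by
  have hC := h.nonneg
  -- the transforms of the three parts of the contour
  have harc : IsLaplace (hankelArc K L) (Real.exp L) (fun s =>
      ∫ y in (-Real.pi)..Real.pi, Complex.I * (Complex.exp (L + y * Complex.I) *
        K (L + y * Complex.I)) / (s - Complex.exp (L + y * Complex.I))) := by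
    unfold hankelArc
    simp only [intervalIntegral.integral_of_le (neg_le_self Real.pi_nonneg)]
    refine isLaplace_integral_exp (Continuous.aestronglyMeasurable (by fun_prop))
      ((h.continuousOn_arc'.mono Ioc_subset_Icc_self).aestronglyMeasurable measurableSet_Ioc)
      (Eventually.of_forall fun y => ?_) fun σ hσ => ?_
    · refine (Complex.re_le_norm _).trans_eq ?_
      rw [Complex.norm_exp, re_add_mul_I]
    · refine ContinuousOn.integrableOn_Icc (ContinuousOn.div h.continuousOn_arc'.norm
        (by fun_prop) fun y hy => ?_) |>.mono_set Ioc_subset_Icc_self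
      have h1 := Complex.re_le_norm (Complex.exp (L + y * Complex.I))
      rw [Complex.norm_exp, re_add_mul_I] at h1
      linarith
  have hedge : ∀ θ : ℝ, θ = Real.pi ∨ θ = -Real.pi → IsLaplace (hankelEdge K L θ) (Real.exp L)
      (fun s => ∫ x in Ioi L, Complex.exp (x + θ * Complex.I) * K (x + θ * Complex.I) /
        (s - Complex.exp (x + θ * Complex.I))) := by
    intro θ hθ
    refine (isLaplace_integral_exp (c := 0) (Continuous.aestronglyMeasurable (by fun_prop))
      (((h.continuousOn_edge' (abs_le_pi_of_edge hθ)).mono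
        Ioi_subset_Ici_self).aestronglyMeasurable measurableSet_Ioi)
      (Eventually.of_forall fun x => ?_) fun σ hσ => ?_).mono (Real.exp_pos L).le
    · rw [exp_edge hθ, Complex.neg_re, Complex.ofReal_re]
      linarith [Real.exp_pos x]
    · refine ((integrableOn_exp_edge hβ L).const_mul C).mono' ?_ ?_
      · refine (ContinuousOn.div (((h.continuousOn_edge' (abs_le_pi_of_edge hθ)).mono
          Ioi_subset_Ici_self).norm) (by fun_prop) fun x _ => ?_).aestronglyMeasurable
          measurableSet_Ioi
        rw [exp_edge hθ, Complex.neg_re, Complex.ofReal_re]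
        linarith [Real.exp_pos x]
      · filter_upwards [ae_restrict_mem measurableSet_Ioi] with x hx
        have h1 := h.norm_edge_le hθ (le_of_lt hx)
        have hex := Real.exp_pos x
        rw [norm_div, norm_norm, exp_edge hθ, Complex.neg_re, Complex.ofReal_re,
          Real.norm_of_nonneg (by linarith : 0 ≤ σ - -Real.exp x), div_le_iff₀ (by linarith)]
        rw [exp_edge hθ] at h1
        refine h1.trans ?_
        have : 0 ≤ C * Real.exp (-β * x) := by positivity
        nlinarith
  refine ((harc.sub (((hedge (-Real.pi) (Or.inr rfl)).sub
    (hedge Real.pi (Or.inl rfl))))).const_mul (2 * Real.pi * Complex.I)⁻¹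
    |>.congr_left fun t _ => ?_).congr_right fun s hs => ?_
  · rw [hankel]; ring
  -- Cauchy's theorem on the rectangles `[L, M] × [-π, π]`, with a simple pole at `log s`
  have hsre : 0 < s.re := (Real.exp_pos L).trans hs
  have hs0 : s ≠ 0 := fun h => by simp [h] at hsre
  have hlogre : L < (Complex.log s).re := by
    rw [Complex.log_re, Real.lt_log_iff_exp_lt (norm_pos_iff.2 hs0)]
    exact hs.trans_le (Complex.re_le_norm s)
  have hlogim : |(Complex.log s).im| < Real.pi := by
    rw [Complex.log_im]
    exact (Complex.abs_arg_lt_pi_div_two_iff.2 (Or.inl hsre)).trans (by linarith [Real.pi_pos])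
  set J : ℂ → ℂ := fun z => Complex.exp z * K z / (s - Complex.exp z) with hJ
  have hrect : ∀ M : ℝ, (Complex.log s).re < M →
      rectIntegral J L M (-Real.pi) Real.pi = -(2 * Real.pi * Complex.I * K (Complex.log s)) := by
    intro M hM
    have hKan := h.analyticAt _ hlogre.le hlogim.le
    have hd : deriv (fun z => s - Complex.exp z) (Complex.log s) = -s := by
      simp [Complex.exp_log hs0]
    have hres : HasResidue J (Complex.log s) (-K (Complex.log s)) := by
      have := HasResidue.div_of_simple_zero (f := fun z => Complex.exp z * K z)
        (D := fun z => s - Complex.exp z) (p := Complex.log s)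
        (by fun_prop) (by fun_prop)
        (by simp [Complex.exp_log hs0]) (by rw [hd]; simpa using hs0)
      rw [hd, Complex.exp_log hs0, div_neg, mul_div_cancel_left₀ _ hs0] at this
      exact this
    have hJan : ∀ z ∈ Icc L M ×ℂ Icc (-Real.pi) Real.pi, z ∉ ({Complex.log s} : Finset ℂ) →
        AnalyticAt ℂ J z := by
      intro z hz hzs
      have := h.analyticAt z hz.1.1 (abs_le.2 hz.2)
      refine AnalyticAt.div (by fun_prop) (by fun_prop) ?_
      exact exp_sub_ne_zero hsre (abs_le.2 hz.2) (by simpa using hzs)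
    rw [rectIntegral_eq_sum_residues (S := {Complex.log s}) (res := fun _ => -K (Complex.log s))
      (hlogre.trans hM) (by linarith [Real.pi_pos]) (by
        intro p hp
        rw [Finset.mem_singleton] at hp
        subst hp
        exact ⟨⟨hlogre, hM⟩, abs_lt.1 hlogim⟩) (by
        intro p hp
        rw [Finset.mem_singleton] at hp
        subst hp
        exact (AnalyticAt.meromorphicAt (by fun_prop)).div
          (AnalyticAt.meromorphicAt (by fun_prop))) hJan (by
        intro p hp
        rw [Finset.mem_singleton] at hp
        subst hp
        exact hres)]
    simp
  have hedgeInt : ∀ θ : ℝ, θ = Real.pi ∨ θ = -Real.pi →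
      IntegrableOn (fun x : ℝ => J (x + θ * Complex.I)) (Ioi L) := by
    intro θ hθ
    refine ((integrableOn_exp_edge hβ L).const_mul C).mono' ?_ ?_
    · refine (ContinuousOn.div ((h.continuousOn_edge' (abs_le_pi_of_edge hθ)).mono
        Ioi_subset_Ici_self) (by fun_prop) fun x _ => ?_).aestronglyMeasurable measurableSet_Ioi
      rw [exp_edge hθ]
      intro h0
      have := congrArg Complex.re h0
      simp [-Complex.ofReal_exp] at this
      linarith [Real.exp_pos x]
    · filter_upwards [ae_restrict_mem measurableSet_Ioi] with x hx
      have h1 := h.norm_edge_le hθ (le_of_lt hx)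
      have hex := Real.exp_pos x
      have h2 : Real.exp x ≤ ‖s - Complex.exp (x + θ * Complex.I)‖ := by
        refine le_trans ?_ (Complex.re_le_norm _)
        rw [exp_edge hθ, Complex.sub_re, Complex.neg_re, Complex.ofReal_re]
        linarith
      rw [hJ, norm_div, div_le_iff₀ (by linarith)]
      refine h1.trans ?_
      have : 0 ≤ C * Real.exp (-β * x) := by positivity
      nlinarith
  have hright : Tendsto (fun M : ℝ => ∫ y in (-Real.pi)..Real.pi, J (M + y * Complex.I)) atTop
      (𝓝 0) := by
    refine squeeze_zero_norm' (a := fun M => 2 * C * Real.exp (-β * M) * |Real.pi - -Real.pi|) ?_ ?_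
    · have hlarge : ∀ᶠ M : ℝ in atTop, 2 * ‖s‖ ≤ Real.exp M :=
        Real.tendsto_exp_atTop.eventually_ge_atTop _
      filter_upwards [hlarge, eventually_ge_atTop L] with M hM hML
      refine intervalIntegral.norm_integral_le_of_norm_le_const fun y hy => ?_
      rw [uIoc_of_le (neg_le_self Real.pi_nonneg)] at hy
      have h1 := h.bound (M + y * Complex.I) (by simpa using hML)
        (by simpa using abs_le.2 ⟨hy.1.le, hy.2⟩)
      rw [re_add_mul_I] at h1
      have hex := Real.exp_pos M
      have hn : ‖Complex.exp (M + y * Complex.I)‖ = Real.exp M := by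
        rw [Complex.norm_exp, re_add_mul_I]
      have h2 : Real.exp M / 2 ≤ ‖s - Complex.exp (M + y * Complex.I)‖ := by
        have := norm_sub_norm_le (Complex.exp (M + y * Complex.I)) s
        rw [norm_sub_rev, hn] at this
        linarith
      rw [hJ, norm_div, norm_mul, hn, div_le_iff₀ (by linarith)]
      calc Real.exp M * ‖K (M + y * Complex.I)‖ ≤ Real.exp M * (C * Real.exp (-β * M)) := by gcongr
        _ = 2 * C * Real.exp (-β * M) * (Real.exp M / 2) := by ring
        _ ≤ _ := by gcongr
    · have : Tendsto (fun M : ℝ => Real.exp (-β * M)) atTop (𝓝 0) :=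
        Real.tendsto_exp_atBot.comp (tendsto_id.const_mul_atTop_of_neg (by linarith))
      simpa using (this.const_mul (2 * C)).mul_const (|Real.pi - -Real.pi|)
  have hlim : Tendsto (fun M : ℝ => rectIntegral J L M (-Real.pi) Real.pi) atTop
      (𝓝 ((∫ x in Ioi L, J (x + (-Real.pi : ℝ) * Complex.I)) -
        (∫ x in Ioi L, J (x + (Real.pi : ℝ) * Complex.I)) + Complex.I * 0 -
        Complex.I * ∫ y in (-Real.pi)..Real.pi, J (L + y * Complex.I))) :=
    (((intervalIntegral_tendsto_integral_Ioi L (hedgeInt _ (Or.inr rfl)) tendsto_id).sub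
      (intervalIntegral_tendsto_integral_Ioi L (hedgeInt _ (Or.inl rfl)) tendsto_id)).add
      (hright.const_mul _)).sub_const _
  have hval := tendsto_nhds_unique hlim (tendsto_const_nhds.congr' (by
    filter_upwards [eventually_gt_atTop (Complex.log s).re] with M hM using (hrect M hM).symm))
  have hI : ∫ y in (-Real.pi)..Real.pi, Complex.I * (Complex.exp (L + y * Complex.I) *
        K (L + y * Complex.I)) / (s - Complex.exp (L + y * Complex.I)) =
      Complex.I * ∫ y in (-Real.pi)..Real.pi, J (L + y * Complex.I) := by
    rw [← intervalIntegral.integral_const_mul]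
    simp only [hJ, mul_div_assoc]
  have h2pi : (2 * Real.pi * Complex.I : ℂ) ≠ 0 := by simp [Real.pi_ne_zero]
  rw [hI, inv_mul_eq_iff_eq_mul₀ h2pi]
  linear_combination -hval

end DecaysOnStrip

/-! ### The Cauchy problem as a Volterra equation -/

theorem IsLaplace.intervalIntegrable {f : ℝ → ℂ} {σ : ℝ} {F : ℂ → ℂ} (h : IsLaplace f σ F)
    {T : ℝ} (hT : 0 ≤ T) : IntervalIntegrable f volume 0 T := by
  rw [intervalIntegrable_iff_integrableOn_Ioc_of_le hT]
  have h1 := (h (σ + 1 : ℝ) (by simp)).1.mono_set (Ioc_subset_Ioi_self : Ioc 0 T ⊆ Ioi 0)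
  have h2 : IntegrableOn (fun t : ℝ => Complex.exp ((σ + 1 : ℝ) * t) *
      (Complex.exp (-((σ + 1 : ℝ) * t)) * f t)) (Ioc 0 T) := by
    obtain ⟨D, hD⟩ := (isCompact_Icc (a := (0 : ℝ)) (b := T)).exists_bound_of_continuousOn
      (f := fun t : ℝ => Complex.exp ((σ + 1 : ℝ) * t)) (by fun_prop)
    refine h1.bdd_mul (c := D) (Continuous.aestronglyMeasurable (by fun_prop)) ?_
    filter_upwards [ae_restrict_mem measurableSet_Ioc] with t ht
      using hD t (Ioc_subset_Icc_self ht)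
  refine h2.congr_fun (fun t _ => ?_) measurableSet_Ioc
  simp only
  rw [← mul_assoc, ← Complex.exp_add]
  simp

theorem IntervalIntegrable.of_ofReal {f : ℝ → ℝ} {a b : ℝ}
    (h : IntervalIntegrable (fun t => (f t : ℂ)) volume a b) : IntervalIntegrable f volume a b :=
  ⟨Integrable.re h.1, Integrable.re h.2⟩

theorem IntervalIntegrable.toComplex {f : ℝ → ℝ} {a b : ℝ}
    (h : IntervalIntegrable f volume a b) :
    IntervalIntegrable (fun t => (f t : ℂ)) volume a b :=
  ⟨h.1.ofReal, h.2.ofReal⟩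

/-- The reflection `τ ↦ t - τ` of `(0, t)` preserves null sets. -/
theorem ae_comp_sub_left {p : ℝ → Prop} (h : ∀ᵐ τ ∂(volume.restrict (Ioi (0 : ℝ))), p τ) (t : ℝ) :
    ∀ᵐ τ : ℝ, τ < t → p (t - τ) := by
  have h1 := ae_imp_of_ae_restrict h
  filter_upwards [(quasiMeasurePreserving_sub_left_of_right_invariant (volume : Measure ℝ) t).ae h1] with τ hτ hlt
  exact hτ (by simpa using hlt)

/-- The kernel of the equation matters only up to a null set. -/
theorem IsRelaxationSolution.congr_kernel {φ φ' u : ℝ → ℝ} {lam u₀ : ℝ}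
    (h : IsRelaxationSolution φ lam u₀ u)
    (hφ : ∀ᵐ τ ∂(volume.restrict (Ioi (0 : ℝ))), φ τ = φ' τ) :
    IsRelaxationSolution φ' lam u₀ u := by
  have key : ∀ t : ℝ, 0 < t → (fun τ => φ (t - τ) * deriv u τ) =ᵐ[volume.restrict (uIoc 0 t)]
      fun τ => φ' (t - τ) * deriv u τ := by
    intro t ht
    rw [uIoc_of_le ht.le, ← restrict_Ioo_eq_restrict_Ioc]
    filter_upwards [ae_restrict_of_ae (ae_comp_sub_left hφ t), ae_restrict_mem measurableSet_Ioo]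
      with τ h1 h2
    rw [h1 h2.2]
  refine ⟨h.absolutelyContinuous, h.initial, fun t ht => (h.integrable t ht).congr_ae (key t ht),
    fun t ht => ?_⟩
  rw [← h.equation t ht]
  exact (intervalIntegral.integral_congr_ae_restrict (key t ht)).symm

section Volterra

variable {φ v : ℝ → ℝ} {lam σ : ℝ} {Φ V : ℂ → ℂ}

/-- The equation `φ * D = -λ W` with `W' = D`, `W(0) = 0` has only the trivial solution: convolution
with `v` turns it into `W - λ v * W = -λ v * W`. The functions are cut off at `T` so that Laplace
transforms exist. -/
theorem eq_zero_of_volterra (hσ : 0 ≤ σ) (hφ : IsLaplace (fun t => (φ t : ℂ)) σ Φ)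
    (hv : IsLaplace (fun t => (v t : ℂ)) σ V)
    (hΦV : ∀ s : ℂ, σ < s.re → Φ s * V s = 1 / s - lam * (V s / s))
    {D : ℝ → ℝ} (hD : ∀ T, 0 < T → IntervalIntegrable D volume 0 T)
    (heq : ∀ t, 0 < t → ∫ τ in (0 : ℝ)..t, φ (t - τ) * D τ = -lam * ∫ τ in (0 : ℝ)..t, D τ) :
    ∀ t, 0 < t → ∫ τ in (0 : ℝ)..t, D τ = 0 := by
  intro t₀ ht₀
  set T := t₀ + 1 with hT
  have hT0 : 0 < T := by linarith
  set DT : ℝ → ℂ := indicator (Ioc 0 T) (fun t => (D t : ℂ)) with hDT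
  have hDTint : Integrable DT := by
    rw [hDT, integrable_indicator_iff measurableSet_Ioc,
      ← intervalIntegrable_iff_integrableOn_Ioc_of_le hT0.le]
    exact (hD T hT0).toComplex
  have hDL := IsLaplace.of_integrableOn (f := DT) (σ := σ) (fun s hs => by
    refine hDTint.integrableOn.bdd_mul (c := 1) (Continuous.aestronglyMeasurable (by fun_prop)) ?_
    filter_upwards [ae_restrict_mem measurableSet_Ioi] with t ht
    rw [Complex.norm_exp]
    have : 0 ≤ s.re * t := mul_nonneg (hσ.trans hs.le) (le_of_lt ht)
    simpa using this)
  have h1 := (hDL.conv hφ).conv hv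
  have h2 := (hDL.primitive hσ).sub (((hDL.primitive hσ).conv hv).const_mul lam)
  have hae := (h1.congr_right fun s hs => by
    rw [mul_assoc, hΦV s hs]).ae_eq (h2.congr_right fun s hs => by ring)
  have hDTeq : ∀ {t}, 0 ≤ t → t ≤ T → ∀ f : ℝ → ℂ, ∫ τ in (0 : ℝ)..t, DT τ * f τ =
      ∫ τ in (0 : ℝ)..t, (D τ : ℂ) * f τ := by
    intro t h0 ht f
    refine intervalIntegral.integral_congr_ae (Eventually.of_forall fun τ hτ => ?_)
    rw [uIoc_of_le h0] at hτ
    rw [hDT, indicator_of_mem (show τ ∈ Ioc 0 T from ⟨hτ.1, hτ.2.trans ht⟩)]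
  set W : ℝ → ℂ := fun t => ((∫ τ in (0 : ℝ)..t, D τ : ℝ) : ℂ) with hW
  have hprim : ∀ {t}, 0 ≤ t → t ≤ T → ∫ τ in (0 : ℝ)..t, DT τ = W t := by
    intro t h0 ht
    have := hDTeq h0 ht (fun _ => 1)
    simp only [mul_one] at this
    rw [this, hW, intervalIntegral.integral_ofReal]
  have hconv : ∀ {t}, 0 < t → t ≤ T → ∫ τ in (0 : ℝ)..t, DT τ * (φ (t - τ) : ℂ) = -lam * W t := by
    intro t h0 ht
    rw [hDTeq h0.le ht, hW]
    have := congrArg (fun x : ℝ => (x : ℂ)) (heq t h0)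
    simp only [Complex.ofReal_mul, Complex.ofReal_neg] at this
    rw [← this, ← intervalIntegral.integral_ofReal]
    refine intervalIntegral.integral_congr fun τ _ => ?_
    push_cast; ring
  have hWae : ∀ᵐ t ∂(volume.restrict (Ioo 0 T)), W t = 0 := by
    filter_upwards [ae_restrict_of_ae_restrict_of_subset Ioo_subset_Ioi_self hae,
      ae_restrict_mem measurableSet_Ioo] with t ht htT
    rw [hprim htT.1.le htT.2.le] at ht
    have e1 : ∫ τ in (0 : ℝ)..t, (∫ ρ in (0 : ℝ)..τ, DT ρ * (φ (τ - ρ) : ℂ)) * (v (t - τ) : ℂ) =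
        -lam * ∫ τ in (0 : ℝ)..t, W τ * (v (t - τ) : ℂ) := by
      rw [← intervalIntegral.integral_const_mul]
      refine intervalIntegral.integral_congr_ae (Eventually.of_forall fun τ hτ => ?_)
      rw [uIoc_of_le htT.1.le] at hτ
      rw [hconv hτ.1 (hτ.2.trans htT.2.le)]
      ring
    have e2 : ∫ τ in (0 : ℝ)..t, (∫ ρ in (0 : ℝ)..τ, DT ρ) * (v (t - τ) : ℂ) =
        ∫ τ in (0 : ℝ)..t, W τ * (v (t - τ) : ℂ) := by
      refine intervalIntegral.integral_congr_ae (Eventually.of_forall fun τ hτ => ?_)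
      rw [uIoc_of_le htT.1.le] at hτ
      rw [hprim hτ.1.le (hτ.2.trans htT.2.le)]
    rw [e1, e2] at ht
    linear_combination -ht
  have hWc : ContinuousOn W (Ioo 0 T) := by
    refine Complex.continuous_ofReal.comp_continuousOn ?_
    have := intervalIntegral.continuousOn_primitive_interval'
      (hD T hT0) (left_mem_uIcc)
    exact this.mono (by rw [uIcc_of_le hT0.le]; exact Ioo_subset_Icc_self)
  have := Measure.eqOn_open_of_ae_eq (g := fun _ => (0 : ℂ)) hWae isOpen_Ioo hWc continuousOn_const
    (⟨ht₀, by linarith⟩ : t₀ ∈ Ioo 0 T)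
  exact Complex.ofReal_eq_zero.1 this

/-- Two solutions of the Cauchy problem agree. -/
theorem IsRelaxationSolution.eqOn (hσ : 0 ≤ σ) (hφ : IsLaplace (fun t => (φ t : ℂ)) σ Φ)
    (hv : IsLaplace (fun t => (v t : ℂ)) σ V)
    (hΦV : ∀ s : ℂ, σ < s.re → Φ s * V s = 1 / s - lam * (V s / s))
    {u₀ : ℝ} {u₁ u₂ : ℝ → ℝ} (h₁ : IsRelaxationSolution φ lam u₀ u₁)
    (h₂ : IsRelaxationSolution φ lam u₀ u₂) : EqOn u₁ u₂ (Ici 0) := by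
  have hint : ∀ {u}, IsRelaxationSolution φ lam u₀ u → ∀ T, 0 < T →
      IntervalIntegrable (deriv u) volume 0 T := fun hu T hT =>
    (hu.absolutelyContinuous T hT).intervalIntegrable_deriv
  have hprim : ∀ t, 0 < t → ∫ τ in (0 : ℝ)..t, (deriv u₁ τ - deriv u₂ τ) = u₁ t - u₂ t := by
    intro t ht
    rw [intervalIntegral.integral_sub (hint h₁ t ht) (hint h₂ t ht),
      (h₁.absolutelyContinuous t ht).integral_deriv_eq_sub,
      (h₂.absolutelyContinuous t ht).integral_deriv_eq_sub, h₁.initial, h₂.initial]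
    ring
  have hz := eq_zero_of_volterra hσ hφ hv hΦV (D := fun τ => deriv u₁ τ - deriv u₂ τ)
    (fun T hT => (hint h₁ T hT).sub (hint h₂ T hT)) (fun t ht => by
      rw [hprim t ht]
      simp only [mul_sub]
      rw [intervalIntegral.integral_sub (h₁.integrable t ht) (h₂.integrable t ht)]
      exact congrArg₂ (· - ·) (h₁.equation t ht) (h₂.equation t ht))
  intro t ht
  rcases (mem_Ici.1 ht).eq_or_lt with rfl | ht
  · rw [h₁.initial, h₂.initial]
  · have := hz t ht
    rw [hprim t ht] at this
    linarith

variable {a b : ℝ}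

/-- The solution with initial value `1`, in terms of the inverse transform `v` of
`1 / (s^{sA(s)} + λ)`. -/
noncomputable def relaxationProfile (v : ℝ → ℝ) (lam t : ℝ) : ℝ := 1 - lam * ∫ τ in (0 : ℝ)..t, v τ

theorem isLaplace_relaxationProfile (hσ : 0 ≤ σ) (hv : IsLaplace (fun t => (v t : ℂ)) σ V) :
    IsLaplace (fun t => (relaxationProfile v lam t : ℂ)) σ (fun s => 1 / s - lam * (V s / s)) := by
  refine ((IsLaplace.one.mono hσ).sub ((hv.primitive hσ).const_mul lam)).congr_left fun t _ => ?_
  rw [relaxationProfile, intervalIntegral.integral_ofReal]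
  push_cast; rfl

theorem continuousOn_relaxationProfile (hv : IsLaplace (fun t => (v t : ℂ)) σ V) :
    ContinuousOn (fun t => (relaxationProfile v lam t : ℂ)) (Ioi 0) := by
  refine Complex.continuous_ofReal.comp_continuousOn ?_
  intro t ht
  have ht : 0 < t := ht
  have := intervalIntegral.continuousOn_primitive_interval'
    (hv.intervalIntegrable (T := t + 1) (by linarith)).of_ofReal left_mem_uIcc
  rw [uIcc_of_le (by linarith)] at this
  exact (continuousAt_const.sub (continuousAt_const.mul
    (this.continuousAt (Icc_mem_nhds ht (by linarith))))).continuousWithinAt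

theorem conv_eq_relaxationProfile (hσ : 0 ≤ σ) (hφ : IsLaplace (fun t => (φ t : ℂ)) σ Φ)
    (hv : IsLaplace (fun t => (v t : ℂ)) σ V)
    (hΦV : ∀ s : ℂ, σ < s.re → Φ s * V s = 1 / s - lam * (V s / s))
    (ha : 0 < a) (hb : 0 < b) (hφb : PowerBounded (fun t => (φ t : ℂ)) a)
    (hvb : PowerBounded (fun t => (v t : ℂ)) b)
    (hφc : ContinuousOn (fun t => (φ t : ℂ)) (Ioi 0))
    (hvc : ContinuousOn (fun t => (v t : ℂ)) (Ioi 0)) {t : ℝ} (ht : 0 < t) :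
    ∫ τ in (0 : ℝ)..t, v τ * φ (t - τ) = relaxationProfile v lam t := by
  have h := ((hv.conv hφ).congr_right fun s hs => by rw [mul_comm, hΦV s hs]).eqOn
    (isLaplace_relaxationProfile (lam := lam) hσ hv)
    (hvb.continuousOn_conv hφb hb ha hvc hφc) (continuousOn_relaxationProfile hv) ht
  simp only [← Complex.ofReal_mul, intervalIntegral.integral_ofReal] at h
  exact_mod_cast h

/-- Existence for the Cauchy problem: the convolution of the kernel with the derivative `-λ v` of
the profile is `-λ` times the profile. -/
theorem isRelaxationSolution_relaxationProfile (hσ : 0 ≤ σ)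
    (hφ : IsLaplace (fun t => (φ t : ℂ)) σ Φ)
    (hv : IsLaplace (fun t => (v t : ℂ)) σ V)
    (hΦV : ∀ s : ℂ, σ < s.re → Φ s * V s = 1 / s - lam * (V s / s))
    (ha : 0 < a) (hb : 0 < b) (hφb : PowerBounded (fun t => (φ t : ℂ)) a)
    (hvb : PowerBounded (fun t => (v t : ℂ)) b)
    (hφc : ContinuousOn (fun t => (φ t : ℂ)) (Ioi 0))
    (hvc : ContinuousOn (fun t => (v t : ℂ)) (Ioi 0)) (u₀ : ℝ) :
    IsRelaxationSolution φ lam u₀ (fun t => u₀ * relaxationProfile v lam t) := by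
  have hvint : ∀ T, 0 < T → IntervalIntegrable v volume 0 T := fun T hT =>
    (hv.intervalIntegrable hT.le).of_ofReal
  have hvc' : ContinuousOn v (Ioi 0) := by
    have := Complex.continuous_re.comp_continuousOn hvc
    simpa [Function.comp_def] using this
  have hderiv : ∀ τ, 0 < τ → deriv (fun t => u₀ * relaxationProfile v lam t) τ =
      u₀ * (-lam * v τ) := by
    intro τ hτ
    have h1 := intervalIntegral.integral_hasDerivAt_right (hvint τ hτ)
      (hvc'.stronglyMeasurableAtFilter isOpen_Ioi τ hτ) (hvc'.continuousAt (Ioi_mem_nhds hτ))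
    refine (((h1.const_mul lam).const_sub 1).const_mul u₀).deriv.trans ?_
    ring
  have hcongr : ∀ t, 0 < t → EqOn (fun τ => φ (t - τ) *
      deriv (fun t => u₀ * relaxationProfile v lam t) τ)
      (fun τ => u₀ * -lam * (v τ * φ (t - τ))) (Ioc 0 t) := fun t _ τ hτ => by
    simp only [hderiv τ hτ.1]; ring
  have hint : ∀ t, 0 < t → IntervalIntegrable (fun τ => v τ * φ (t - τ)) volume 0 t := by
    intro t ht
    refine IntervalIntegrable.of_ofReal ?_
    have := hvb.intervalIntegrable_conv hφb hb ha hvc hφc ht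
    simpa only [Complex.ofReal_mul] using this
  refine ⟨fun T hT => ?_, ?_, fun t ht => ?_, fun t ht => ?_⟩
  · have h1 := (hvint T hT).absolutelyContinuousOnInterval_intervalIntegral left_mem_uIcc
    have h2 : AbsolutelyContinuousOnInterval (fun _ : ℝ => (1 : ℝ)) 0 T :=
      (contDiff_const (n := 1)).contDiffOn.absolutelyContinuousOnInterval
    exact (h2.sub (h1.const_mul lam)).const_mul u₀
  · simp [relaxationProfile]
  · refine ((hint t ht).const_mul (u₀ * -lam)).congr ?_
    rw [uIoc_of_le ht.le]
    exact (hcongr t ht).symm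
  · rw [scarpiDerivative, intervalIntegral.integral_congr_ae (Eventually.of_forall fun τ hτ =>
      hcongr t ht (by rwa [uIoc_of_le ht.le] at hτ)), intervalIntegral.integral_const_mul,
      conv_eq_relaxationProfile hσ hφ hv hΦV ha hb hφb hvb hφc hvc ht]
    ring

end Volterra

/-! ### The symbol `s^{sA(s)}` near the ends of the cut plane -/

/-- The function `s^{sA(s)}` in terms of `z = log s`. -/
noncomputable def scarpiPower (A : ℂ → ℂ) (z : ℂ) : ℂ := Complex.exp (z * (Complex.exp z * A z))

section abel

variable {α : ℝ → ℝ}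

theorem IsTransitionFunction.norm_le_one (hα : IsTransitionFunction α) {t : ℝ} (ht : 0 ≤ t) :
    ‖(α t : ℂ)‖ ≤ 1 := by
  rw [Complex.norm_real, Real.norm_of_nonneg (hα.mem_Ioo t ht).1.le]
  exact (hα.mem_Ioo t ht).2.le

theorem IsTransitionFunction.integrableOn (hα : IsTransitionFunction α) {r : ℝ} (hr : 0 < r) :
    IntegrableOn (fun t : ℝ => Complex.exp (-((r : ℂ) * t)) * (α t : ℂ)) (Ioi 0) := by
  have h1 : IntegrableOn (fun t : ℝ => Complex.exp (-(r : ℂ) * t)) (Ioi 0) :=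
    integrableOn_exp_mul_complex_Ioi (by simpa using hr) 0
  simp only [neg_mul] at h1
  refine h1.mul_bdd (c := 1) ?_ ?_
  · exact (Complex.measurable_ofReal.comp_aemeasurable hα.aemeasurable).aestronglyMeasurable
  · filter_upwards [ae_restrict_mem measurableSet_Ioi] with t ht
      using hα.norm_le_one (le_of_lt ht)

/-- The initial and final value theorem for Laplace transforms. -/
theorem IsTransitionFunction.tendsto_mul_laplaceTransform (hα : IsTransitionFunction α)
    {ι : Type*} {l : Filter ι} [l.IsCountablyGenerated] {r : ι → ℝ} (hr : ∀ i, 0 < r i) {a : ℝ}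
    (h : ∀ x : ℝ, 0 < x → Tendsto (fun i => α ((r i)⁻¹ * x)) l (𝓝 a)) :
    Tendsto (fun i => (r i : ℂ) * laplaceTransform α (r i)) l (𝓝 a) := by
  have hscale : ∀ i, (r i : ℂ) * laplaceTransform α (r i) =
      ∫ x in Ioi (0 : ℝ), Complex.exp (-x) * (α ((r i)⁻¹ * x) : ℂ) := fun i => by
    have := integral_comp_mul_left_Ioi
      (fun t : ℝ => Complex.exp (-((r i : ℂ) * t)) * (α t : ℂ)) 0 (inv_pos.2 (hr i))
    simp only [inv_inv, mul_zero, Complex.real_smul] at this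
    rw [laplaceTransform, ← this]
    have hri : (r i : ℂ) ≠ 0 := by exact_mod_cast (hr i).ne'
    refine integral_congr_ae (Eventually.of_forall fun x => ?_)
    simp only
    push_cast
    rw [mul_inv_cancel_left₀ hri]
  have hone : (a : ℂ) = ∫ x in Ioi (0 : ℝ), Complex.exp (-x) * (a : ℂ) := by
    have h0 := (IsLaplace.one 1 (by simp)).2
    simp only [one_mul, mul_one, div_one] at h0
    rw [integral_mul_const, h0, one_mul]
  simp only [hscale]
  rw [hone]
  refine tendsto_integral_filter_of_dominated_convergence (fun x => Real.exp (-x))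
    (Eventually.of_forall fun i => ?_) (Eventually.of_forall fun i => ?_) ?_ ?_
  · have h1 := (integrableOn_Ioi_comp_mul_left_iff
      (fun t : ℝ => Complex.exp (-((r i : ℂ) * t)) * (α t : ℂ)) 0 (inv_pos.2 (hr i))).2
      (by simpa using hα.integrableOn (hr i))
    refine h1.1.congr (Eventually.of_forall fun x => ?_)
    have hri : (r i : ℂ) ≠ 0 := by exact_mod_cast (hr i).ne'
    simp only
    push_cast
    rw [mul_inv_cancel_left₀ hri]
  · filter_upwards [ae_restrict_mem measurableSet_Ioi] with x hx
    have hx : 0 < x := hx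
    have := hr i
    rw [norm_mul]
    have h1 : ‖Complex.exp (-(x : ℂ))‖ = Real.exp (-x) := by rw [Complex.norm_exp]; simp
    rw [h1]
    exact mul_le_of_le_one_right (Real.exp_pos _).le (hα.norm_le_one (by positivity))
  · have h1 := integrableOn_exp_mul_Ioi (a := -1) (by norm_num) 0
    simp only [neg_one_mul] at h1
    exact h1
  · filter_upwards [ae_restrict_mem measurableSet_Ioi] with x hx
    exact ((Complex.continuous_ofReal.tendsto a).comp (h x hx)).const_mul _

end abel

theorem ofReal_mem_cutStrip (x : ℝ) : (x : ℂ) ∈ cutStrip := by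
  simp [cutStrip, Real.pi_nonneg]

section limits

variable {α : ℝ → ℝ} {A : ℂ → ℂ}

theorem IsTransformOnCutPlane.apply_ofReal (hA : IsTransformOnCutPlane α A) (x : ℝ) :
    Complex.exp x * A x = (Real.exp x : ℂ) * laplaceTransform α (Real.exp x) := by
  rw [hA.eq_laplace x (by simpa using Real.pi_pos), Complex.ofReal_exp]

/-- The limit of `sA(s)` at infinity is the initial state, which lies in `(0, 1)`. -/
theorem IsTransformOnCutPlane.exists_limit_atTop (hα : IsTransitionFunction α)
    (hA : IsTransformOnCutPlane α A)
    (h_infty : ∃ l : ℂ, Tendsto (fun z : ℂ => Complex.exp z * A z)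
      (comap Complex.re atTop ⊓ 𝓟 cutStrip) (𝓝 l)) :
    ∃ a ∈ Ioo (0 : ℝ) 1, Tendsto (fun z : ℂ => Complex.exp z * A z)
      (comap Complex.re atTop ⊓ 𝓟 cutStrip) (𝓝 (a : ℂ)) := by
  obtain ⟨l, hl⟩ := h_infty
  obtain ⟨a, ha, hlim⟩ := hα.initial_state
  refine ⟨a, ha, ?_⟩
  have h1 : Tendsto (fun x : ℝ => (x : ℂ)) atTop (comap Complex.re atTop ⊓ 𝓟 cutStrip) :=
    tendsto_inf.2 ⟨tendsto_comap_iff.2 tendsto_id,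
      tendsto_principal.2 (Eventually.of_forall ofReal_mem_cutStrip)⟩
  have h2 := hα.tendsto_mul_laplaceTransform (l := atTop) (r := Real.exp) Real.exp_pos
    (fun x hx => hlim.comp (tendsto_nhdsWithin_iff.2 ⟨by
      simpa using (tendsto_inv_atTop_zero.comp Real.tendsto_exp_atTop).mul_const x,
      Eventually.of_forall fun i => mul_pos (inv_pos.2 (Real.exp_pos i)) hx⟩))
  have h3 := hl.comp h1
  simp only [Function.comp_def, hA.apply_ofReal] at h3
  rwa [← tendsto_nhds_unique h3 h2]

/-- The limit of `sA(s)` at `0` is the final state, which lies in `(0, 1)`. -/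
theorem IsTransformOnCutPlane.exists_limit_atBot (hα : IsTransitionFunction α)
    (hA : IsTransformOnCutPlane α A)
    (h_zero : ∃ l : ℂ, Tendsto (fun z : ℂ => Complex.exp z * A z)
      (comap Complex.re atBot ⊓ 𝓟 cutStrip) (𝓝 l)) :
    ∃ a ∈ Ioo (0 : ℝ) 1, Tendsto (fun z : ℂ => Complex.exp z * A z)
      (comap Complex.re atBot ⊓ 𝓟 cutStrip) (𝓝 (a : ℂ)) := by
  obtain ⟨l, hl⟩ := h_zero
  obtain ⟨a, ha, hlim⟩ := hα.final_state
  refine ⟨a, ha, ?_⟩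
  have h1 : Tendsto (fun x : ℝ => (x : ℂ)) atBot (comap Complex.re atBot ⊓ 𝓟 cutStrip) :=
    tendsto_inf.2 ⟨tendsto_comap_iff.2 tendsto_id,
      tendsto_principal.2 (Eventually.of_forall ofReal_mem_cutStrip)⟩
  have h2 := hα.tendsto_mul_laplaceTransform (l := atBot) (r := Real.exp) Real.exp_pos
    (fun x hx => hlim.comp (by
      have : Tendsto (fun i => (Real.exp i)⁻¹) atBot atTop := by
        simp only [← Real.exp_neg]
        exact Real.tendsto_exp_atTop.comp tendsto_neg_atBot_atTop
      exact this.atTop_mul_const hx))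
  have h3 := hl.comp h1
  simp only [Function.comp_def, hA.apply_ofReal] at h3
  rwa [← tendsto_nhds_unique h3 h2]

/-- At a pole a function is unbounded in every direction. -/
theorem MeromorphicNFAt.analyticAt_of_bounded {f : ℂ → ℂ} {z : ℂ} {D : ℝ}
    (hf : MeromorphicNFAt f z) (hD : ∀ᶠ x : ℝ in 𝓝[≠] 0, ‖f (z + x)‖ ≤ D) : AnalyticAt ℂ f z := by
  rcases meromorphicNFAt_iff_analyticAt_or.1 hf with h | ⟨-, h, -⟩
  · exact h
  · exfalso
    have h1 := tendsto_norm_cobounded_atTop.comp (tendsto_cobounded_of_meromorphicOrderAt_neg h)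
    have h2 : Tendsto (fun x : ℝ => z + x) (𝓝[≠] 0) (𝓝[≠] z) := by
      refine tendsto_nhdsWithin_iff.2 ⟨?_, ?_⟩
      · have : Continuous fun x : ℝ => z + x := by fun_prop
        simpa using (this.tendsto 0).mono_left nhdsWithin_le_nhds
      · filter_upwards [self_mem_nhdsWithin] with x hx
        simpa using hx
    obtain ⟨x, hx1, hx2⟩ := (((h1.comp h2).eventually_gt_atTop D).and hD).exists
    simp only [Function.comp_apply] at hx1
    linarith

theorem IsTransformOnCutPlane.analyticAt_of_bounded (hA : IsTransformOnCutPlane α A) {z : ℂ}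
    (hz : z ∈ cutStrip) {D : ℝ} (hD : ∀ᶠ w in 𝓝 z, w ∈ cutStrip → ‖Complex.exp w * A w‖ ≤ D) :
    AnalyticAt ℂ A z := by
  refine (hA.meromorphic hz).analyticAt_of_bounded (D := D * Real.exp (-(z.re - 1))) ?_
  have h2 : Tendsto (fun x : ℝ => z + x) (𝓝[≠] 0) (𝓝 z) := by
    have : Continuous fun x : ℝ => z + x := by fun_prop
    simpa using (this.tendsto 0).mono_left nhdsWithin_le_nhds
  have h3 : ∀ᶠ x : ℝ in 𝓝[≠] 0, -1 < x :=
    (lt_mem_nhds (by norm_num : (-1 : ℝ) < 0)).filter_mono nhdsWithin_le_nhds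
  filter_upwards [h2.eventually hD, h3] with x hx hx1
  have h4 := hx (by simpa [cutStrip] using hz)
  have h5 : ‖A (z + x)‖ = ‖Complex.exp (z + x) * A (z + x)‖ * Real.exp (-(z.re + x)) := by
    rw [norm_mul, Complex.norm_exp, Complex.add_re, Complex.ofReal_re, mul_comm, ← mul_assoc,
      ← Real.exp_add]
    simp
  rw [h5]
  have h6 := (norm_nonneg _).trans h4
  gcongr
  linarith

theorem IsTransformOnCutPlane.exists_near_atTop (hA : IsTransformOnCutPlane α A) {a : ℝ}
    (h : Tendsto (fun z : ℂ => Complex.exp z * A z)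
      (comap Complex.re atTop ⊓ 𝓟 cutStrip) (𝓝 (a : ℂ))) {ε : ℝ} (hε : 0 < ε) :
    ∃ L : ℝ, ∀ z : ℂ, L ≤ z.re → |z.im| ≤ Real.pi →
      AnalyticAt ℂ A z ∧ ‖Complex.exp z * A z - a‖ ≤ ε := by
  have h1 := h.eventually (Metric.closedBall_mem_nhds (a : ℂ) hε)
  rw [eventually_inf_principal, eventually_comap] at h1
  obtain ⟨L, hL⟩ := eventually_atTop.1 h1
  refine ⟨L + 1, fun z hz hzi => ⟨?_, ?_⟩⟩
  · refine hA.analyticAt_of_bounded hzi (D := |a| + ε) ?_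
    have h2 : ∀ᶠ w : ℂ in 𝓝 z, L < w.re :=
      Complex.continuous_re.continuousAt.eventually (lt_mem_nhds (by linarith))
    filter_upwards [h2] with w hw hws
    have h3 := hL w.re hw.le w rfl hws
    rw [dist_eq_norm] at h3
    calc _ = ‖(a : ℂ) + (Complex.exp w * A w - a)‖ := by ring_nf
      _ ≤ ‖(a : ℂ)‖ + ‖Complex.exp w * A w - a‖ := norm_add_le _ _
      _ ≤ _ := by rw [Complex.norm_real, Real.norm_eq_abs]; gcongr
  · have h3 := hL z.re (by linarith) z rfl hzi
    rwa [dist_eq_norm] at h3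

theorem IsTransformOnCutPlane.exists_near_atBot (hA : IsTransformOnCutPlane α A) {a : ℝ}
    (h : Tendsto (fun z : ℂ => Complex.exp z * A z)
      (comap Complex.re atBot ⊓ 𝓟 cutStrip) (𝓝 (a : ℂ))) {ε : ℝ} (hε : 0 < ε) :
    ∃ L : ℝ, ∀ z : ℂ, z.re ≤ L → |z.im| ≤ Real.pi →
      AnalyticAt ℂ A z ∧ ‖Complex.exp z * A z - a‖ ≤ ε := by
  have h1 := h.eventually (Metric.closedBall_mem_nhds (a : ℂ) hε)
  rw [eventually_inf_principal, eventually_comap] at h1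
  obtain ⟨L, hL⟩ := eventually_atBot.1 h1
  refine ⟨L - 1, fun z hz hzi => ⟨?_, ?_⟩⟩
  · refine hA.analyticAt_of_bounded hzi (D := |a| + ε) ?_
    have h2 : ∀ᶠ w : ℂ in 𝓝 z, w.re < L :=
      Complex.continuous_re.continuousAt.eventually (gt_mem_nhds (by linarith))
    filter_upwards [h2] with w hw hws
    have h3 := hL w.re hw.le w rfl hws
    rw [dist_eq_norm] at h3
    calc _ = ‖(a : ℂ) + (Complex.exp w * A w - a)‖ := by ring_nf
      _ ≤ ‖(a : ℂ)‖ + ‖Complex.exp w * A w - a‖ := norm_add_le _ _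
      _ ≤ _ := by rw [Complex.norm_real, Real.norm_eq_abs]; gcongr
  · have h3 := hL z.re (by linarith) z rfl hzi
    rwa [dist_eq_norm] at h3

theorem AnalyticAt.scarpiPower {z : ℂ} (h : AnalyticAt ℂ A z) :
    AnalyticAt ℂ (scarpiPower A) z := by
  unfold _root_.scarpiPower
  fun_prop

theorem norm_scarpiPower (z : ℂ) : ‖scarpiPower A z‖ =
    Real.exp (z.re * (Complex.exp z * A z).re - z.im * (Complex.exp z * A z).im) := by
  rw [scarpiPower, Complex.norm_exp, Complex.mul_re]

theorem scarpi_exponent_bounds {W : ℂ} {a ε y : ℝ} (h : ‖W - a‖ ≤ ε) (hy : |y| ≤ Real.pi) :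
    a - ε ≤ W.re ∧ W.re ≤ a + ε ∧ |y * W.im| ≤ Real.pi * ε := by
  have h1 := (Complex.abs_re_le_norm (W - a)).trans h
  have h2 := (Complex.abs_im_le_norm (W - a)).trans h
  simp only [Complex.sub_re, Complex.ofReal_re, Complex.sub_im, Complex.ofReal_im, sub_zero] at h1 h2
  rw [abs_le] at h1
  refine ⟨by linarith, by linarith, ?_⟩
  rw [abs_mul]
  gcongr

/-- For large `|s|` the function `s^{sA(s)}` is large, but smaller than `|s|`, by a power of `|s|`. -/
theorem IsTransformOnCutPlane.exists_scarpiPower_bounds_atTop (hα : IsTransitionFunction α)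
    (hA : IsTransformOnCutPlane α A)
    (h_infty : ∃ l : ℂ, Tendsto (fun z : ℂ => Complex.exp z * A z)
      (comap Complex.re atTop ⊓ 𝓟 cutStrip) (𝓝 l)) (lam : ℝ) :
    ∃ β C L : ℝ, 0 < β ∧ β ≤ 1 / 2 ∧ 0 < C ∧ 0 ≤ L ∧ ∀ z : ℂ, L ≤ z.re → |z.im| ≤ Real.pi →
      AnalyticAt ℂ A z ∧ 2 * lam ≤ ‖scarpiPower A z‖ ∧
      C⁻¹ * Real.exp (β * z.re) ≤ ‖scarpiPower A z‖ ∧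
      ‖scarpiPower A z‖ ≤ C * Real.exp ((1 - β) * z.re) := by
  obtain ⟨a, ha, hlim⟩ := hA.exists_limit_atTop hα h_infty
  obtain ⟨β, hβ, h2, h3⟩ : ∃ β, 0 < β ∧ β ≤ a / 2 ∧ β ≤ (1 - a) / 2 :=
    ⟨min (a / 2) ((1 - a) / 2), lt_min (by linarith [ha.1]) (by linarith [ha.2]), min_le_left _ _,
      min_le_right _ _⟩
  obtain ⟨L₀, hL₀⟩ := hA.exists_near_atTop hlim hβ
  have hlarge : ∀ᶠ x : ℝ in atTop, 2 * lam * Real.exp (Real.pi * β) ≤ Real.exp (β * x) :=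
    (Real.tendsto_exp_atTop.comp (tendsto_id.const_mul_atTop hβ)).eventually_ge_atTop _
  obtain ⟨L₁, hL₁⟩ := eventually_atTop.1 hlarge
  refine ⟨β, Real.exp (Real.pi * β), max (max L₀ L₁) 0, hβ, by linarith [ha.2], Real.exp_pos _,
    le_max_right _ _, fun z hz hzi => ?_⟩
  have hz0 : 0 ≤ z.re := (le_max_right _ _).trans hz
  have hz1 : L₁ ≤ z.re := ((le_max_right _ _).trans (le_max_left _ _)).trans hz
  obtain ⟨h4, h5⟩ := hL₀ z (((le_max_left _ _).trans (le_max_left _ _)).trans hz) hzi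
  obtain ⟨h6, h7, h8⟩ := scarpi_exponent_bounds h5 hzi
  rw [abs_le] at h8
  have h9 : (Real.exp (Real.pi * β))⁻¹ * Real.exp (β * z.re) ≤ ‖scarpiPower A z‖ := by
    rw [norm_scarpiPower, ← Real.exp_neg, ← Real.exp_add]
    refine Real.exp_le_exp.2 ?_
    nlinarith
  refine ⟨h4, ?_, h9, ?_⟩
  · refine le_trans ?_ h9
    rw [le_inv_mul_iff₀ (Real.exp_pos _), mul_comm]
    exact hL₁ _ hz1
  · rw [norm_scarpiPower, ← Real.exp_add]
    refine Real.exp_le_exp.2 ?_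
    nlinarith

/-- For small `|s|` the function `s^{sA(s)}` is small, by a power of `|s|`. -/
theorem IsTransformOnCutPlane.exists_scarpiPower_bounds_atBot (hα : IsTransitionFunction α)
    (hA : IsTransformOnCutPlane α A)
    (h_zero : ∃ l : ℂ, Tendsto (fun z : ℂ => Complex.exp z * A z)
      (comap Complex.re atBot ⊓ 𝓟 cutStrip) (𝓝 l)) {lam : ℝ} (hlam : 0 < lam) :
    ∃ β C L : ℝ, 0 < β ∧ 0 < C ∧ L ≤ 0 ∧ ∀ z : ℂ, z.re ≤ L → |z.im| ≤ Real.pi →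
      AnalyticAt ℂ A z ∧ ‖scarpiPower A z‖ ≤ lam / 2 ∧
      ‖scarpiPower A z‖ ≤ C * Real.exp (β * z.re) := by
  obtain ⟨a, ha, hlim⟩ := hA.exists_limit_atBot hα h_zero
  have hβ : 0 < a / 2 := by linarith [ha.1]
  obtain ⟨L₀, hL₀⟩ := hA.exists_near_atBot hlim hβ
  have hsmall : ∀ᶠ x : ℝ in atBot, Real.exp (Real.pi * (a / 2)) * Real.exp (a / 2 * x) < lam / 2 := by
    have h1 : Tendsto (fun x : ℝ => Real.exp (a / 2 * x)) atBot (𝓝 0) :=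
      Real.tendsto_exp_atBot.comp (tendsto_id.const_mul_atBot hβ)
    have h2 := h1.const_mul (Real.exp (Real.pi * (a / 2)))
    rw [mul_zero] at h2
    exact h2.eventually (gt_mem_nhds (by linarith))
  obtain ⟨L₁, hL₁⟩ := eventually_atBot.1 hsmall
  refine ⟨a / 2, Real.exp (Real.pi * (a / 2)), min (min L₀ L₁) 0, hβ, Real.exp_pos _,
    min_le_right _ _, fun z hz hzi => ?_⟩
  have hz0 : z.re ≤ 0 := hz.trans (min_le_right _ _)
  have hz1 : z.re ≤ L₁ := hz.trans ((min_le_left _ _).trans (min_le_right _ _))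
  obtain ⟨h4, h5⟩ := hL₀ z (hz.trans ((min_le_left _ _).trans (min_le_left _ _))) hzi
  obtain ⟨h6, h7, h8⟩ := scarpi_exponent_bounds h5 hzi
  rw [abs_le] at h8
  have h9 : ‖scarpiPower A z‖ ≤ Real.exp (Real.pi * (a / 2)) * Real.exp (a / 2 * z.re) := by
    rw [norm_scarpiPower, ← Real.exp_add]
    refine Real.exp_le_exp.2 ?_
    nlinarith
  exact ⟨h4, h9.trans (hL₁ _ hz1).le, h9⟩

end limits

/-! ### The solution of the Cauchy problem as a contour integral -/

section kernels

variable {α : ℝ → ℝ} {A : ℂ → ℂ} {lam : ℝ}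

/-- The transform `s^{sA(s)-1} / (s^{sA(s)} + λ)` in terms of `z = log s`, on the closed strip. -/
noncomputable def relaxationSymbol (A : ℂ → ℂ) (lam : ℝ) (z : ℂ) : ℂ :=
  Complex.exp (-z) * (scarpiPower A z / (scarpiPower A z + lam))

theorem half_norm_le_norm_add {g : ℂ} (h : 2 * lam ≤ ‖g‖) (hlam : 0 < lam) :
    ‖g‖ / 2 ≤ ‖g + lam‖ := by
  have h1 := norm_sub_le_norm_add g (lam : ℂ)
  rw [Complex.norm_real, Real.norm_of_nonneg hlam.le] at h1
  linarith

section decay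

variable {β C L : ℝ}

theorem decaysOnStrip_scarpiKernel (hb : ∀ z : ℂ, L ≤ z.re → |z.im| ≤ Real.pi →
      AnalyticAt ℂ A z ∧ ‖scarpiPower A z‖ ≤ C * Real.exp ((1 - β) * z.re)) :
    DecaysOnStrip (fun z => scarpiPower A z * Complex.exp (-z)) L β C := by
  refine ⟨fun z hz hzi => ?_, fun z hz hzi => ?_⟩
  · have := (hb z hz hzi).1.scarpiPower
    fun_prop
  · rw [norm_mul, Complex.norm_exp, Complex.neg_re]
    calc _ ≤ C * Real.exp ((1 - β) * z.re) * Real.exp (-z.re) := by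
          gcongr; exact (hb z hz hzi).2
      _ = _ := by rw [mul_assoc, ← Real.exp_add]; ring_nf

theorem decaysOnStrip_inv_add (hlam : 0 < lam) (hC : 0 < C)
    (hb : ∀ z : ℂ, L ≤ z.re → |z.im| ≤ Real.pi →
      AnalyticAt ℂ A z ∧ 2 * lam ≤ ‖scarpiPower A z‖ ∧
      C⁻¹ * Real.exp (β * z.re) ≤ ‖scarpiPower A z‖) :
    DecaysOnStrip (fun z => 1 / (scarpiPower A z + lam)) L β (2 * C) := by
  have hlow : ∀ z : ℂ, L ≤ z.re → |z.im| ≤ Real.pi →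
      C⁻¹ * Real.exp (β * z.re) / 2 ≤ ‖scarpiPower A z + lam‖ := fun z hz hzi => by
    obtain ⟨-, h2, h3⟩ := hb z hz hzi
    exact (by linarith : _ ≤ ‖scarpiPower A z‖ / 2).trans (half_norm_le_norm_add h2 hlam)
  refine ⟨fun z hz hzi => ?_, fun z hz hzi => ?_⟩
  · have := (hb z hz hzi).1.scarpiPower
    refine analyticAt_const.div (by fun_prop) fun h0 => ?_
    have h1 := hlow z hz hzi
    rw [h0, norm_zero] at h1
    have : 0 < C⁻¹ * Real.exp (β * z.re) / 2 := by positivity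
    linarith
  · have h1 := hlow z hz hzi
    have h2 : 0 < C⁻¹ * Real.exp (β * z.re) / 2 := by positivity
    rw [norm_div, norm_one, div_le_iff₀ (h2.trans_le h1)]
    calc (1 : ℝ) = 2 * C * Real.exp (-β * z.re) * (C⁻¹ * Real.exp (β * z.re) / 2) := by
          rw [neg_mul, Real.exp_neg]
          field_simp
      _ ≤ _ := by gcongr

theorem decaysOnStrip_relaxationSymbol (hlam : 0 < lam) (hL : 0 ≤ L) (hβ : β ≤ 1)
    (hb : ∀ z : ℂ, L ≤ z.re → |z.im| ≤ Real.pi →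
      AnalyticAt ℂ A z ∧ 2 * lam ≤ ‖scarpiPower A z‖) :
    DecaysOnStrip (relaxationSymbol A lam) L β 2 := by
  have hlow : ∀ z : ℂ, L ≤ z.re → |z.im| ≤ Real.pi → 0 < ‖scarpiPower A z + lam‖ :=
    fun z hz hzi => by
      obtain ⟨-, h2⟩ := hb z hz hzi
      linarith [half_norm_le_norm_add h2 hlam]
  refine ⟨fun z hz hzi => ?_, fun z hz hzi => ?_⟩
  · have := (hb z hz hzi).1.scarpiPower
    exact AnalyticAt.mul (by fun_prop)
      (this.div (by fun_prop) (norm_pos_iff.1 (hlow z hz hzi)))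
  · rw [relaxationSymbol, norm_mul, Complex.norm_exp, Complex.neg_re, norm_div]
    have h1 : ‖scarpiPower A z‖ / ‖scarpiPower A z + lam‖ ≤ 2 := by
      rw [div_le_iff₀ (hlow z hz hzi)]
      linarith [half_norm_le_norm_add (hb z hz hzi).2 hlam]
    have h2 : Real.exp (-z.re) ≤ Real.exp (-β * z.re) := Real.exp_le_exp.2 (by nlinarith)
    calc _ ≤ Real.exp (-β * z.re) * 2 := by gcongr
      _ = _ := by ring

end decay

theorem laplaceTransform_conj (f : ℝ → ℝ) (s : ℂ) :
    laplaceTransform f ((starRingEnd ℂ) s) = (starRingEnd ℂ) (laplaceTransform f s) := by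
  unfold laplaceTransform
  rw [← integral_conj]
  refine integral_congr_ae (Eventually.of_forall fun t => ?_)
  simp only [map_mul, Complex.conj_ofReal, ← Complex.exp_conj, map_neg]

theorem IsTransformOnCutPlane.scarpiPower_log (hA : IsTransformOnCutPlane α A) {s : ℂ}
    (hs : 0 < s.re) :
    scarpiPower A (Complex.log s) = Complex.exp (Complex.log s * (s * laplaceTransform α s)) := by
  have hs0 : s ≠ 0 := fun h => by simp [h] at hs
  rw [scarpiPower, hA.eq_laplace, Complex.exp_log hs0]
  rw [Complex.log_im]
  exact Complex.abs_arg_lt_pi_div_two_iff.2 (Or.inl hs)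

theorem log_conj_of_re_pos {s : ℂ} (hs : 0 < s.re) :
    Complex.log ((starRingEnd ℂ) s) = (starRingEnd ℂ) (Complex.log s) := by
  refine Complex.log_conj s fun h => ?_
  have := Complex.abs_arg_lt_pi_div_two_iff.2 (Or.inl hs)
  rw [h, abs_of_pos Real.pi_pos] at this
  linarith [Real.pi_pos]

theorem IsTransformOnCutPlane.scarpiPower_conj (hA : IsTransformOnCutPlane α A) {s : ℂ}
    (hs : 0 < s.re) : (starRingEnd ℂ) (scarpiPower A (Complex.log ((starRingEnd ℂ) s))) =
      scarpiPower A (Complex.log s) := by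
  rw [hA.scarpiPower_log hs, hA.scarpiPower_log (by simpa using hs), log_conj_of_re_pos hs,
    laplaceTransform_conj, ← Complex.exp_conj]
  simp

theorem IsScarpiKernel.ae_eq {φ φ' : ℝ → ℝ} (h : IsScarpiKernel α φ) (h' : IsScarpiKernel α φ') :
    ∀ᵐ t ∂(volume.restrict (Ioi (0 : ℝ))), φ t = φ' t := by
  obtain ⟨σ, hσ⟩ := h
  obtain ⟨σ', hσ'⟩ := h'
  have h1 : IsLaplace (fun t => (φ t : ℂ)) σ _ := hσ
  have h2 : IsLaplace (fun t => (φ' t : ℂ)) σ' _ := hσ'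
  filter_upwards [(h1.mono (le_max_left σ σ')).ae_eq (h2.mono (le_max_right σ σ'))] with t ht
  exact_mod_cast ht

/-- Existence of the Scarpi kernel, well-posedness of the Cauchy problem, and the representation of
its solution as an integral along a Hankel contour that surrounds all singularities. -/
theorem IsTransformOnCutPlane.exists_solution (hα : IsTransitionFunction α)
    (hA : IsTransformOnCutPlane α A)
    (h_infty : ∃ l : ℂ, Tendsto (fun z : ℂ => Complex.exp z * A z)
      (comap Complex.re atTop ⊓ 𝓟 cutStrip) (𝓝 l)) (hlam : 0 < lam) :
    ∃ (L β : ℝ) (p : ℝ → ℝ), 0 ≤ L ∧ 0 < β ∧ β < 1 ∧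
      (∀ z : ℂ, L ≤ z.re → |z.im| ≤ Real.pi →
        AnalyticAt ℂ A z ∧ 2 * lam ≤ ‖scarpiPower A z‖) ∧
      (∃ φ : ℝ → ℝ, IsScarpiKernel α φ) ∧
      (∀ φ : ℝ → ℝ, IsScarpiKernel α φ → ∀ u₀ : ℝ,
        IsRelaxationSolution φ lam u₀ (fun t => u₀ * p t) ∧
        ∀ v, IsRelaxationSolution φ lam u₀ v → EqOn v (fun t => u₀ * p t) (Ici 0)) ∧
      DecaysOnStrip (relaxationSymbol A lam) L β 2 ∧
      ∀ t, 0 < t → (p t : ℂ) = hankel (relaxationSymbol A lam) L t := by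
  obtain ⟨β, C, L, hβ, hβ2, hC, hL, hb⟩ := hA.exists_scarpiPower_bounds_atTop hα h_infty lam
  have hβ1 : β < 1 := by linarith
  have hdφ := decaysOnStrip_scarpiKernel (A := A) (L := L) (C := C) (β := β)
    fun z hz hzi => ⟨(hb z hz hzi).1, (hb z hz hzi).2.2.2⟩
  have hdv := decaysOnStrip_inv_add (A := A) (L := L) (β := β) hlam hC
    fun z hz hzi => ⟨(hb z hz hzi).1, (hb z hz hzi).2.1, (hb z hz hzi).2.2.1⟩
  have hdU := decaysOnStrip_relaxationSymbol (A := A) (L := L) hlam hL hβ1.le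
    fun z hz hzi => ⟨(hb z hz hzi).1, (hb z hz hzi).2.1⟩
  have hσ : 0 ≤ Real.exp L := (Real.exp_pos L).le
  have hσpos : ∀ {s : ℂ}, Real.exp L < s.re → 0 < s.re := fun hs => (Real.exp_pos L).trans hs
  set φ : ℝ → ℝ := fun t => (hankel (fun z => scarpiPower A z * Complex.exp (-z)) L t).re with hφdef
  set v : ℝ → ℝ := fun t => (hankel (fun z => 1 / (scarpiPower A z + lam)) L t).re with hvdef
  have hφL : IsLaplace (fun t => (φ t : ℂ)) (Real.exp L) _ :=
    (hdφ.isLaplace_hankel hβ hβ1).re fun s hs => by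
      have hlog := log_conj_of_re_pos (hσpos hs)
      rw [map_mul, hA.scarpiPower_conj (hσpos hs), ← Complex.exp_conj, map_neg, hlog,
        Complex.conj_conj]
  have hvL : IsLaplace (fun t => (v t : ℂ)) (Real.exp L) _ :=
    (hdv.isLaplace_hankel hβ hβ1).re fun s hs => by
      simp only [map_div₀, map_one, map_add, hA.scarpiPower_conj (hσpos hs), Complex.conj_ofReal]
  have hne : ∀ {s : ℂ}, Real.exp L < s.re → s ≠ 0 ∧ scarpiPower A (Complex.log s) + lam ≠ 0 := by
    intro s hs
    have hs0 : s ≠ 0 := fun h => by simpa [h] using hσpos hs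
    refine ⟨hs0, ?_⟩
    have h1 : L ≤ (Complex.log s).re := by
      rw [Complex.log_re, Real.le_log_iff_exp_le (norm_pos_iff.2 hs0)]
      exact hs.le.trans (Complex.re_le_norm s)
    have h2 : |(Complex.log s).im| ≤ Real.pi := by
      rw [Complex.log_im]; exact Complex.abs_arg_le_pi s
    have h3 := half_norm_le_norm_add (hb _ h1 h2).2.1 hlam
    have h4 := (hb _ h1 h2).2.1
    rw [← norm_pos_iff]
    linarith
  have hΦV : ∀ s : ℂ, Real.exp L < s.re →
      scarpiPower A (Complex.log s) * Complex.exp (-Complex.log s) *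
        (1 / (scarpiPower A (Complex.log s) + lam)) =
      1 / s - lam * (1 / (scarpiPower A (Complex.log s) + lam) / s) := by
    intro s hs
    obtain ⟨h1, h2⟩ := hne hs
    rw [Complex.exp_neg, Complex.exp_log h1]
    field_simp
    ring
  have hcre : ∀ {f : ℝ → ℂ}, ContinuousOn f (Ioi 0) →
      ContinuousOn (fun t => ((f t).re : ℂ)) (Ioi 0) := fun hf =>
    (Complex.continuous_ofReal.comp Complex.continuous_re).comp_continuousOn hf
  have hbre : ∀ {f : ℝ → ℂ} {a : ℝ}, PowerBounded f a → PowerBounded (fun t => ((f t).re : ℂ)) a :=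
    fun hf => hf.mono_norm fun t => by
      rw [Complex.norm_real]; exact Complex.abs_re_le_norm _
  have hker : IsScarpiKernel α φ := by
    have h1 := hφL.congr_right (G := fun s => s ^ (s * laplaceTransform α s - 1)) fun s hs => by
      have hs0 := (hne hs).1
      rw [hA.scarpiPower_log (hσpos hs), ← Complex.exp_add, Complex.cpow_def_of_ne_zero hs0]
      ring_nf
    exact ⟨Real.exp L, h1⟩
  have hsol : ∀ u₀, IsRelaxationSolution φ lam u₀ (fun t => u₀ * relaxationProfile v lam t) :=
    isRelaxationSolution_relaxationProfile hσ hφL hvL hΦV (half_pos hβ) (half_pos hβ)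
      (hbre (hdφ.powerBounded_hankel hβ hβ1)) (hbre (hdv.powerBounded_hankel hβ hβ1))
      (hcre (hdφ.continuousOn_hankel hβ hβ1)) (hcre (hdv.continuousOn_hankel hβ hβ1))
  refine ⟨L, β, relaxationProfile v lam, hL, hβ, hβ1,
    fun z hz hzi => ⟨(hb z hz hzi).1, (hb z hz hzi).2.1⟩, ⟨φ, hker⟩, ?_, hdU, ?_⟩
  · intro φ' hφ' u₀
    refine ⟨(hsol u₀).congr_kernel (hker.ae_eq hφ'), fun w hw => ?_⟩
    exact (hw.congr_kernel (hφ'.ae_eq hker)).eqOn hσ hφL hvL hΦV (hsol u₀)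
  · intro t ht
    refine ((isLaplace_relaxationProfile hσ hvL).congr_right fun s hs => ?_).eqOn
      (hdU.isLaplace_hankel hβ hβ1) (continuousOn_relaxationProfile hvL)
      (hdU.continuousOn_hankel hβ hβ1) ht
    rw [← hΦV s hs, relaxationSymbol]
    ring

end kernels

/-! ### The partial fractions of the cotangent -/

/-- The terms of the Mittag-Leffler expansion of `π cot (π x)`: `1 / x`, and `1 / (x - n)` paired
with `1 / (x + n)` for `n ≥ 1`. -/
noncomputable def cotSummand (n : ℕ) (x : ℂ) : ℂ :=
  if n = 0 then 1 / x else 1 / (x - n) + 1 / (x + n)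

/-- `e^{2πix} / (e^{2πix} - 1)`, which has a simple pole at each integer. -/
noncomputable def expRatio (x : ℂ) : ℂ :=
  Complex.exp (2 * Real.pi * Complex.I * x) / (Complex.exp (2 * Real.pi * Complex.I * x) - 1)

theorem exp_two_pi_I_mul_sub_one_ne_zero {x : ℂ} (hx : ∀ n : ℤ, x ≠ n) :
    Complex.exp (2 * Real.pi * Complex.I * x) - 1 ≠ 0 := by
  intro h
  obtain ⟨n, hn⟩ := Complex.exp_eq_one_iff.1 (sub_eq_zero.1 h)
  refine hx n ?_
  have h2 : (2 * Real.pi * Complex.I : ℂ) ≠ 0 := Complex.two_pi_I_ne_zero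
  exact mul_left_cancel₀ h2 (hn.trans (mul_comm _ _))

theorem hasSum_cotSummand {x : ℂ} (hx : ∀ n : ℤ, x ≠ n) :
    HasSum (fun n => cotSummand n x)
      (2 * Real.pi * Complex.I * expRatio x - Real.pi * Complex.I) := by
  have hx' : x ∈ Complex.integerComplement := by
    rintro ⟨n, hn⟩
    exact hx n hn.symm
  have h1 : HasSum (fun n : ℕ => cotSummand (n + 1) x)
      (Real.pi * Complex.cot (Real.pi * x) - 1 / x) := by
    rw [cot_series_rep' hx']
    have := (summable_cotTerm hx').hasSum
    simp only [cotTerm] at this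
    simpa [cotSummand] using this
  have h2 := (hasSum_nat_add_iff (f := fun n => cotSummand n x) 1).1 h1
  rw [Finset.sum_range_one, show cotSummand 0 x = 1 / x by simp [cotSummand], sub_add_cancel,
    Complex.cot_pi_eq_exp_ratio] at h2
  refine (Eq.subst (motive := HasSum fun n => cotSummand n x) ?_ h2)
  have h3 := exp_two_pi_I_mul_sub_one_ne_zero hx
  rw [expRatio]
  set w := Complex.exp (2 * Real.pi * Complex.I * x)
  have h4 : 1 - w ≠ 0 := fun h => h3 (by linear_combination -h)
  have h5 : Complex.I ≠ 0 := Complex.I_ne_zero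
  have h6 : w / (w - 1) = -(w / (1 - w)) := by rw [← div_neg, neg_sub]
  have h7 := Complex.I_sq
  rw [h6]
  field_simp
  linear_combination (w + 1) * h7

theorem cotSummand_neg (n : ℕ) (x : ℂ) : cotSummand n (-x) = -cotSummand n x := by
  unfold cotSummand
  split_ifs
  · rw [div_neg]
  · rw [show -x - (n : ℂ) = -(x + n) by ring, show -x + (n : ℂ) = -(x - n) by ring, div_neg, div_neg]
    ring

theorem analyticAt_cotSummand {n : ℕ} {x : ℂ} (h1 : x ≠ n) (h2 : x ≠ -n) :
    AnalyticAt ℂ (cotSummand n) x := by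
  have h3 : x - n ≠ 0 := sub_ne_zero.2 h1
  have h4 : x + n ≠ 0 := fun h => h2 (by linear_combination h)
  rcases eq_or_ne n 0 with rfl | hn
  · have : cotSummand 0 = fun x : ℂ => 1 / x := by ext; simp [cotSummand]
    rw [this]
    exact analyticAt_const.div analyticAt_id (by simpa using h1)
  · have : cotSummand n = fun x : ℂ => 1 / (x - n) + 1 / (x + n) := by ext; simp [cotSummand, hn]
    rw [this]
    exact ((analyticAt_const (v := (1 : ℂ))).div (analyticAt_id.sub analyticAt_const) h3).add
      ((analyticAt_const (v := (1 : ℂ))).div (analyticAt_id.add analyticAt_const) h4)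

/-- At an integer the ratio has the same principal part as one of the summands, up to the
factor `2πi`. -/
theorem exists_analyticAt_expRatio_sub (m : ℤ) : ∃ k : ℂ → ℂ, AnalyticAt ℂ k m ∧
    ∀ x : ℂ, x ≠ m → expRatio x =
      (2 * Real.pi * Complex.I)⁻¹ * cotSummand m.natAbs x + k x := by
  have hpi : (2 * Real.pi * Complex.I : ℂ) ≠ 0 := Complex.two_pi_I_ne_zero
  set D : ℂ → ℂ := fun x => Complex.exp (2 * Real.pi * Complex.I * x) - 1 with hD
  have hDan : ∀ x, AnalyticAt ℂ D x := fun x => by fun_prop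
  have he : Complex.exp (2 * Real.pi * Complex.I * m) = 1 := by
    rw [mul_comm]
    exact Complex.exp_int_mul_two_pi_mul_I m
  have hd : deriv D m = 2 * Real.pi * Complex.I := by
    have h1 : HasDerivAt D (Complex.exp (2 * Real.pi * Complex.I * m) *
        (2 * Real.pi * Complex.I * 1)) m :=
      (((hasDerivAt_id' (m : ℂ)).const_mul (2 * Real.pi * Complex.I)).cexp).sub_const 1
    rw [h1.deriv, he]
    ring
  set w : ℂ → ℂ := fun x => Complex.exp (2 * Real.pi * Complex.I * x) / dslope D m x with hw
  have hwan : AnalyticAt ℂ w m := by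
    refine AnalyticAt.div (by fun_prop) (hDan m).dslope_self ?_
    rwa [dslope_same, hd]
  have hwm : w m = (2 * Real.pi * Complex.I)⁻¹ := by
    simp only [hw, dslope_same, hd, he, one_div]
  have hq : ∀ x : ℂ, x ≠ m →
      expRatio x = (2 * Real.pi * Complex.I)⁻¹ * (1 / (x - m)) + dslope w m x := by
    intro x hx
    have hx' : x - m ≠ 0 := sub_ne_zero.2 hx
    have hDm : D m = 0 := by simp [hD, he]
    rw [dslope_of_ne _ hx, slope_def_field, hwm]
    simp only [hw]
    rw [dslope_of_ne _ hx, slope_def_field, hDm, sub_zero, expRatio]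
    rw [div_div_eq_mul_div]
    field_simp
    ring
  obtain ⟨k, hk, hkx⟩ : ∃ k : ℂ → ℂ, AnalyticAt ℂ k m ∧
      ∀ x, cotSummand m.natAbs x = 1 / (x - m) + k x := by
    rcases lt_trichotomy m 0 with hm | rfl | hm
    · have h1 : ((m.natAbs : ℕ) : ℂ) = -m := by
        rw [← Int.cast_natCast, Int.natCast_natAbs, abs_of_neg hm]; simp
      refine ⟨fun x => 1 / (x + m), analyticAt_const.div (by fun_prop) ?_, fun x => ?_⟩
      · norm_cast; omega
      · rw [cotSummand, if_neg (by omega), h1]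
        ring
    · exact ⟨fun _ => 0, analyticAt_const, fun x => by simp [cotSummand]⟩
    · have h1 : ((m.natAbs : ℕ) : ℂ) = m := by
        rw [← Int.cast_natCast, Int.natCast_natAbs, abs_of_pos hm]
      refine ⟨fun x => 1 / (x + m), analyticAt_const.div (by fun_prop) ?_, fun x => ?_⟩
      · norm_cast; omega
      · rw [cotSummand, if_neg (by omega), h1]
  refine ⟨fun x => dslope w m x - (2 * Real.pi * Complex.I)⁻¹ * k x,
    hwan.dslope_self.sub (analyticAt_const.mul hk), fun x hx => ?_⟩
  rw [hq x hx, hkx x]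
  ring

/-- The bound of a single summand in terms of the distance `d` of `x` to the integers: only the
summands with index `0` and with index nearest to `x` feel `d`, and the others are dominated by
terms whose sum over `n` is bounded by a multiple of `‖x‖ ^ η`. -/
theorem norm_cotSummand_le {η : ℝ} (hη : η ∈ Ioo (0 : ℝ) 1) {x : ℂ} (hx : 0 ≤ x.re) {d : ℝ}
    (hd : 0 < d) (hdx : ∀ n : ℤ, d ≤ ‖x - n‖) (n : ℕ) :
    ‖cotSummand n x‖ ≤ (if n = 0 then 1 / d else 0) + (if (n : ℤ) = round x.re then 2 / d else 0) +
      4 * ‖x‖ ^ η * (|((n : ℤ) : ℝ)| ^ (-(1 + η)) +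
        |((round x.re - n : ℤ) : ℝ)| ^ (-(1 + η))) := by
  obtain ⟨hη0, hη1⟩ := hη
  set N : ℤ := round x.re with hN
  have hr : 0 ≤ ‖x‖ ^ η := Real.rpow_nonneg (norm_nonneg _) _
  have hT : 0 ≤ 4 * ‖x‖ ^ η * (|((n : ℤ) : ℝ)| ^ (-(1 + η)) +
        |((round x.re - n : ℤ) : ℝ)| ^ (-(1 + η))) := by positivity
  have hdn : d ≤ ‖x - n‖ := by simpa using hdx n
  have hxr : ‖x‖ ≤ ‖x + n‖ := by
    rw [Complex.norm_eq_sqrt_sq_add_sq, Complex.norm_eq_sqrt_sq_add_sq]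
    refine Real.sqrt_le_sqrt ?_
    simp only [Complex.add_re, Complex.natCast_re, Complex.add_im, Complex.natCast_im, add_zero]
    have : (0 : ℝ) ≤ n := Nat.cast_nonneg n
    nlinarith
  have hnr : (n : ℝ) ≤ ‖x + n‖ := by
    refine le_trans ?_ (Complex.re_le_norm _)
    simp [hx]
  have hx0 : 0 < ‖x‖ := hd.trans_le (by simpa using hdx 0)
  have hpos : 0 < ‖x + n‖ := hx0.trans_le hxr
  rcases Nat.eq_zero_or_pos n with rfl | hn
  · have h1 : ‖cotSummand 0 x‖ ≤ 1 / d := by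
      rw [cotSummand, if_pos rfl, norm_div, norm_one]
      exact one_div_le_one_div_of_le hd (by simpa using hdn)
    have h2 : (0 : ℝ) ≤ if ((0 : ℕ) : ℤ) = N then 2 / d else 0 := by split_ifs <;> positivity
    rw [if_pos rfl]
    exact h1.trans (by rw [add_assoc]; exact le_add_of_nonneg_right (add_nonneg h2 hT))
  rw [if_neg hn.ne', zero_add]
  have hxn : x - n ≠ 0 := norm_pos_iff.1 (hd.trans_le hdn)
  have hxn' : x + n ≠ 0 := norm_pos_iff.1 hpos
  have hn0 : (0 : ℝ) < n := by exact_mod_cast hn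
  have hform : ‖cotSummand n x‖ = 2 * ‖x‖ / (‖x - n‖ * ‖x + n‖) := by
    rw [cotSummand, if_neg hn.ne', ← norm_mul, show (2 : ℝ) * ‖x‖ = ‖2 * x‖ by simp, ← norm_div]
    congr 1
    field_simp
    ring
  have hxnp : 0 < ‖x - n‖ := norm_pos_iff.2 hxn
  rw [hform]
  split_ifs with hnN
  · refine le_trans ?_ (le_add_of_nonneg_right hT)
    rw [div_le_div_iff₀ (by positivity) hd]
    have : d * ‖x‖ ≤ ‖x - n‖ * ‖x + n‖ := mul_le_mul hdn hxr hx0.le hxnp.le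
    linarith
  rw [zero_add]
  -- here `|x - n| ≥ |N - n| / 2`, since `N` is the integer nearest to `Re x`
  have hNn : (1 : ℝ) ≤ |((N - n : ℤ) : ℝ)| := by
    rw [← Int.cast_abs]
    exact_mod_cast Int.one_le_abs (sub_ne_zero.2 (Ne.symm hnN))
  have hb : |((N - n : ℤ) : ℝ)| / 2 ≤ ‖x - n‖ := by
    have h1 := abs_sub_round x.re
    rw [← hN] at h1
    have h2 : |x.re - n| ≤ ‖x - n‖ := by
      refine le_trans (le_of_eq ?_) (Complex.abs_re_le_norm _)
      simp
    have h3 : |((N - n : ℤ) : ℝ)| ≤ |x.re - N| + |x.re - n| := by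
      push_cast
      rw [show (N : ℝ) - n = -(x.re - N) + (x.re - n) by ring]
      exact (abs_add_le _ _).trans (by rw [abs_neg])
    linarith
  -- interpolate between the two lower bounds of `|x + n|`
  have hi : ‖x‖ ^ (1 - η) * (n : ℝ) ^ η ≤ ‖x + n‖ := by
    calc ‖x‖ ^ (1 - η) * (n : ℝ) ^ η ≤ ‖x + n‖ ^ (1 - η) * ‖x + n‖ ^ η := by
          gcongr
      _ = ‖x + n‖ := by rw [← Real.rpow_add hpos]; simp
  have hsplit : ‖x‖ = ‖x‖ ^ η * ‖x‖ ^ (1 - η) := by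
    rw [← Real.rpow_add hx0]; simp
  set M : ℝ := |((N - n : ℤ) : ℝ)| with hM
  have hM0 : 0 < M := by linarith
  have hnabs : |((n : ℤ) : ℝ)| = n := by simp
  have hx1 : 0 < ‖x‖ ^ (1 - η) := Real.rpow_pos_of_pos hx0 _
  have hnη : 0 < (n : ℝ) ^ η := Real.rpow_pos_of_pos hn0 _
  calc 2 * ‖x‖ / (‖x - n‖ * ‖x + n‖)
      ≤ 2 * ‖x‖ / (M / 2 * (‖x‖ ^ (1 - η) * (n : ℝ) ^ η)) := by
        gcongr
    _ = 4 * ‖x‖ ^ η * ((n : ℝ) ^ η)⁻¹ * M⁻¹ := by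
        nth_rewrite 1 [hsplit]
        field_simp
        norm_num
    _ ≤ 4 * ‖x‖ ^ η * ((n : ℝ) ^ (-(1 + η)) + M ^ (-(1 + η))) := by
        rw [mul_assoc]
        refine mul_le_mul_of_nonneg_left ?_ (by positivity)
        have e : ∀ y : ℝ, 0 < y → y ^ (-(1 + η)) = (y ^ η)⁻¹ * y⁻¹ := fun y hy => by
          rw [neg_add, add_comm, Real.rpow_add hy, Real.rpow_neg hy.le, Real.rpow_neg hy.le,
            Real.rpow_one]
        rcases le_total (n : ℝ) M with h | h
        · refine le_add_of_le_of_nonneg ?_ (by positivity)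
          rw [e _ hn0]
          gcongr
        · refine le_add_of_nonneg_of_le (by positivity) ?_
          rw [e _ hM0]
          gcongr
    _ = _ := by rw [hnabs]

/-- The series of absolute values grows slower than any power of `‖x‖`, away from the integers. -/
theorem exists_sum_norm_cotSummand_le {η : ℝ} (hη : η ∈ Ioo (0 : ℝ) 1) : ∃ C : ℝ, 0 ≤ C ∧
    ∀ (x : ℂ) (d : ℝ), 0 < d → (∀ n : ℤ, d ≤ ‖x - n‖) → ∀ s : Finset ℕ,
      ∑ n ∈ s, ‖cotSummand n x‖ ≤ C * (‖x‖ ^ η + 1 / d) := by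
  have hs : Summable fun n : ℤ => |(n : ℝ)| ^ (-(1 + η)) :=
    Real.summable_abs_int_rpow (by linarith [hη.1])
  set B : ℝ := ∑' n : ℤ, |(n : ℝ)| ^ (-(1 + η)) with hB
  have hB0 : 0 ≤ B := tsum_nonneg fun n => Real.rpow_nonneg (abs_nonneg _) _
  have key : ∀ (x : ℂ) (d : ℝ), 0 ≤ x.re → 0 < d → (∀ n : ℤ, d ≤ ‖x - n‖) → ∀ s : Finset ℕ,
      ∑ n ∈ s, ‖cotSummand n x‖ ≤ (8 * B + 3) * (‖x‖ ^ η + 1 / d) := by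
    intro x d hx hd hdx s
    have hsum : ∀ g : ℕ → ℤ, Function.Injective g →
        ∑ n ∈ s, |((g n : ℤ) : ℝ)| ^ (-(1 + η)) ≤ B := by
      intro g hg
      calc ∑ n ∈ s, |((g n : ℤ) : ℝ)| ^ (-(1 + η))
          = ∑ k ∈ s.map ⟨g, hg⟩, |(k : ℝ)| ^ (-(1 + η)) := by rw [Finset.sum_map]; rfl
        _ ≤ B := hs.sum_le_tsum _ fun n _ => Real.rpow_nonneg (abs_nonneg _) _
    have h1 := hsum (fun n => (n : ℤ)) Nat.cast_injective
    have h2 := hsum (fun n => round x.re - n) (fun a b h => by simpa using h)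
    have h3 : ∑ n ∈ s, (if n = 0 then 1 / d else 0) ≤ 1 / d := by
      rw [Finset.sum_ite_eq']
      split_ifs
      · exact le_rfl
      · positivity
    have h4 : ∑ n ∈ s, (if (n : ℤ) = round x.re then 2 / d else 0) ≤ 2 / d := by
      calc ∑ n ∈ s, (if (n : ℤ) = round x.re then 2 / d else 0)
          ≤ ∑ n ∈ s, (if n = (round x.re).toNat then 2 / d else 0) := by
            refine Finset.sum_le_sum fun n _ => ?_
            split_ifs with ha hb
            · exact le_rfl
            · exact absurd (by omega) hb
            · positivity
            · exact le_rfl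
        _ ≤ 2 / d := by
          rw [Finset.sum_ite_eq']
          split_ifs
          · exact le_rfl
          · positivity
    have hr : 0 ≤ ‖x‖ ^ η := Real.rpow_nonneg (norm_nonneg _) _
    refine (Finset.sum_le_sum fun n _ => norm_cotSummand_le hη hx hd hdx n).trans ?_
    rw [Finset.sum_add_distrib, Finset.sum_add_distrib, ← Finset.mul_sum, Finset.sum_add_distrib]
    have h5 : 4 * ‖x‖ ^ η * (∑ n ∈ s, |((n : ℤ) : ℝ)| ^ (-(1 + η)) +
        ∑ n ∈ s, |((round x.re - n : ℤ) : ℝ)| ^ (-(1 + η))) ≤ 4 * ‖x‖ ^ η * (B + B) := by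
      gcongr
    have hd' : 0 < 1 / d := by positivity
    have h6 : 2 / d = 2 * (1 / d) := by ring
    nlinarith [mul_nonneg hB0 hd'.le]
  refine ⟨8 * B + 3, by positivity, fun x d hd hdx s => ?_⟩
  rcases le_total 0 x.re with hx | hx
  · exact key x d hx hd hdx s
  · have h := key (-x) d (by simpa using hx) hd (fun n => by
      have := hdx (-n)
      rw [← norm_neg] at this
      refine this.trans (le_of_eq ?_)
      congr 1
      push_cast
      ring) s
    simpa [cotSummand_neg] using h

/-! ### The cotangent series along a ray ending at a pole -/

/-- On a ray that ends at a pole the distance to the integers enters through this integral: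
each unit interval contributes the same finite integral, weighted by a summable power. -/
theorem lintegral_abs_sub_round_rpow_lt_top {e μ : ℝ} (he : e ∈ Ioo (0 : ℝ) 1) (hμ : 0 < μ) :
    ∫⁻ t in Ioi (1 : ℝ), ENNReal.ofReal (|t - round t| ^ (-e) * t ^ (-(1 + μ))) < ⊤ := by
  set K : ENNReal := ∫⁻ t in Ioc (0 : ℝ) 1, ENNReal.ofReal (|t - round t| ^ (-e)) with hK
  have hKfin : K < ⊤ := by
    have h1 : IntervalIntegrable (fun t : ℝ => t ^ (-e)) volume 0 1 :=
      intervalIntegral.intervalIntegrable_rpow' (by linarith [he.2])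
    have h2 : IntervalIntegrable (fun t : ℝ => (1 - t) ^ (-e)) volume 0 1 := by
      simpa using (h1.comp_sub_left 1).symm
    have h3 := (h1.add h2).1
    have h4 : ∀ᵐ t : ℝ ∂(volume.restrict (Ioc (0 : ℝ) 1)),
        ENNReal.ofReal (|t - round t| ^ (-e)) ≤ ENNReal.ofReal (t ^ (-e) + (1 - t) ^ (-e)) := by
      have h5 : ∀ᵐ t : ℝ ∂(volume.restrict (Ioc (0 : ℝ) 1)), t ≠ 1 :=
        ae_restrict_of_ae (Measure.ae_ne volume (1 : ℝ))
      filter_upwards [h5, ae_restrict_mem measurableSet_Ioc] with t ht ht'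
      have hfr : Int.fract t = t := Int.fract_eq_self.2 ⟨ht'.1.le, lt_of_le_of_ne ht'.2 ht⟩
      refine ENNReal.ofReal_le_ofReal ?_
      rw [abs_sub_round_eq_min, hfr]
      have p1 : 0 ≤ t ^ (-e) := Real.rpow_nonneg ht'.1.le _
      have p2 : 0 ≤ (1 - t) ^ (-e) := Real.rpow_nonneg (by linarith [ht'.2]) _
      rcases min_choice t (1 - t) with h | h <;> rw [h] <;> linarith
    exact (lintegral_mono_ae h4).trans_lt h3.lintegral_lt_top
  have hcover : Ioi (1 : ℝ) ⊆ ⋃ n : ℕ, Ioc ((n : ℝ) + 1) (n + 2) := by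
    intro t ht
    rw [mem_Ioi] at ht
    have h1 : 1 < ⌈t⌉₊ := Nat.lt_ceil.2 (by simpa using ht)
    refine mem_iUnion.2 ⟨⌈t⌉₊ - 2, ?_⟩
    have h2 : ((⌈t⌉₊ - 2 : ℕ) : ℝ) = ⌈t⌉₊ - 2 := by
      push_cast [Nat.cast_sub (show 2 ≤ ⌈t⌉₊ by omega)]; ring
    rw [h2]
    have h3 := Nat.ceil_lt_add_one (show 0 ≤ t by linarith)
    have h4 := Nat.le_ceil t
    constructor <;> linarith
  have hpiece : ∀ n : ℕ, ∫⁻ t in Ioc ((n : ℝ) + 1) (n + 2),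
      ENNReal.ofReal (|t - round t| ^ (-e) * t ^ (-(1 + μ))) ≤
        ENNReal.ofReal (((n : ℝ) + 1) ^ (-(1 + μ))) * K := by
    intro n
    have himg : (fun t : ℝ => t + (n + 1)) '' Ioc (0 : ℝ) 1 = Ioc ((n : ℝ) + 1) (n + 2) := by
      rw [image_add_const_Ioc]
      congr 1 <;> ring
    rw [← himg, lintegral_image_eq_lintegral_abs_deriv_mul (f' := fun _ => 1) measurableSet_Ioc
      (fun x _ => ((hasDerivAt_id' x).add_const _).hasDerivWithinAt)
      (add_left_injective _).injOn, hK, ← lintegral_const_mul' _ _ ENNReal.ofReal_ne_top]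
    refine setLIntegral_mono' measurableSet_Ioc fun t ht => ?_
    have hround : t + ((n : ℝ) + 1) - round (t + ((n : ℝ) + 1)) = t - round t := by
      have : (n : ℝ) + 1 = ((n + 1 : ℕ) : ℝ) := by push_cast; ring
      rw [this, round_add_natCast]
      push_cast
      ring
    rw [hround, abs_one, ENNReal.ofReal_one, one_mul,
      ← ENNReal.ofReal_mul (Real.rpow_nonneg (by positivity) _), mul_comm]
    refine ENNReal.ofReal_le_ofReal (mul_le_mul_of_nonneg_right ?_
      (Real.rpow_nonneg (abs_nonneg _) _))
    exact Real.rpow_le_rpow_of_nonpos (by positivity) (by linarith [ht.1]) (by linarith)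
  have hsum : ∑' n : ℕ, ENNReal.ofReal (((n : ℝ) + 1) ^ (-(1 + μ))) < ⊤ := by
    have h1 : Summable fun n : ℕ => ((n : ℝ) + 1) ^ (-(1 + μ)) := by
      have := (summable_nat_add_iff 1).2 (Real.summable_nat_rpow.2 (show -(1 + μ) < -1 by linarith))
      simpa using this
    exact lt_top_iff_ne_top.2 h1.tsum_ofReal_ne_top
  calc ∫⁻ t in Ioi (1 : ℝ), ENNReal.ofReal (|t - round t| ^ (-e) * t ^ (-(1 + μ)))
      ≤ ∫⁻ t in ⋃ n : ℕ, Ioc ((n : ℝ) + 1) (n + 2),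
          ENNReal.ofReal (|t - round t| ^ (-e) * t ^ (-(1 + μ))) := lintegral_mono_set hcover
    _ ≤ ∑' n : ℕ, ∫⁻ t in Ioc ((n : ℝ) + 1) (n + 2),
          ENNReal.ofReal (|t - round t| ^ (-e) * t ^ (-(1 + μ))) := lintegral_iUnion_le _ _
    _ ≤ ∑' n : ℕ, ENNReal.ofReal (((n : ℝ) + 1) ^ (-(1 + μ))) * K := ENNReal.tsum_le_tsum hpiece
    _ = (∑' n : ℕ, ENNReal.ofReal (((n : ℝ) + 1) ^ (-(1 + μ)))) * K := ENNReal.tsum_mul_right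
    _ < ⊤ := ENNReal.mul_lt_top hsum hKfin

/-- Near a pole `b` takes every large value once, with `|b'|` so large that the substitution
`t = b y` bounds the integral of a power of the distance of `b` to the integers. -/
theorem exists_lintegral_pole_abs_sub_round_lt_top {k : ℝ → ℝ} (hk : AnalyticAt ℝ k 0)
    (hk0 : 0 < k 0) {m : ℕ} (hm : 0 < m) {e : ℝ} (he : e ∈ Ioo (0 : ℝ) 1) :
    ∃ δ > 0, (∀ᵐ y ∂(volume.restrict (Ioo 0 δ)), ∀ n : ℤ, k y / y ^ m ≠ n) ∧
      ∫⁻ y in Ioo 0 δ, ENNReal.ofReal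
        (|k y / y ^ m - round (k y / y ^ m)| ^ (-e) * y ^ (-(1 / 2) : ℝ)) < ⊤ := by
  set a := k 0 with ha
  set b : ℝ → ℝ := fun y => k y / y ^ m with hb
  have hm' : (0 : ℝ) < m := by exact_mod_cast hm
  have h1 : ∀ᶠ y in 𝓝 (0 : ℝ), DifferentiableAt ℝ k y :=
    hk.eventually_analyticAt.mono fun y hy => hy.differentiableAt
  have h2 : ∀ᶠ y in 𝓝 (0 : ℝ), y * deriv k y - m * k y < -(m * a / 2) := by
    have hc : ContinuousAt (fun y => y * deriv k y - m * k y) 0 :=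
      (continuousAt_id.mul hk.deriv.continuousAt).sub (continuousAt_const.mul hk.continuousAt)
    refine hc.eventually (gt_mem_nhds ?_)
    simp only [zero_mul, zero_sub, ← ha]
    nlinarith
  have h3 : ∀ᶠ y in 𝓝 (0 : ℝ), k y < 2 * a :=
    hk.continuousAt.eventually (gt_mem_nhds (by rw [← ha]; linarith))
  have h4 : ∀ᶠ y in 𝓝 (0 : ℝ), a / 2 < k y :=
    hk.continuousAt.eventually (lt_mem_nhds (by rw [← ha]; linarith))
  have h5 : ∀ᶠ y in 𝓝 (0 : ℝ), y ^ m < a / 2 := by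
    have hc : ContinuousAt (fun y : ℝ => y ^ m) 0 := by fun_prop
    refine hc.eventually (gt_mem_nhds ?_)
    simp only [zero_pow hm.ne']
    linarith
  obtain ⟨δ, hδ, H⟩ := Metric.eventually_nhds_iff_ball.1 (h1.and (h2.and (h3.and (h4.and h5))))
  have H' : ∀ y ∈ Ioo 0 δ, DifferentiableAt ℝ k y ∧ y * deriv k y - m * k y < -(m * a / 2) ∧
      k y < 2 * a ∧ a / 2 < k y ∧ y ^ m < a / 2 := fun y hy =>
    H y (by rw [Metric.mem_ball, Real.dist_eq, sub_zero, abs_of_pos hy.1]; exact hy.2)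
  have hder : ∀ y ∈ Ioo 0 δ, HasDerivAt b ((y * deriv k y - m * k y) / y ^ (m + 1)) y := by
    intro y hy
    have hy0 : y ≠ 0 := hy.1.ne'
    have := (H' y hy).1.hasDerivAt.fun_div (hasDerivAt_pow m y) (pow_ne_zero m hy0)
    refine this.congr_deriv ?_
    obtain ⟨j, rfl⟩ : ∃ j, m = j + 1 := ⟨m - 1, by omega⟩
    rw [Nat.add_sub_cancel]
    field_simp
    push_cast
    ring
  have hanti : StrictAntiOn b (Ioo 0 δ) := by
    refine strictAntiOn_of_deriv_neg (convex_Ioo 0 δ)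
      (fun y hy => (hder y hy).continuousAt.continuousWithinAt) fun y hy => ?_
    rw [interior_Ioo] at hy
    rw [(hder y hy).deriv]
    refine div_neg_of_neg_of_pos ((H' y hy).2.1.trans ?_) (pow_pos hy.1 _)
    have : 0 < m * a := mul_pos hm' hk0
    linarith
  have hb1 : ∀ y ∈ Ioo 0 δ, 1 < b y := by
    intro y hy
    obtain ⟨-, -, -, q1, q2⟩ := H' y hy
    rw [hb]
    simp only
    rw [one_lt_div (pow_pos hy.1 _)]
    linarith
  refine ⟨δ, hδ, ?_, ?_⟩
  · have hcount : (Ioo 0 δ ∩ b ⁻¹' range ((↑) : ℤ → ℝ)).Countable := by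
      have hfi : ∀ n : ℤ, (Ioo 0 δ ∩ b ⁻¹' {(n : ℝ)}).Subsingleton := by
        rintro n y ⟨hy, hy'⟩ z ⟨hz, hz'⟩
        exact hanti.injOn hy hz (hy'.trans hz'.symm)
      refine (countable_iUnion fun n : ℤ => (hfi n).countable).mono ?_
      rintro y ⟨hy, n, hn⟩
      exact mem_iUnion.2 ⟨n, hy, hn.symm⟩
    filter_upwards [ae_restrict_of_ae (hcount.ae_notMem volume),
      ae_restrict_mem measurableSet_Ioo] with y hy hy' n hn
    exact hy ⟨hy', n, hn.symm⟩
  · set ν : ℝ := 1 / (2 * m) with hν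
    have hν0 : 0 < ν := by positivity
    set g : ℝ → ENNReal := fun t => ENNReal.ofReal (|t - round t| ^ (-e) * t ^ (-(1 + ν))) with hg
    set C : ℝ := (2 * a) ^ (1 + ν) * (2 / (m * a)) with hC
    have hbound : ∀ y ∈ Ioo 0 δ, y ^ (-(1 / 2) : ℝ) ≤
        C * (|(y * deriv k y - m * k y) / y ^ (m + 1)| * b y ^ (-(1 + ν))) := by
      intro y hy
      obtain ⟨-, q0, q1, q2, q3⟩ := H' y hy
      have hy0 : 0 < y := hy.1
      have hbpos : 0 < b y := zero_lt_one.trans (hb1 y hy)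
      have hma : 0 < m * a := mul_pos hm' hk0
      have e1 : m * a / 2 / y ^ (m + 1) ≤ |(y * deriv k y - m * k y) / y ^ (m + 1)| := by
        rw [abs_div, abs_of_pos (pow_pos hy0 (m + 1))]
        gcongr
        rw [abs_of_neg (by linarith)]
        linarith
      have e2 : (2 * a / y ^ m) ^ (-(1 + ν)) ≤ b y ^ (-(1 + ν)) := by
        refine Real.rpow_le_rpow_of_nonpos hbpos ?_ (by linarith)
        rw [hb]
        simp only
        gcongr
      have e3 : (2 * a / y ^ m) ^ (-(1 + ν)) = ((2 * a) ^ (1 + ν))⁻¹ * (y ^ (m + 1) * y ^ (-(1 / 2) : ℝ)) := by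
        have hp : (y ^ m : ℝ) = y ^ (m : ℝ) := (Real.rpow_natCast y m).symm
        have hp' : (y ^ (m + 1) : ℝ) = y ^ ((m : ℝ) + 1) := by
          rw [← Real.rpow_natCast]; push_cast; rfl
        rw [Real.rpow_neg (by positivity), Real.div_rpow (by positivity) (by positivity), inv_div,
          hp, ← Real.rpow_mul hy0.le, hp', ← Real.rpow_add hy0, div_eq_inv_mul]
        congr 2
        rw [hν]
        field_simp
        ring
      have e4 : 0 < (2 * a) ^ (1 + ν) := Real.rpow_pos_of_pos (by linarith) _
      calc y ^ (-(1 / 2) : ℝ)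
          = C * (m * a / 2 / y ^ (m + 1) * (2 * a / y ^ m) ^ (-(1 + ν))) := by
            rw [e3, hC]
            field_simp
        _ ≤ _ := by
            refine mul_le_mul_of_nonneg_left ?_ (by positivity)
            exact mul_le_mul e1 e2 (Real.rpow_nonneg (by positivity) _) (abs_nonneg _)
    have hC0 : 0 ≤ C := by positivity
    calc ∫⁻ y in Ioo 0 δ, ENNReal.ofReal (|b y - round (b y)| ^ (-e) * y ^ (-(1 / 2) : ℝ))
        ≤ ∫⁻ y in Ioo 0 δ, ENNReal.ofReal C *
            (ENNReal.ofReal |(y * deriv k y - m * k y) / y ^ (m + 1)| * g (b y)) := by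
          refine setLIntegral_mono' measurableSet_Ioo fun y hy => ?_
          rw [hg]
          simp only
          rw [← ENNReal.ofReal_mul (abs_nonneg _), ← ENNReal.ofReal_mul hC0]
          refine ENNReal.ofReal_le_ofReal ?_
          have := mul_le_mul_of_nonneg_left (hbound y hy)
            (Real.rpow_nonneg (abs_nonneg (b y - round (b y))) (-e))
          refine this.trans (le_of_eq ?_)
          ring
      _ = ENNReal.ofReal C * ∫⁻ t in b '' Ioo 0 δ, g t := by
          rw [lintegral_const_mul' _ _ ENNReal.ofReal_ne_top,
            lintegral_image_eq_lintegral_abs_deriv_mul measurableSet_Ioo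
              (fun y hy => (hder y hy).hasDerivWithinAt) hanti.injOn]
      _ ≤ ENNReal.ofReal C * ∫⁻ t in Ioi 1, g t := by
          gcongr
          rintro _ ⟨y, hy, rfl⟩
          exact hb1 y hy
      _ < ⊤ := ENNReal.mul_lt_top ENNReal.ofReal_lt_top
          (lintegral_abs_sub_round_rpow_lt_top he hν0)

theorem exists_tsum_enorm_cotSummand_le {η : ℝ} (hη : η ∈ Ioo (0 : ℝ) 1) : ∃ C : ℝ, 0 ≤ C ∧
    ∀ (x : ℂ) (d : ℝ), 0 < d → (∀ n : ℤ, d ≤ ‖x - n‖) →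
      ∑' n, ‖cotSummand n x‖ₑ ≤ ENNReal.ofReal (C * (‖x‖ ^ η + 1 / d)) := by
  obtain ⟨C, hC, h⟩ := exists_sum_norm_cotSummand_le hη
  refine ⟨C, hC, fun x d hd hdx => ?_⟩
  rw [ENNReal.tsum_eq_iSup_sum]
  refine iSup_le fun s => ?_
  simp only [← ofReal_norm]
  rw [← ENNReal.ofReal_sum_of_nonneg fun _ _ => norm_nonneg _]
  exact ENNReal.ofReal_le_ofReal (h x d hd hdx s)

theorem re_div_ofReal_pow (w : ℂ) (y : ℝ) (m : ℕ) : (w / (y : ℂ) ^ m).re = w.re / y ^ m := by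
  rw [← Complex.ofReal_pow, Complex.div_ofReal_re]

theorem im_div_ofReal_pow (w : ℂ) (y : ℝ) (m : ℕ) : (w / (y : ℂ) ^ m).im = w.im / y ^ m := by
  rw [← Complex.ofReal_pow, Complex.div_ofReal_im]

/-- A real function takes integer values on any interval ending at a pole. -/
theorem not_forall_real_of_pole {k : ℝ → ℂ} (hk : AnalyticAt ℝ k 0) {σ : ℝ}
    (hσ : σ = 1 ∨ σ = -1) (hk0 : 0 < σ * (k 0).re) {m : ℕ} (hm : 0 < m)
    (hne : ∀ᶠ y : ℝ in 𝓝[>] 0, ∀ n : ℤ, k y / (y : ℂ) ^ m ≠ n) :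
    ¬ ∀ᶠ y in 𝓝 (0 : ℝ), (k y).im = 0 := by
  intro him
  have hcont : ∀ᶠ y in 𝓝 (0 : ℝ), ContinuousAt k y :=
    hk.eventually_analyticAt.mono fun y hy => hy.continuousAt
  obtain ⟨δ, hδ, H⟩ := mem_nhdsGT_iff_exists_Ioo_subset.1
    (hne.and (eventually_nhdsWithin_of_eventually_nhds (him.and hcont)))
  set b : ℝ → ℝ := fun y => σ * (k y).re / y ^ m with hb
  have hbc : ContinuousOn b (Ioo 0 δ) := fun y hy =>
    ((continuousAt_const.mul (Complex.continuous_re.continuousAt.comp (H hy).2.2)).div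
      (continuous_pow m).continuousAt (pow_ne_zero m hy.1.ne')).continuousWithinAt
  have hlim : Tendsto b (𝓝[>] 0) atTop := by
    have h1 : Tendsto (fun y => σ * (k y).re) (𝓝[>] 0) (𝓝 (σ * (k 0).re)) :=
      ((continuousAt_const.mul (Complex.continuous_re.continuousAt.comp hk.continuousAt)).tendsto
        ).mono_left nhdsWithin_le_nhds
    have h2 : Tendsto (fun y : ℝ => y ^ m) (𝓝[>] 0) (𝓝[>] 0) := by
      refine tendsto_nhdsWithin_iff.2 ⟨?_, ?_⟩
      · have : Tendsto (fun y : ℝ => y ^ m) (𝓝 0) (𝓝 (0 ^ m)) :=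
          (continuous_pow m).tendsto 0
        rw [zero_pow hm.ne'] at this
        exact this.mono_left nhdsWithin_le_nhds
      · filter_upwards [self_mem_nhdsWithin] with y hy using pow_pos (mem_Ioi.1 hy) m
    exact h1.pos_mul_atTop hk0 (tendsto_inv_nhdsGT_zero.comp h2)
  have hδ' : (0 : ℝ) < δ := hδ
  set y₁ : ℝ := δ / 2
  have hy₁ : 0 < y₁ := by positivity
  obtain ⟨y₂, hy₂, hy₂'⟩ := ((hlim.eventually_ge_atTop (⌈b y₁⌉ : ℝ)).and
    (Ioo_mem_nhdsGT hy₁)).exists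
  obtain ⟨y, hy, hyb⟩ := intermediate_value_Icc' hy₂'.2.le
    (hbc.mono fun z hz => ⟨hy₂'.1.trans_le hz.1, hz.2.trans_lt (half_lt_self hδ')⟩)
    ⟨Int.le_ceil _, hy₂⟩
  have hyI : y ∈ Ioo 0 δ := ⟨hy₂'.1.trans_le hy.1, hy.2.trans_lt (half_lt_self hδ')⟩
  obtain ⟨h1, h2, -⟩ := H hyI
  have hX : ∀ N : ℤ, (k y).re / y ^ m = N → k y / (y : ℂ) ^ m = N := fun N hN =>
    Complex.ext (by rw [re_div_ofReal_pow, hN, Complex.intCast_re])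
      (by rw [im_div_ofReal_pow, h2, zero_div, Complex.intCast_im])
  simp only [hb] at hyb
  rcases hσ with rfl | rfl
  · exact h1 _ (hX _ (by rw [← hyb, one_mul]))
  · refine h1 (-⌈b y₁⌉) (hX _ ?_)
    rw [Int.cast_neg, ← hyb]
    ring

/-- On a ray ending at a pole of `X = k / y ^ m` the distance of `X` to the integers has an
integrable reciprocal. If the leading coefficient is not real the distance is bounded below.
Otherwise it is at least a geometric mean of `|Im X| ≥ c y ^ j` and of the distance of `Re X` to
the integers. -/
theorem exists_lowerBound_dist_int_ray {k : ℝ → ℂ} (hk : AnalyticAt ℝ k 0) (hk0 : k 0 ≠ 0) {m : ℕ}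
    (hm : 0 < m) (hne : ∀ᶠ y : ℝ in 𝓝[>] 0, ∀ n : ℤ, k y / (y : ℂ) ^ m ≠ n) :
    ∃ δ > 0, ∃ d : ℝ → ℝ, (∀ᵐ y ∂(volume.restrict (Ioo 0 δ)),
      0 < d y ∧ ∀ n : ℤ, d y ≤ ‖k y / (y : ℂ) ^ m - n‖) ∧
      ∫⁻ y in Ioo 0 δ, ENNReal.ofReal (1 / d y) < ⊤ := by
  have hre : AnalyticAt ℝ (fun y => (k y).re) 0 :=
    (Complex.reCLM.analyticAt _).comp hk
  have him : AnalyticAt ℝ (fun y => (k y).im) 0 :=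
    (Complex.imCLM.analyticAt _).comp hk
  by_cases hi0 : (k 0).im = 0
  swap
  · set c : ℝ := |(k 0).im| / 2 with hc
    have hc0 : 0 < c := by positivity
    have h1 : ∀ᶠ y in 𝓝[>] (0 : ℝ), c < |(k y).im| :=
      eventually_nhdsWithin_of_eventually_nhds
        (him.continuousAt.abs.eventually (lt_mem_nhds (half_lt_self (abs_pos.2 hi0))))
    obtain ⟨δ, hδ, H⟩ := mem_nhdsGT_iff_exists_Ioo_subset.1
      (h1.and (Ioo_mem_nhdsGT (zero_lt_one' ℝ)))
    refine ⟨δ, hδ, fun _ => c, ?_, ?_⟩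
    · filter_upwards [ae_restrict_mem measurableSet_Ioo] with y hy
      refine ⟨hc0, fun n => ?_⟩
      obtain ⟨h2, h3⟩ := H hy
      refine le_trans ?_ (Complex.abs_im_le_norm _)
      rw [Complex.sub_im, im_div_ofReal_pow, Complex.intCast_im, sub_zero, abs_div,
        abs_of_pos (pow_pos h3.1 m), le_div_iff₀ (pow_pos h3.1 m)]
      have := pow_le_one₀ h3.1.le h3.2.le (n := m)
      nlinarith
    · rw [lintegral_const]
      exact ENNReal.mul_lt_top ENNReal.ofReal_lt_top (by simp)
  have hr0 : (k 0).re ≠ 0 := fun h => hk0 (Complex.ext h hi0)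
  obtain ⟨σ, hσ, hσ0⟩ : ∃ σ : ℝ, (σ = 1 ∨ σ = -1) ∧ 0 < σ * (k 0).re := by
    rcases lt_or_gt_of_ne hr0 with h | h
    · exact ⟨-1, Or.inr rfl, by linarith⟩
    · exact ⟨1, Or.inl rfl, by linarith⟩
  obtain ⟨J, g, hg, hg0, hJ⟩ := him.exists_eventuallyEq_pow_smul_nonzero_iff.2
    (not_forall_real_of_pole hk hσ hσ0 hm hne)
  set c : ℝ := |g 0| / 2 with hc
  have hc0 : 0 < c := by positivity
  have h1 : ∀ᶠ y in 𝓝[>] (0 : ℝ), c * y ^ (J + 1) < |(k y).im / y ^ m| := by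
    filter_upwards [eventually_nhdsWithin_of_eventually_nhds hJ, Ioo_mem_nhdsGT (zero_lt_one' ℝ),
      eventually_nhdsWithin_of_eventually_nhds
        (hg.continuousAt.abs.eventually (lt_mem_nhds (half_lt_self (abs_pos.2 hg0))))]
      with y hy hy1 hy2
    have hpm := pow_pos hy1.1 m
    have hpJ := pow_pos hy1.1 J
    rw [hy, sub_zero, smul_eq_mul, abs_div, abs_of_pos hpm, abs_mul, abs_of_pos hpJ,
      lt_div_iff₀ hpm, pow_succ]
    have q1 := pow_le_one₀ hy1.1.le hy1.2.le (n := m)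
    have q2 : y * y ^ m ≤ 1 := mul_le_one₀ hy1.2.le hpm.le q1
    calc c * (y ^ J * y) * y ^ m = y ^ J * (c * (y * y ^ m)) := by ring
      _ ≤ y ^ J * (c * 1) := by gcongr
      _ < y ^ J * |g y| := by
          rw [mul_one]
          exact mul_lt_mul_of_pos_left hy2 hpJ
  obtain ⟨δ₁, hδ₁, H⟩ := mem_nhdsGT_iff_exists_Ioo_subset.1 h1
  set ε : ℝ := 1 / (2 * (J + 1)) with hε
  have hε0 : 0 < ε := by positivity
  have hε1 : ε < 1 := by
    rw [hε, div_lt_one (by positivity)]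
    have : (0 : ℝ) ≤ J := Nat.cast_nonneg J
    linarith
  obtain ⟨δ₂, hδ₂, hae, hint⟩ := exists_lintegral_pole_abs_sub_round_lt_top
    (k := fun y => σ * (k y).re) (analyticAt_const.mul hre) hσ0 hm
    (e := 1 - ε) ⟨by linarith, by linarith⟩
  set b : ℝ → ℝ := fun y => σ * (k y).re / y ^ m with hb
  have hsub₂ : Ioo 0 (min δ₁ δ₂) ⊆ Ioo 0 δ₂ := Ioo_subset_Ioo_right (min_le_right _ _)
  have hsub₁ : Ioo 0 (min δ₁ δ₂) ⊆ Ioo 0 δ₁ := Ioo_subset_Ioo_right (min_le_left _ _)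
  have hdist : ∀ y : ℝ, ∀ n : ℤ, |b y - round (b y)| ≤ |(k y / (y : ℂ) ^ m - n).re| := by
    intro y n
    rw [Complex.sub_re, re_div_ofReal_pow, Complex.intCast_re]
    rcases hσ with rfl | rfl
    · refine (round_le (b y) n).trans (le_of_eq ?_)
      simp only [hb, one_mul]
    · refine (round_le (b y) (-n)).trans (le_of_eq ?_)
      rw [← abs_neg]
      simp only [hb]
      congr 1
      push_cast
      ring
  refine ⟨min δ₁ δ₂, lt_min hδ₁ hδ₂,
    fun y => |(k y).im / y ^ m| ^ ε * |b y - round (b y)| ^ (1 - ε), ?_, ?_⟩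
  · filter_upwards [ae_restrict_of_ae_restrict_of_subset hsub₂ hae,
      ae_restrict_mem measurableSet_Ioo] with y hy hy'
    have hy0 : 0 < y := hy'.1
    have himpos : 0 < |(k y).im / y ^ m| := lt_trans (by positivity) (H (hsub₁ hy'))
    have hrepos : 0 < |b y - round (b y)| := abs_pos.2 (sub_ne_zero.2 (hy _))
    refine ⟨mul_pos (Real.rpow_pos_of_pos himpos _) (Real.rpow_pos_of_pos hrepos _), fun n => ?_⟩
    set N := ‖k y / (y : ℂ) ^ m - n‖ with hN
    have e1 : |(k y).im / y ^ m| ≤ N := by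
      refine le_trans (le_of_eq ?_) (Complex.abs_im_le_norm _)
      rw [Complex.sub_im, im_div_ofReal_pow, Complex.intCast_im, sub_zero]
    have e2 : |b y - round (b y)| ≤ N := (hdist y n).trans (Complex.abs_re_le_norm _)
    have hNpos : 0 < N := himpos.trans_le e1
    calc |(k y).im / y ^ m| ^ ε * |b y - round (b y)| ^ (1 - ε)
        ≤ N ^ ε * N ^ (1 - ε) := by
          refine mul_le_mul (Real.rpow_le_rpow himpos.le e1 hε0.le)
            (Real.rpow_le_rpow hrepos.le e2 (by linarith))
            (Real.rpow_nonneg hrepos.le _) (Real.rpow_nonneg hNpos.le _)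
      _ = N := by rw [← Real.rpow_add hNpos]; simp
  · calc ∫⁻ y in Ioo 0 (min δ₁ δ₂),
          ENNReal.ofReal (1 / (|(k y).im / y ^ m| ^ ε * |b y - round (b y)| ^ (1 - ε)))
        ≤ ∫⁻ y in Ioo 0 (min δ₁ δ₂), ENNReal.ofReal (c ^ (-ε)) *
            ENNReal.ofReal (|b y - round (b y)| ^ (-(1 - ε)) * y ^ (-(1 / 2) : ℝ)) := by
          refine setLIntegral_mono' measurableSet_Ioo fun y hy => ?_
          have hy0 : 0 < y := hy.1
          rw [← ENNReal.ofReal_mul (Real.rpow_nonneg hc0.le _)]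
          refine ENNReal.ofReal_le_ofReal ?_
          have himpos : 0 < |(k y).im / y ^ m| := lt_trans (by positivity) (H (hsub₁ hy))
          have e1 : |(k y).im / y ^ m| ^ (-ε) ≤ c ^ (-ε) * y ^ (-(1 / 2) : ℝ) := by
            have e2 : c ^ (-ε) * y ^ (-(1 / 2) : ℝ) = (c * y ^ (J + 1)) ^ (-ε) := by
              rw [Real.mul_rpow hc0.le (by positivity), ← Real.rpow_natCast,
                ← Real.rpow_mul hy0.le]
              congr 2
              rw [hε]
              push_cast
              field_simp
            rw [e2]
            exact Real.rpow_le_rpow_of_nonpos (by positivity) (H (hsub₁ hy)).le (by linarith)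
          rw [one_div, mul_inv, ← Real.rpow_neg (abs_nonneg _), ← Real.rpow_neg (abs_nonneg _)]
          calc |(k y).im / y ^ m| ^ (-ε) * |b y - round (b y)| ^ (-(1 - ε))
              ≤ c ^ (-ε) * y ^ (-(1 / 2) : ℝ) * |b y - round (b y)| ^ (-(1 - ε)) :=
                mul_le_mul_of_nonneg_right e1 (Real.rpow_nonneg (abs_nonneg _) _)
            _ = _ := by ring
      _ = ENNReal.ofReal (c ^ (-ε)) * ∫⁻ y in Ioo 0 (min δ₁ δ₂),
            ENNReal.ofReal (|b y - round (b y)| ^ (-(1 - ε)) * y ^ (-(1 / 2) : ℝ)) :=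
          lintegral_const_mul' _ _ ENNReal.ofReal_ne_top
      _ < ⊤ := ENNReal.mul_lt_top ENNReal.ofReal_lt_top
          ((lintegral_mono_set hsub₂).trans_lt hint)

theorem exists_lintegral_tsum_cotSummand_ray_lt_top {k : ℝ → ℂ} (hk : AnalyticAt ℝ k 0)
    (hk0 : k 0 ≠ 0) {m : ℕ} (hm : 0 < m)
    (hne : ∀ᶠ y : ℝ in 𝓝[>] 0, ∀ n : ℤ, k y / (y : ℂ) ^ m ≠ n) :
    ∃ δ > 0, ∫⁻ y in Ioo 0 δ, ∑' n, ‖cotSummand n (k y / (y : ℂ) ^ m)‖ₑ < ⊤ := by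
  obtain ⟨δ₁, hδ₁, d, hd, hdint⟩ := exists_lowerBound_dist_int_ray hk hk0 hm hne
  have hm' : (1 : ℝ) ≤ m := by exact_mod_cast hm
  set η : ℝ := 1 / (2 * m) with hη
  have hη0 : 0 < η := by positivity
  have hη1 : η < 1 := by
    rw [hη, div_lt_one (by positivity)]
    linarith
  obtain ⟨C, hC, hS⟩ := exists_tsum_enorm_cotSummand_le ⟨hη0, hη1⟩
  set K : ℝ := ‖k 0‖ + 1 with hK
  have h1 : ∀ᶠ y in 𝓝[>] (0 : ℝ), ‖k y‖ < K :=
    eventually_nhdsWithin_of_eventually_nhds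
      (hk.continuousAt.norm.eventually (gt_mem_nhds (lt_add_one _)))
  obtain ⟨δ₂, hδ₂, H⟩ := mem_nhdsGT_iff_exists_Ioo_subset.1 h1
  have hsub₂ : Ioo 0 (min δ₁ δ₂) ⊆ Ioo 0 δ₂ := Ioo_subset_Ioo_right (min_le_right _ _)
  have hsub₁ : Ioo 0 (min δ₁ δ₂) ⊆ Ioo 0 δ₁ := Ioo_subset_Ioo_right (min_le_left _ _)
  have hδ : 0 < min δ₁ δ₂ := lt_min hδ₁ hδ₂
  refine ⟨min δ₁ δ₂, hδ, ?_⟩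
  have hpow : ∀ y ∈ Ioo 0 (min δ₁ δ₂), ‖k y / (y : ℂ) ^ m‖ ^ η ≤ K ^ η * y ^ (-(1 / 2) : ℝ) := by
    intro y hy
    have hy0 : 0 < y := hy.1
    have e : y ^ (-(1 / 2) : ℝ) = ((y ^ m) ^ η)⁻¹ := by
      rw [← Real.rpow_natCast, ← Real.rpow_mul hy0.le, ← Real.rpow_neg hy0.le]
      congr 1
      rw [hη]
      field_simp
    rw [e, norm_div, norm_pow, Complex.norm_real, Real.norm_of_nonneg hy0.le,
      Real.div_rpow (norm_nonneg _) (by positivity), div_eq_mul_inv]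
    gcongr
    exact (H (hsub₂ hy)).le
  have hint : ∫⁻ y in Ioo 0 (min δ₁ δ₂), ENNReal.ofReal (y ^ (-(1 / 2) : ℝ)) < ⊤ :=
    ((intervalIntegral.integrableOn_Ioo_rpow_iff hδ).2 (by norm_num)).lintegral_lt_top
  have hmeas : AEMeasurable (fun y : ℝ => ENNReal.ofReal (K ^ η) *
      ENNReal.ofReal (y ^ (-(1 / 2) : ℝ))) (volume.restrict (Ioo 0 (min δ₁ δ₂))) := by
    fun_prop
  calc ∫⁻ y in Ioo 0 (min δ₁ δ₂), ∑' n, ‖cotSummand n (k y / (y : ℂ) ^ m)‖ₑ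
      ≤ ∫⁻ y in Ioo 0 (min δ₁ δ₂), ENNReal.ofReal C *
          (ENNReal.ofReal (K ^ η) * ENNReal.ofReal (y ^ (-(1 / 2) : ℝ)) +
            ENNReal.ofReal (1 / d y)) := by
        refine lintegral_mono_ae ?_
        filter_upwards [ae_restrict_of_ae_restrict_of_subset hsub₁ hd,
          ae_restrict_mem measurableSet_Ioo] with y hy hy'
        refine (hS _ _ hy.1 hy.2).trans ?_
        rw [← ENNReal.ofReal_mul (by positivity), ← ENNReal.ofReal_add
          (mul_nonneg (by positivity) (Real.rpow_nonneg hy'.1.le _)) (by have := hy.1; positivity),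
          ← ENNReal.ofReal_mul hC]
        refine ENNReal.ofReal_le_ofReal ?_
        gcongr
        exact hpow y hy'
    _ = ENNReal.ofReal C * (ENNReal.ofReal (K ^ η) *
          (∫⁻ y in Ioo 0 (min δ₁ δ₂), ENNReal.ofReal (y ^ (-(1 / 2) : ℝ))) +
            ∫⁻ y in Ioo 0 (min δ₁ δ₂), ENNReal.ofReal (1 / d y)) := by
        rw [lintegral_const_mul' _ _ ENNReal.ofReal_ne_top, lintegral_add_left' hmeas,
          lintegral_const_mul' _ _ ENNReal.ofReal_ne_top]
    _ < ⊤ := ENNReal.mul_lt_top ENNReal.ofReal_lt_top (ENNReal.add_lt_top.2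
        ⟨ENNReal.mul_lt_top ENNReal.ofReal_lt_top hint,
          (lintegral_mono_set hsub₁).trans_lt hdint⟩)

/-! ### Integrating the cotangent series along a segment -/

theorem IsCompact.finite_inter_of_eventually_notMem {T : Type*} [TopologicalSpace T] {K S : Set T}
    (hK : IsCompact K) (h : ∀ x ∈ K, ∀ᶠ y in 𝓝[≠] x, y ∉ S) : (K ∩ S).Finite := by
  have key : ∀ x ∈ K, ∃ t ∈ 𝓝[K] x, (t ∩ S).Finite := fun x hx => by
    have h1 := eventually_nhdsWithin_iff.1 (h x hx)
    refine ⟨_, mem_nhdsWithin_of_mem_nhds h1, (finite_singleton x).subset ?_⟩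
    rintro y ⟨hy, hyS⟩
    by_contra hne
    exact hy hne hyS
  refine hK.induction_on (p := fun s => (s ∩ S).Finite) (by simp)
    (fun s t hst ht => ht.subset (inter_subset_inter_left _ hst)) (fun s t hs ht => ?_) key
  rw [union_inter_distrib_right]
  exact hs.union ht

/-- `X` is meromorphic at `z` and has a pole there. -/
def HasPoleAt (X : ℂ → ℂ) (z : ℂ) : Prop :=
  MeromorphicAt X z ∧ Tendsto X (𝓝[≠] z) (Bornology.cobounded ℂ)

namespace HasPoleAt

variable {X : ℂ → ℂ} {z : ℂ}

theorem not_analyticAt (h : HasPoleAt X z) : ¬ AnalyticAt ℂ X z := fun ha =>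
  h.2.not_tendsto (Metric.disjoint_cobounded_nhds _)
    (ha.continuousAt.tendsto.mono_left nhdsWithin_le_nhds)

theorem exists_eq_div_pow (h : HasPoleAt X z) : ∃ (m : ℕ) (K : ℂ → ℂ), 0 < m ∧ AnalyticAt ℂ K z ∧
    K z ≠ 0 ∧ ∀ᶠ w in 𝓝[≠] z, X w = K w / (w - z) ^ m := by
  have h1 := (tendsto_cobounded_iff_meromorphicOrderAt_neg h.1).1 h.2
  obtain ⟨n, hn⟩ := WithTop.ne_top_iff_exists.1 h1.ne_top
  rw [← hn] at h1
  have hn0 : n < 0 := by exact_mod_cast h1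
  obtain ⟨K, hK, hK0, hKe⟩ := (meromorphicOrderAt_eq_int_iff h.1).1 hn.symm
  refine ⟨n.natAbs, K, by omega, hK, hK0, ?_⟩
  filter_upwards [hKe] with w hw
  rw [hw, smul_eq_mul, div_eq_mul_inv, mul_comm, ← zpow_natCast, ← zpow_neg]
  congr 2
  omega

end HasPoleAt

theorem tendsto_add_mul_nhdsNE (w₀ : ℂ) {v : ℂ} (hv : v ≠ 0) (x₀ : ℝ) :
    Tendsto (fun x : ℝ => w₀ + x * v) (𝓝[≠] x₀) (𝓝[≠] (w₀ + x₀ * v)) := by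
  refine tendsto_nhdsWithin_iff.2 ⟨?_, ?_⟩
  · have : ContinuousAt (fun x : ℝ => w₀ + x * v) x₀ := by fun_prop
    exact this.tendsto.mono_left nhdsWithin_le_nhds
  · filter_upwards [self_mem_nhdsWithin] with x hx h
    simp only [mem_singleton_iff, add_right_inj, mul_eq_mul_right_iff, Complex.ofReal_inj] at h
    exact h.elim hx hv

theorem HasPoleAt.exists_lintegral_halfLine_lt_top {X : ℂ → ℂ} {w₀ v : ℂ} (hv : v ≠ 0) {x₀ : ℝ}
    (hX : HasPoleAt X (w₀ + x₀ * v))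
    (hne : ∀ᶠ x : ℝ in 𝓝[≠] x₀, ∀ n : ℤ, X (w₀ + x * v) ≠ n) {σ : ℝ} (hσ : σ ≠ 0) :
    ∃ δ > 0, ∫⁻ x in (fun y => x₀ + σ * y) '' Ioo 0 δ,
      ∑' n, ‖cotSummand n (X (w₀ + x * v))‖ₑ < ⊤ := by
  obtain ⟨m, K, hm, hK, hK0, hKe⟩ := hX.exists_eq_div_pow
  have ht : Tendsto (fun y : ℝ => x₀ + σ * y) (𝓝[>] 0) (𝓝[≠] x₀) := by
    refine tendsto_nhdsWithin_iff.2 ⟨?_, ?_⟩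
    · have : ContinuousAt (fun y : ℝ => x₀ + σ * y) 0 := by fun_prop
      have h := this.tendsto.mono_left (nhdsWithin_le_nhds (s := Ioi 0))
      simpa using h
    · filter_upwards [self_mem_nhdsWithin] with y hy h
      have hy' : y ≠ 0 := (mem_Ioi.1 hy).ne'
      simp [hσ, hy'] at h
  set k : ℝ → ℂ := fun y => K (w₀ + x₀ * v + y * (σ * v)) / (σ * v) ^ m with hk
  have hσv : (σ * v : ℂ) ≠ 0 := mul_ne_zero (by exact_mod_cast hσ) hv
  have hkan : AnalyticAt ℝ k 0 := by
    have h1 : AnalyticAt ℝ (fun y : ℝ => w₀ + x₀ * v + y * (σ * v)) 0 :=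
      analyticAt_const.add ((Complex.ofRealCLM.analyticAt 0).mul analyticAt_const)
    have h2 : AnalyticAt ℝ K (w₀ + x₀ * v + (0 : ℝ) * (σ * v)) := by
      rw [Complex.ofReal_zero, zero_mul, add_zero]
      exact hK.restrictScalars
    have h3 : AnalyticAt ℝ (fun y : ℝ => K (w₀ + x₀ * v + y * (σ * v))) 0 := AnalyticAt.fun_comp h2 h1
    simp only [hk, div_eq_mul_inv]
    exact h3.mul analyticAt_const
  have hk0 : k 0 ≠ 0 := by
    simp only [hk, Complex.ofReal_zero, zero_mul, add_zero]
    exact div_ne_zero hK0 (pow_ne_zero m hσv)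
  have hXk : ∀ᶠ y : ℝ in 𝓝[>] 0, X (w₀ + (x₀ + σ * y : ℝ) * v) = k y / (y : ℂ) ^ m := by
    filter_upwards [((tendsto_add_mul_nhdsNE w₀ hv x₀).comp ht).eventually hKe,
      self_mem_nhdsWithin] with y hy hy0
    have hy0' : (y : ℂ) ≠ 0 := by exact_mod_cast (mem_Ioi.1 hy0).ne'
    simp only [Function.comp_apply] at hy
    rw [hy, hk]
    simp only
    rw [div_div, ← mul_pow]
    congr 2
    · push_cast; ring
    · push_cast; ring
  obtain ⟨δ₁, hδ₁, h1⟩ := exists_lintegral_tsum_cotSummand_ray_lt_top hkan hk0 hm (by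
    filter_upwards [hXk, ht.eventually hne] with y hy hy' n
    rw [← hy]
    exact hy' n)
  obtain ⟨δ₂, hδ₂, H⟩ := mem_nhdsGT_iff_exists_Ioo_subset.1 hXk
  have hsub₂ : Ioo 0 (min δ₁ δ₂) ⊆ Ioo 0 δ₂ := Ioo_subset_Ioo_right (min_le_right _ _)
  have hsub₁ : Ioo 0 (min δ₁ δ₂) ⊆ Ioo 0 δ₁ := Ioo_subset_Ioo_right (min_le_left _ _)
  refine ⟨min δ₁ δ₂, lt_min hδ₁ hδ₂, ?_⟩
  rw [lintegral_image_eq_lintegral_abs_deriv_mul (f' := fun _ => σ) measurableSet_Ioo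
    (fun y _ => by simpa using (((hasDerivAt_id' y).const_mul σ).const_add x₀).hasDerivWithinAt)
    (fun y _ z _ h => by simpa [hσ] using h)]
  calc ∫⁻ y in Ioo 0 (min δ₁ δ₂), ENNReal.ofReal |σ| *
        ∑' n, ‖cotSummand n (X (w₀ + (x₀ + σ * y : ℝ) * v))‖ₑ
      = ∫⁻ y in Ioo 0 (min δ₁ δ₂), ENNReal.ofReal |σ| *
        ∑' n, ‖cotSummand n (k y / (y : ℂ) ^ m)‖ₑ :=
        setLIntegral_congr_fun measurableSet_Ioo fun y hy => by
          rw [H (hsub₂ hy)]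
    _ ≤ ENNReal.ofReal |σ| * ∫⁻ y in Ioo 0 δ₁, ∑' n, ‖cotSummand n (k y / (y : ℂ) ^ m)‖ₑ := by
        rw [lintegral_const_mul' _ _ ENNReal.ofReal_ne_top]
        gcongr
    _ < ⊤ := ENNReal.mul_lt_top ENNReal.ofReal_lt_top h1

/-- Near a point that is not an integer the series is bounded. -/
theorem exists_eventually_tsum_enorm_cotSummand_le {x₀ : ℂ} (hx₀ : ∀ n : ℤ, x₀ ≠ n) :
    ∃ C : ENNReal, C < ⊤ ∧ ∀ᶠ x in 𝓝 x₀, ∑' n, ‖cotSummand n x‖ₑ ≤ C := by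
  have hmem : x₀ ∈ (range ((↑) : ℤ → ℂ))ᶜ := by
    rintro ⟨n, hn⟩
    exact hx₀ n hn.symm
  obtain ⟨r, hr, hball⟩ := Metric.isOpen_iff.1 Complex.isOpen_compl_range_intCast x₀ hmem
  obtain ⟨C, hC, hS⟩ := exists_tsum_enorm_cotSummand_le (η := 1 / 2) (by norm_num)
  refine ⟨ENNReal.ofReal (C * ((‖x₀‖ + r) ^ (1 / 2 : ℝ) + 1 / (r / 2))), ENNReal.ofReal_lt_top, ?_⟩
  filter_upwards [Metric.ball_mem_nhds x₀ (half_pos hr)] with x hx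
  rw [Metric.mem_ball, dist_eq_norm] at hx
  refine (hS x (r / 2) (half_pos hr) fun n => ?_).trans (ENNReal.ofReal_le_ofReal ?_)
  · by_contra! h
    refine hball (?_ : (n : ℂ) ∈ Metric.ball x₀ r) ⟨n, rfl⟩
    rw [Metric.mem_ball, dist_eq_norm]
    calc ‖(n : ℂ) - x₀‖ = ‖(x - x₀) - (x - n)‖ := by congr 1; ring
      _ ≤ ‖x - x₀‖ + ‖x - n‖ := norm_sub_le _ _
      _ < r := by linarith
  · have : ‖x‖ ≤ ‖x₀‖ + r := by
      have := norm_le_norm_add_norm_sub' x x₀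
      linarith
    gcongr

/-- A segment whose points are either poles of `X` or points where `X` is analytic and not an
integer; the end points are not poles. -/
structure IsAdmissibleSegment (X : ℂ → ℂ) (w₀ v : ℂ) (a b : ℝ) : Prop where
  ne_zero : v ≠ 0
  le : a ≤ b
  cases : ∀ x ∈ Icc a b, (AnalyticAt ℂ X (w₀ + x * v) ∧ ∀ n : ℤ, X (w₀ + x * v) ≠ n) ∨
    (x ∈ Ioo a b ∧ HasPoleAt X (w₀ + x * v))

/-- The summand of index `n` of the partial fraction series of `E · π cot (π X)`, with the value
`0` at the poles of `X`, where it is analytic. -/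
noncomputable def cotSummandComp (X E : ℂ → ℂ) (n : ℕ) (z : ℂ) : ℂ :=
  open Classical in if AnalyticAt ℂ X z then E z * cotSummand n (X z) else 0

namespace IsAdmissibleSegment

variable {X E : ℂ → ℂ} {w₀ v : ℂ} {a b : ℝ}

/-- The cotangent series is absolutely integrable along an admissible segment; being a statement
about a compact interval, this is checked locally. -/
theorem lintegral_lt_top (h : IsAdmissibleSegment X w₀ v a b) :
    ∫⁻ x in Icc a b, ∑' n, ‖cotSummand n (X (w₀ + x * v))‖ₑ < ⊤ := by
  refine (isCompact_Icc (a := a) (b := b)).induction_on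
    (p := fun s => ∫⁻ x in s, ∑' n, ‖cotSummand n (X (w₀ + x * v))‖ₑ < ⊤) (by simp)
    (fun s t hst ht => (lintegral_mono_set hst).trans_lt ht)
    (fun s t hs ht => (lintegral_union_le _ s t).trans_lt (ENNReal.add_lt_top.2 ⟨hs, ht⟩))
    fun x₀ hx₀ => ?_
  rcases h.cases x₀ hx₀ with ⟨h1, h2⟩ | ⟨hx₀', hp⟩
  · obtain ⟨C, hC, hS⟩ := exists_eventually_tsum_enorm_cotSummand_le h2
    have hcont : ContinuousAt (fun x : ℝ => X (w₀ + x * v)) x₀ :=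
      ContinuousAt.comp (g := X) (f := fun x : ℝ => w₀ + x * v) h1.continuousAt (by fun_prop)
    obtain ⟨r, hr, hball⟩ := Metric.mem_nhds_iff.1 (hcont.eventually hS)
    refine ⟨Metric.ball x₀ r, mem_nhdsWithin_of_mem_nhds (Metric.ball_mem_nhds x₀ hr), ?_⟩
    calc ∫⁻ x in Metric.ball x₀ r, ∑' n, ‖cotSummand n (X (w₀ + x * v))‖ₑ
        ≤ ∫⁻ x in Metric.ball x₀ r, C := setLIntegral_mono' measurableSet_ball fun x hx => hball hx
      _ < ⊤ := by
          rw [setLIntegral_const]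
          exact ENNReal.mul_lt_top hC measure_ball_lt_top
  · have hne : ∀ᶠ x : ℝ in 𝓝[≠] x₀, ∀ n : ℤ, X (w₀ + x * v) ≠ n := by
      filter_upwards [(tendsto_add_mul_nhdsNE w₀ h.ne_zero x₀).eventually
        hp.1.eventually_analyticAt, mem_nhdsWithin_of_mem_nhds (Icc_mem_nhds hx₀'.1 hx₀'.2)]
        with x hx hx'
      rcases h.cases x hx' with h3 | h3
      · exact h3.2
      · exact absurd hx h3.2.not_analyticAt
    obtain ⟨δ₁, hδ₁, h1⟩ := hp.exists_lintegral_halfLine_lt_top h.ne_zero hne one_ne_zero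
    obtain ⟨δ₂, hδ₂, h2⟩ := hp.exists_lintegral_halfLine_lt_top h.ne_zero hne
      (neg_ne_zero.2 one_ne_zero)
    refine ⟨((fun y => x₀ + 1 * y) '' Ioo 0 δ₁ ∪ (fun y => x₀ + -1 * y) '' Ioo 0 δ₂) ∪ {x₀}, ?_, ?_⟩
    · refine mem_nhdsWithin_of_mem_nhds ?_
      filter_upwards [Ioo_mem_nhds (show x₀ - δ₂ < x₀ by linarith) (show x₀ < x₀ + δ₁ by linarith)]
        with x hx
      rcases lt_trichotomy x x₀ with hlt | heq | hgt
      · exact Or.inl (Or.inr ⟨x₀ - x, ⟨by linarith, by linarith [hx.1]⟩, by ring⟩)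
      · exact Or.inr heq
      · exact Or.inl (Or.inl ⟨x - x₀, ⟨by linarith, by linarith [hx.2]⟩, by ring⟩)
    · refine (lintegral_union_le _ _ _).trans_lt (ENNReal.add_lt_top.2
        ⟨(lintegral_union_le _ _ _).trans_lt (ENNReal.add_lt_top.2 ⟨h1, h2⟩), ?_⟩)
      rw [Measure.restrict_singleton]
      simp

theorem ae_analyticAt (h : IsAdmissibleSegment X w₀ v a b) :
    ∀ᵐ x : ℝ ∂(volume.restrict (Icc a b)),
      AnalyticAt ℂ X (w₀ + x * v) ∧ ∀ n : ℤ, X (w₀ + x * v) ≠ n := by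
  have hfin : (Icc a b ∩ {x : ℝ | HasPoleAt X (w₀ + x * v)}).Finite := by
    refine isCompact_Icc.finite_inter_of_eventually_notMem fun x₀ hx₀ => ?_
    have h1 : ∀ᶠ z in 𝓝[≠] (w₀ + x₀ * v), AnalyticAt ℂ X z := by
      rcases h.cases x₀ hx₀ with h1 | h1
      · exact eventually_nhdsWithin_of_eventually_nhds h1.1.eventually_analyticAt
      · exact h1.2.1.eventually_analyticAt
    filter_upwards [(tendsto_add_mul_nhdsNE w₀ h.ne_zero x₀).eventually h1] with x hx hx'
    exact HasPoleAt.not_analyticAt hx' hx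
  filter_upwards [ae_restrict_of_ae (hfin.countable.ae_notMem volume),
    ae_restrict_mem measurableSet_Icc] with x hx hx'
  rcases h.cases x hx' with h1 | h1
  · exact h1
  · exact absurd ⟨hx', h1.2⟩ hx

theorem aestronglyMeasurable (h : IsAdmissibleSegment X w₀ v a b) {G : ℂ → ℂ}
    (hG : ∀ z, AnalyticAt ℂ X z → (∀ n : ℤ, X z ≠ n) → ContinuousAt G z) :
    AEStronglyMeasurable (fun x : ℝ => G (w₀ + x * v)) (volume.restrict (Icc a b)) := by
  set U : Set ℝ := {x | AnalyticAt ℂ X (w₀ + x * v) ∧ ∀ n : ℤ, X (w₀ + x * v) ≠ n} with hU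
  have hUo : IsOpen U := by
    rw [isOpen_iff_mem_nhds]
    rintro x ⟨hx, hx'⟩
    have hc : ContinuousAt (fun x : ℝ => w₀ + x * v) x := by fun_prop
    have h2 : ∀ᶠ z in 𝓝 (w₀ + x * v), X z ∈ (range ((↑) : ℤ → ℂ))ᶜ :=
      hx.continuousAt.eventually (Complex.isOpen_compl_range_intCast.mem_nhds (by
        rintro ⟨n, hn⟩
        exact hx' n hn.symm))
    filter_upwards [hc.eventually hx.eventually_analyticAt, hc.eventually h2] with y hy hy'
    exact ⟨hy, fun n hn => hy' ⟨n, hn.symm⟩⟩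
  have hcont : ContinuousOn (fun x : ℝ => G (w₀ + x * v)) U := fun x hx =>
    (ContinuousAt.comp (g := G) (f := fun x : ℝ => w₀ + x * v) (hG _ hx.1 hx.2)
      (by fun_prop)).continuousWithinAt
  have h1 := hcont.aestronglyMeasurable hUo.measurableSet (μ := volume)
  have h2 : volume.restrict (Icc a b) = (volume.restrict (Icc a b)).restrict U :=
    (Measure.restrict_eq_self_of_ae_mem h.ae_analyticAt).symm
  rw [h2, Measure.restrict_restrict hUo.measurableSet]
  exact h1.mono_measure (Measure.restrict_mono_set _ inter_subset_left)

/-- Summation and integration along the segment may be interchanged. -/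
theorem hasSum_integral (h : IsAdmissibleSegment X w₀ v a b) (hE : Continuous E) :
    IntervalIntegrable (fun x : ℝ => E (w₀ + x * v) * expRatio (X (w₀ + x * v))) volume a b ∧
    HasSum (fun n => ∫ x in a..b, cotSummandComp X E n (w₀ + x * v))
      (2 * Real.pi * Complex.I * (∫ x in a..b, E (w₀ + x * v) * expRatio (X (w₀ + x * v))) -
        Real.pi * Complex.I * ∫ x in a..b, E (w₀ + x * v)) := by
  set μ := volume.restrict (Icc a b) with hμ
  obtain ⟨B, hB⟩ : ∃ B : ℝ, ∀ x ∈ Icc a b, ‖E (w₀ + x * v)‖ ≤ B :=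
    isCompact_Icc.exists_bound_of_continuousOn (f := fun x : ℝ => E (w₀ + x * v))
      (by fun_prop)
  have hEint : Integrable (fun x : ℝ => E (w₀ + x * v)) μ :=
    (ContinuousOn.integrableOn_Icc (by fun_prop))
  have hsum_eq : ∀ x : ℝ, AnalyticAt ℂ X (w₀ + x * v) → (∀ n : ℤ, X (w₀ + x * v) ≠ n) →
      HasSum (fun n => cotSummandComp X E n (w₀ + x * v))
        (2 * Real.pi * Complex.I * (E (w₀ + x * v) * expRatio (X (w₀ + x * v))) -
          Real.pi * Complex.I * E (w₀ + x * v)) := by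
    intro x hx hx'
    have h1 := (hasSum_cotSummand hx').mul_left (E (w₀ + x * v))
    simp only [cotSummandComp, if_pos hx]
    refine Eq.subst (motive := HasSum _) ?_ h1
    ring
  -- the series of norms has a finite integral
  have hfin : ∫⁻ x, ∑' n, ‖cotSummandComp X E n (w₀ + x * v)‖ₑ ∂μ < ⊤ := by
    calc ∫⁻ x, ∑' n, ‖cotSummandComp X E n (w₀ + x * v)‖ₑ ∂μ
        ≤ ∫⁻ x, ENNReal.ofReal B * ∑' n, ‖cotSummand n (X (w₀ + x * v))‖ₑ ∂μ := by
          refine lintegral_mono_ae ?_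
          filter_upwards [h.ae_analyticAt, ae_restrict_mem measurableSet_Icc] with x hx hx'
          rw [← ENNReal.tsum_mul_left]
          refine ENNReal.tsum_le_tsum fun n => ?_
          rw [cotSummandComp, if_pos hx.1, enorm_mul]
          gcongr
          rw [← ofReal_norm]
          exact ENNReal.ofReal_le_ofReal (hB x hx')
      _ = ENNReal.ofReal B * ∫⁻ x in Icc a b, ∑' n, ‖cotSummand n (X (w₀ + x * v))‖ₑ :=
          lintegral_const_mul' _ _ ENNReal.ofReal_ne_top
      _ < ⊤ := ENNReal.mul_lt_top ENNReal.ofReal_lt_top h.lintegral_lt_top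
  have hmeas : ∀ n, AEStronglyMeasurable (fun x : ℝ => cotSummandComp X E n (w₀ + x * v)) μ :=
    fun n => h.aestronglyMeasurable fun z hz hz' => by
      have h1 : ContinuousAt (fun z => E z * cotSummand n (X z)) z :=
        hE.continuousAt.mul (ContinuousAt.comp (g := cotSummand n) (f := X)
          (analyticAt_cotSummand (by exact_mod_cast hz' n)
            (by exact_mod_cast hz' (-n))).continuousAt hz.continuousAt)
      refine h1.congr ?_
      filter_upwards [hz.eventually_analyticAt] with w hw
      rw [cotSummandComp, if_pos hw]
  have hswap : ∑' n, ∫⁻ x, ‖cotSummandComp X E n (w₀ + x * v)‖ₑ ∂μ < ⊤ := by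
    rwa [← lintegral_tsum fun n => (hmeas n).enorm]
  have hint : ∀ n, Integrable (fun x : ℝ => cotSummandComp X E n (w₀ + x * v)) μ := fun n =>
    ⟨hmeas n, (ENNReal.le_tsum n).trans_lt hswap⟩
  have hsumm : Summable fun n => ∫ x, ‖cotSummandComp X E n (w₀ + x * v)‖ ∂μ := by
    have h1 := ENNReal.summable_toReal hswap.ne
    refine h1.congr fun n => ?_
    rw [integral_norm_eq_lintegral_enorm (hmeas n)]
  have hS := hasSum_integral_of_summable_integral_norm hint hsumm
  have hqmeas : AEStronglyMeasurable
      (fun x : ℝ => E (w₀ + x * v) * expRatio (X (w₀ + x * v))) μ :=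
    h.aestronglyMeasurable (G := fun z => E z * expRatio (X z)) fun z hz hz' => by
      refine hE.continuousAt.mul (ContinuousAt.comp (g := expRatio) (f := X) ?_ hz.continuousAt)
      exact ContinuousAt.div (by fun_prop) (by fun_prop) (exp_two_pi_I_mul_sub_one_ne_zero hz')
  have hGint : Integrable (fun x : ℝ =>
      2 * Real.pi * Complex.I * (E (w₀ + x * v) * expRatio (X (w₀ + x * v))) -
          Real.pi * Complex.I * E (w₀ + x * v)) μ := by
    refine ⟨(hqmeas.const_mul _).sub (hEint.1.const_mul _), lt_of_le_of_lt ?_ hfin⟩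
    refine lintegral_mono_ae ?_
    filter_upwards [h.ae_analyticAt] with x hx
    rw [← (hsum_eq x hx.1 hx.2).tsum_eq]
    exact enorm_tsum_le_tsum_enorm
  have hqint : Integrable (fun x : ℝ => E (w₀ + x * v) * expRatio (X (w₀ + x * v))) μ := by
    have h1 := (hGint.add (hEint.const_mul (Real.pi * Complex.I))).const_mul
      (2 * Real.pi * Complex.I)⁻¹
    refine h1.congr (Eventually.of_forall fun x => ?_)
    simp only [Pi.add_apply, sub_add_cancel]
    exact inv_mul_cancel_left₀ Complex.two_pi_I_ne_zero _
  have hIcc : ∀ G : ℝ → ℂ, ∫ x in a..b, G x = ∫ x, G x ∂μ := fun G => by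
    rw [intervalIntegral.integral_of_le h.le, hμ, integral_Icc_eq_integral_Ioc]
  refine ⟨(intervalIntegrable_iff_integrableOn_Icc_of_le h.le).2 hqint, ?_⟩
  simp only [hIcc]
  rw [← integral_const_mul, ← integral_const_mul, ← integral_sub (hqint.const_mul _)
    (hEint.const_mul _)]
  refine Eq.subst (motive := HasSum _) ?_ hS
  refine integral_congr_ae ?_
  filter_upwards [h.ae_analyticAt] with x hx
  exact (hsum_eq x hx.1 hx.2).tsum_eq

end IsAdmissibleSegment

/-! ### The residues at the points where `X` is an integer -/

/-- The points where `X` is analytic and takes an integer value. -/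
def integerLocus (X : ℂ → ℂ) : Set ℂ := {z | AnalyticAt ℂ X z ∧ ∃ n : ℤ, X z = n}

theorem round_re_intCast (n : ℤ) : round (n : ℂ).re = n := by simp

theorem AnalyticAt.eventually_notMem_integerLocus {X : ℂ → ℂ} {z : ℂ} (hX : AnalyticAt ℂ X z)
    (hne : ∀ n : ℤ, ∀ᶠ w in 𝓝[≠] z, X w ≠ n) : ∀ᶠ w in 𝓝[≠] z, w ∉ integerLocus X := by
  have h1 : ∀ᶠ w in 𝓝[≠] z, ‖X w - X z‖ < 1 / 2 := by
    have := hX.continuousAt.eventually (Metric.ball_mem_nhds (X z) (one_half_pos (α := ℝ)))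
    filter_upwards [eventually_nhdsWithin_of_eventually_nhds this] with w hw
    rwa [← dist_eq_norm]
  filter_upwards [h1, hne (round (X z).re)] with w hw hw'
  rintro ⟨-, n, hn⟩
  refine hw' (hn.trans ?_)
  -- an integer within `1 / 2` of `X z` is the one nearest to `Re (X z)`
  have h2 := abs_sub_round (X z).re
  have h3 : |(n : ℝ) - (X z).re| < 1 / 2 := by
    refine lt_of_le_of_lt ?_ hw
    rw [hn]
    refine le_trans (le_of_eq ?_) (Complex.abs_re_le_norm _)
    simp
  have h4 : |((n - round (X z).re : ℤ) : ℝ)| < 1 := by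
    push_cast
    calc |(n : ℝ) - round (X z).re|
        ≤ |(n : ℝ) - (X z).re| + |(X z).re - round (X z).re| := by
          refine le_trans (le_of_eq ?_) (abs_add_le _ _)
          congr 1; ring
      _ < 1 := by linarith
  rw [← Int.cast_abs] at h4
  have h5 : |n - round (X z).re| < 1 := by exact_mod_cast h4
  have h6 : n = round (X z).re := by
    have := Int.abs_lt_one_iff.1 h5
    omega
  exact_mod_cast h6

section residues

variable {X E : ℂ → ℂ} {p : ℂ}

theorem meromorphicAt_mul_expRatio (hE : AnalyticAt ℂ E p) (hX : AnalyticAt ℂ X p) :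
    MeromorphicAt (fun z => E z * expRatio (X z)) p := by
  have h1 : AnalyticAt ℂ (fun z => Complex.exp (2 * Real.pi * Complex.I * X z)) p :=
    (analyticAt_const.mul hX).cexp
  exact hE.meromorphicAt.mul (h1.meromorphicAt.div (h1.sub analyticAt_const).meromorphicAt)

theorem hasResidue_residueAt (hE : AnalyticAt ℂ E p) (hX : AnalyticAt ℂ X p) :
    HasResidue (fun z => E z * expRatio (X z)) p
      (residueAt (fun z => E z * expRatio (X z)) p) := by
  obtain ⟨c, hc⟩ := (meromorphicAt_mul_expRatio hE hX).exists_hasResidue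
  rwa [hc.residueAt_eq]

theorem residueAt_mul_expRatio_of_deriv_ne_zero (hE : AnalyticAt ℂ E p) (hX : AnalyticAt ℂ X p)
    {n : ℤ} (hn : X p = n) (hd : deriv X p ≠ 0) :
    residueAt (fun z => E z * expRatio (X z)) p =
      E p / (2 * Real.pi * Complex.I * deriv X p) := by
  have hexp : Complex.exp (2 * Real.pi * Complex.I * X p) = 1 := by
    rw [hn, mul_comm]
    exact Complex.exp_int_mul_two_pi_mul_I n
  have hder : HasDerivAt (fun z => Complex.exp (2 * Real.pi * Complex.I * X z) - 1)
      (2 * Real.pi * Complex.I * deriv X p) p := by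
    have h1 := ((hX.differentiableAt.hasDerivAt.const_mul
      (2 * Real.pi * Complex.I : ℂ)).cexp).sub_const 1
    refine h1.congr_deriv ?_
    rw [hexp, one_mul]
  have h1 : AnalyticAt ℂ (fun z => Complex.exp (2 * Real.pi * Complex.I * X z)) p :=
    (analyticAt_const.mul hX).cexp
  have h2 := HasResidue.div_of_simple_zero
    (D := fun z => Complex.exp (2 * Real.pi * Complex.I * X z) - 1)
    (f := fun z => E z * Complex.exp (2 * Real.pi * Complex.I * X z))
    (hE.mul h1) (h1.sub analyticAt_const) (by rw [hexp, sub_self]) (by rw [hder.deriv]; exact mul_ne_zero Complex.two_pi_I_ne_zero hd)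
  rw [hder.deriv, hexp, mul_one] at h2
  rw [← h2.residueAt_eq]
  congr 1
  ext z
  rw [expRatio, mul_div_assoc]

theorem cotSummandComp_eventuallyEq (hX : AnalyticAt ℂ X p) (n : ℕ) :
    cotSummandComp X E n =ᶠ[𝓝 p] fun z => E z * cotSummand n (X z) := by
  filter_upwards [hX.eventually_analyticAt] with z hz
  rw [cotSummandComp, if_pos hz]

theorem hasResidue_cotSummandComp (hE : AnalyticAt ℂ E p) (hX : AnalyticAt ℂ X p) {n : ℤ}
    (hn : X p = n) (hne : ∀ᶠ w in 𝓝[≠] p, X w ≠ n) :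
    HasResidue (cotSummandComp X E n.natAbs) p
      (2 * Real.pi * Complex.I * residueAt (fun z => E z * expRatio (X z)) p) := by
  obtain ⟨k, hk, hkx⟩ := exists_analyticAt_expRatio_sub n
  rw [← hn] at hk
  have h1 : AnalyticAt ℂ (fun z => E z * k (X z)) p := hE.mul (AnalyticAt.fun_comp hk hX)
  have h2 := ((hasResidue_residueAt hE hX).add
    ((HasResidue.of_analyticAt h1).const_mul (-1))).const_mul (2 * Real.pi * Complex.I)
  rw [mul_zero, add_zero] at h2
  refine h2.congr ?_
  filter_upwards [hne, eventually_nhdsWithin_of_eventually_nhds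
    (cotSummandComp_eventuallyEq (E := E) hX n.natAbs)] with z hz hz'
  rw [hz', hkx _ hz]
  have := Complex.two_pi_I_ne_zero
  field_simp
  ring

theorem meromorphicAt_cotSummandComp (hE : AnalyticAt ℂ E p) (hX : AnalyticAt ℂ X p) (n : ℕ) :
    MeromorphicAt (cotSummandComp X E n) p := by
  have h1 : MeromorphicAt (fun z => cotSummand n (X z)) p := by
    unfold cotSummand
    split_ifs
    · exact (MeromorphicAt.const 1 p).div hX.meromorphicAt
    · exact ((MeromorphicAt.const 1 p).div (hX.sub analyticAt_const).meromorphicAt).add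
        ((MeromorphicAt.const 1 p).div (hX.add analyticAt_const).meromorphicAt)
  exact (hE.meromorphicAt.mul h1).congr
    ((cotSummandComp_eventuallyEq hX n).symm.filter_mono nhdsWithin_le_nhds)

theorem analyticAt_cotSummandComp (hE : AnalyticAt ℂ E p) (hX : AnalyticAt ℂ X p) {n : ℕ}
    (h1 : X p ≠ n) (h2 : X p ≠ -n) : AnalyticAt ℂ (cotSummandComp X E n) p :=
  (hE.mul (AnalyticAt.fun_comp (analyticAt_cotSummand h1 h2) hX)).congr
    (cotSummandComp_eventuallyEq hX n).symm

/-- Where `X` has a pole the summands have a removable singularity, as they vanish at infinity. -/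
theorem HasPoleAt.analyticAt_cotSummandComp (hE : ∀ z, AnalyticAt ℂ E z) (hX : HasPoleAt X p)
    (n : ℕ) : AnalyticAt ℂ (cotSummandComp X E n) p := by
  have hcob : ∀ c : ℂ, ∀ᶠ w in 𝓝[≠] p, X w ≠ c := fun c =>
    hX.2.eventually (Bornology.isBounded_def.1 (Bornology.isBounded_singleton (x := c)))
  have hev : ∀ᶠ w in 𝓝[≠] p, AnalyticAt ℂ X w ∧ X w ≠ n ∧ X w ≠ -n :=
    hX.1.eventually_analyticAt.and ((hcob n).and (hcob (-n)))
  refine Complex.analyticAt_of_differentiable_on_punctured_nhds_of_continuousAt ?_ ?_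
  · filter_upwards [hev] with w hw
    exact (_root_.analyticAt_cotSummandComp (hE w) hw.1 hw.2.1 hw.2.2).differentiableAt
  · rw [continuousAt_iff_punctured_nhds]
    have hp : cotSummandComp X E n p = 0 := by rw [cotSummandComp, if_neg hX.not_analyticAt]
    rw [hp]
    have hinv : ∀ c : ℂ, Tendsto (fun w => 1 / (X w + c)) (𝓝[≠] p) (𝓝 0) := fun c => by
      have h1 : Tendsto (fun w => X w + c) (𝓝[≠] p) (Bornology.cobounded ℂ) :=
        (tendsto_add_const_cobounded c).comp hX.2
      have h2 := Filter.tendsto_inv₀_cobounded.comp h1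
      simp only [one_div]
      exact h2
    have hcot : Tendsto (fun w => cotSummand n (X w)) (𝓝[≠] p) (𝓝 0) := by
      unfold cotSummand
      split_ifs
      · simpa using hinv 0
      · have := (hinv (-n)).add (hinv n)
        rw [add_zero] at this
        simpa only [sub_eq_add_neg] using this
    have hlim := ((hE p).continuousAt.tendsto.mono_left nhdsWithin_le_nhds).mul hcot
    rw [mul_zero] at hlim
    refine hlim.congr' ?_
    filter_upwards [hev] with w hw
    rw [cotSummandComp, if_pos hw.1]

end residues

/-- Near a pole of `X` the residues at the points with an integer value of `X` are absolutely
summable: if the pole has order `m` and the value is `n`, the residue is of size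
`|n| ^ (-1 - 1 / m)`, and each value is taken at most `m` times since `X` is the `m`-th power of an
injective function. -/
theorem HasPoleAt.exists_summable_residueAt {X E : ℂ → ℂ} (hE : ∀ z, AnalyticAt ℂ E z) {z₀ : ℂ}
    (hX : HasPoleAt X z₀) : ∃ U ∈ 𝓝 z₀, Summable ((U ∩ integerLocus X).indicator
      (residueAt fun z => E z * expRatio (X z))) := by
  obtain ⟨m, K, hm, hK, hK0, hKe⟩ := hX.exists_eq_div_pow
  have hm0 : (m : ℂ) ≠ 0 := by exact_mod_cast hm.ne'
  have hmr : (0 : ℝ) < m := by exact_mod_cast hm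
  have hKn : 0 < ‖K z₀‖ := norm_pos_iff.2 hK0
  -- an `m`-th root of `1 / X`, up to a constant factor
  set h : ℂ → ℂ := fun w => (w - z₀) * Complex.exp (-(Complex.log (K w / K z₀) / m)) with hh
  have hlogan : AnalyticAt ℂ (fun w => Complex.log (K w / K z₀)) z₀ :=
    (hK.div analyticAt_const hK0).clog (by
      simp only [Pi.div_apply, div_self hK0]
      exact Complex.one_mem_slitPlane)
  have hhan : AnalyticAt ℂ h z₀ :=
    (analyticAt_id.sub analyticAt_const).mul ((hlogan.div analyticAt_const hm0).neg.cexp)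
  have hhd : HasStrictDerivAt h 1 z₀ := by
    have h1 := hhan.hasStrictDerivAt
    have h2 : HasDerivAt h 1 z₀ := by
      have e1 : AnalyticAt ℂ (fun w => Complex.exp (-(Complex.log (K w / K z₀) / m))) z₀ :=
        (hlogan.div analyticAt_const hm0).neg.cexp
      have e2 := ((hasDerivAt_id' z₀).sub_const z₀).fun_mul e1.differentiableAt.hasDerivAt
      refine e2.congr_deriv ?_
      rw [div_self hK0]
      simp
    rwa [h2.deriv] at h1
  have hinj := hhd.eventually_left_inverse one_ne_zero
  have hKan : ∀ᶠ w in 𝓝 z₀, AnalyticAt ℂ K w := hK.eventually_analyticAt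
  have hK1 : ∀ᶠ w in 𝓝 z₀, ‖K w‖ < 2 * ‖K z₀‖ :=
    hK.continuousAt.norm.eventually (gt_mem_nhds (by linarith))
  have hK2 : ∀ᶠ w in 𝓝 z₀, K w ≠ 0 := hK.continuousAt.eventually_ne hK0
  set c : ℝ := m * ‖K z₀‖ / 2 with hc
  have hc0 : 0 < c := by positivity
  have hK3 : ∀ᶠ w in 𝓝 z₀, c < ‖deriv K w * (w - z₀) - m * K w‖ := by
    have h1 : ContinuousAt (fun w => deriv K w * (w - z₀) - m * K w) z₀ :=
      (hK.deriv.continuousAt.mul (by fun_prop)).sub (continuousAt_const.mul hK.continuousAt)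
    refine h1.norm.eventually (lt_mem_nhds ?_)
    simp only [sub_self, mul_zero, zero_sub, norm_neg, norm_mul, Complex.norm_natCast]
    rw [hc]
    exact half_lt_self (by positivity)
  have hE1 : ∀ᶠ w in 𝓝 z₀, ‖E w‖ < ‖E z₀‖ + 1 :=
    (hE z₀).continuousAt.norm.eventually (gt_mem_nhds (lt_add_one _))
  obtain ⟨r, hr, H⟩ := Metric.eventually_nhds_iff_ball.1 (hinj.and (hKan.and (hK1.and (hK2.and
    (hK3.and (hE1.and (eventually_nhdsWithin_iff.1 hKe)))))))
  refine ⟨Metric.ball z₀ r, Metric.ball_mem_nhds z₀ hr, ?_⟩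
  set V : Set ℂ := Metric.ball z₀ r ∩ integerLocus X with hV
  set res : ℂ → ℂ := residueAt fun z => E z * expRatio (X z) with hres
  set N : ℂ → ℤ := fun z => round (X z).re with hN
  set β : ℝ := 1 + 1 / m with hβ
  set C : ℝ := (‖E z₀‖ + 1) * (2 * ‖K z₀‖) ^ β / (2 * Real.pi * c) with hC
  have hC0 : 0 ≤ C := by positivity
  have hVne : ∀ p ∈ V, p ≠ z₀ := by
    rintro p hp rfl
    exact hX.not_analyticAt hp.2.1
  have hVX : ∀ p ∈ V, X p = N p := by
    rintro p ⟨-, -, n, hn⟩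
    simp only [hN, hn, Complex.intCast_re, round_intCast]
  have hVK : ∀ p ∈ V, X p = K p / (p - z₀) ^ m := fun p hp =>
    (H p hp.1).2.2.2.2.2.2 (hVne p hp)
  have hroot : ∀ p ∈ V, h p ^ m = K z₀ / N p := by
    intro p hp
    obtain ⟨-, -, -, q2, -⟩ := H p hp.1
    have hsub : p - z₀ ≠ 0 := sub_ne_zero.2 (hVne p hp)
    rw [← hVX p hp, hVK p hp, hh]
    simp only
    rw [mul_pow, ← Complex.exp_nat_mul, mul_neg, mul_div_cancel₀ _ hm0, Complex.exp_neg,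
      Complex.exp_log (div_ne_zero q2 hK0)]
    field_simp
  have hbound : ∀ p ∈ V, ‖res p‖ ≤ C * |(N p : ℝ)| ^ (-β) := by
    intro p hp
    obtain ⟨-, q0, q1, q2, q3, q4, -⟩ := H p hp.1
    have hsub : p - z₀ ≠ 0 := sub_ne_zero.2 (hVne p hp)
    have hsubn : 0 < ‖p - z₀‖ := norm_pos_iff.2 hsub
    have hder : deriv X p = (deriv K p * (p - z₀) - m * K p) / (p - z₀) ^ (m + 1) := by
      have e1 : X =ᶠ[𝓝 p] fun w => K w / (w - z₀) ^ m := by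
        filter_upwards [Metric.isOpen_ball.mem_nhds hp.1, isOpen_ne.mem_nhds (hVne p hp)]
          with w hw hw' using (H w hw).2.2.2.2.2.2 hw'
      have e2 := q0.differentiableAt.hasDerivAt.fun_div
        (((hasDerivAt_id' p).sub_const z₀).fun_pow m) (pow_ne_zero m hsub)
      rw [e1.deriv_eq, e2.deriv]
      obtain ⟨j, rfl⟩ : ∃ j, m = j + 1 := ⟨m - 1, by omega⟩
      rw [Nat.add_sub_cancel]
      field_simp
      ring
    have hdn : c / ‖p - z₀‖ ^ (m + 1) ≤ ‖deriv X p‖ := by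
      rw [hder, norm_div, norm_pow]
      gcongr
    have hd0 : deriv X p ≠ 0 := norm_pos_iff.1 (lt_of_lt_of_le (by positivity) hdn)
    have hNabs : |(N p : ℝ)| = ‖K p‖ / ‖p - z₀‖ ^ m := by
      rw [← Complex.norm_intCast, ← hVX p hp, hVK p hp, norm_div, norm_pow]
    have hNpos : 0 < |(N p : ℝ)| := by
      rw [hNabs]
      have := norm_pos_iff.2 q2
      positivity
    have hpow : ‖p - z₀‖ ^ (m + 1) ≤ (2 * ‖K z₀‖) ^ β * |(N p : ℝ)| ^ (-β) := by
      have e1 : ‖p - z₀‖ ^ m ≤ 2 * ‖K z₀‖ / |(N p : ℝ)| := by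
        rw [le_div_iff₀ hNpos, hNabs, mul_div_cancel₀ _ (by positivity)]
        exact q1.le
      have e2 : ‖p - z₀‖ ^ (m + 1) = (‖p - z₀‖ ^ m) ^ β := by
        rw [← Real.rpow_natCast, ← Real.rpow_natCast, ← Real.rpow_mul hsubn.le]
        congr 1
        rw [hβ]
        push_cast
        field_simp
      rw [e2, Real.rpow_neg hNpos.le, ← div_eq_mul_inv, ← Real.div_rpow (by positivity) hNpos.le]
      exact Real.rpow_le_rpow (by positivity) e1 (by positivity)
    rw [hres, residueAt_mul_expRatio_of_deriv_ne_zero (hE p) hp.2.1 (hVX p hp) hd0, norm_div, norm_mul]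
    have hpi : ‖(2 * Real.pi * Complex.I : ℂ)‖ = 2 * Real.pi := by
      simp [abs_of_pos Real.pi_pos]
    rw [hpi]
    calc ‖E p‖ / (2 * Real.pi * ‖deriv X p‖)
        ≤ (‖E z₀‖ + 1) / (2 * Real.pi * (c / ‖p - z₀‖ ^ (m + 1))) := by gcongr
      _ = (‖E z₀‖ + 1) / (2 * Real.pi * c) * ‖p - z₀‖ ^ (m + 1) := by field_simp
      _ ≤ (‖E z₀‖ + 1) / (2 * Real.pi * c) * ((2 * ‖K z₀‖) ^ β * |(N p : ℝ)| ^ (-β)) := by gcongr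
      _ = C * |(N p : ℝ)| ^ (-β) := by rw [hC]; ring
  have hsumm : Summable fun n : ℤ => |(n : ℝ)| ^ (-β) :=
    Real.summable_abs_int_rpow (by rw [hβ]; linarith [one_div_pos.2 hmr])
  have hcard : ∀ (T : Finset ℂ), (∀ p ∈ T, p ∈ V) → ∀ n : ℤ, (T.filter fun p => N p = n).card ≤ m := by
    classical
    intro T hT n
    refine (Finset.card_le_card_of_injOn (t := (Polynomial.nthRoots m (K z₀ / n)).toFinset) h
      ?_ ?_).trans ((Multiset.toFinset_card_le _).trans (Polynomial.card_nthRoots _ _))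
    · intro p hp
      simp only [Finset.coe_filter, mem_ofPred_eq] at hp
      simp only [Finset.mem_coe, Multiset.mem_toFinset]
      rw [Polynomial.mem_nthRoots hm, hroot p (hT p hp.1), hp.2]
    · intro p hp q hq hpq
      simp only [Finset.coe_filter, mem_ofPred_eq] at hp hq
      rw [← (H p (hT p hp.1).1).1, ← (H q (hT q hq.1).1).1, hpq]
  refine Summable.of_norm ?_
  refine summable_of_sum_le (c := ∑' n : ℤ, m * (C * |(n : ℝ)| ^ (-β)))
    (fun p => norm_nonneg _) fun T => ?_
  classical
  set T' := T.filter fun p => p ∈ V with hT'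
  have hT'V : ∀ p ∈ T', p ∈ V := fun p hp => (Finset.mem_filter.1 hp).2
  calc ∑ p ∈ T, ‖V.indicator res p‖ = ∑ p ∈ T', ‖res p‖ := by
        rw [hT', Finset.sum_filter]
        refine Finset.sum_congr rfl fun p _ => ?_
        rw [indicator_apply]
        split_ifs <;> simp
    _ ≤ ∑ p ∈ T', C * |(N p : ℝ)| ^ (-β) := Finset.sum_le_sum fun p hp => hbound p (hT'V p hp)
    _ = ∑ n ∈ T'.image N, (T'.filter fun p => N p = n).card • (C * |(n : ℝ)| ^ (-β)) :=
        Finset.sum_comp (fun n : ℤ => C * |(n : ℝ)| ^ (-β)) N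
    _ ≤ ∑ n ∈ T'.image N, m * (C * |(n : ℝ)| ^ (-β)) := by
        refine Finset.sum_le_sum fun n _ => ?_
        rw [nsmul_eq_mul]
        refine mul_le_mul_of_nonneg_right ?_ (by positivity)
        exact_mod_cast hcard T' hT'V n
    _ ≤ ∑' n : ℤ, m * (C * |(n : ℝ)| ^ (-β)) :=
        ((hsumm.mul_left C).mul_left _).sum_le_tsum _ fun n _ => by positivity

/-! ### The residue theorem with infinitely many poles -/

/-- A rectangle on which `X` is analytic except for poles, with no pole on the vertical sides and no
integer value on the boundary. -/
structure IsAdmissibleRect (X : ℂ → ℂ) (a b c d : ℝ) : Prop where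
  hab : a < b
  hcd : c < d
  cases : ∀ z ∈ Icc a b ×ℂ Icc c d, AnalyticAt ℂ X z ∨ HasPoleAt X z
  ne_int : ∀ z ∈ Icc a b ×ℂ Icc c d, ∀ n : ℤ, ∀ᶠ w in 𝓝[≠] z, X w ≠ n
  boundary : ∀ z ∈ rectBoundary a b c d, AnalyticAt ℂ X z → ∀ n : ℤ, X z ≠ n
  vertical : ∀ z ∈ rectBoundary a b c d, z.re = a ∨ z.re = b → AnalyticAt ℂ X z

namespace IsAdmissibleRect

variable {X E : ℂ → ℂ} {a b c d : ℝ}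

theorem horizontal (h : IsAdmissibleRect X a b c d) {y : ℝ} (hy : y = c ∨ y = d) :
    IsAdmissibleSegment X (y * Complex.I) 1 a b where
  ne_zero := one_ne_zero
  le := h.hab.le
  cases x hx := by
    have e : (y * Complex.I + x * 1 : ℂ) = x + y * Complex.I := by ring
    rw [e]
    have hb := mem_rectBoundary_iff_horizontal hx hy h.hcd.le
    rcases h.cases _ hb.1 with h1 | h1
    · exact Or.inl ⟨h1, h.boundary _ hb h1⟩
    · refine Or.inr ⟨⟨lt_of_le_of_ne hx.1 ?_, lt_of_le_of_ne hx.2 ?_⟩, h1⟩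
      · rintro rfl
        exact h1.not_analyticAt (h.vertical _ hb (Or.inl (by simp)))
      · rintro rfl
        exact h1.not_analyticAt (h.vertical _ hb (Or.inr (by simp)))

theorem vertical_segment (h : IsAdmissibleRect X a b c d) {x : ℝ} (hx : x = a ∨ x = b) :
    IsAdmissibleSegment X x Complex.I c d where
  ne_zero := Complex.I_ne_zero
  le := h.hcd.le
  cases y hy := by
    have hb := mem_rectBoundary_iff_vertical hy hx h.hab.le
    have h1 := h.vertical _ hb (by simpa using hx)
    exact Or.inl ⟨h1, h.boundary _ hb h1⟩

theorem intervalIntegrable_horizontal (h : IsAdmissibleRect X a b c d) (hE : Continuous E) {y : ℝ}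
    (hy : y = c ∨ y = d) : IntervalIntegrable
      (fun x : ℝ => E (x + y * Complex.I) * expRatio (X (x + y * Complex.I))) volume a b := by
  have := ((h.horizontal hy).hasSum_integral hE).1
  simpa only [mul_one, add_comm] using this

theorem rectIntegral_eq_zero (hab : a < b) (hcd : c < d) (hE : Differentiable ℂ E) :
    rectIntegral E a b c d = 0 := by
  have := rectIntegral_eq_sum_residues (f := E) hab hcd ∅ (by simp) (by simp)
    (fun z _ _ => hE.analyticAt z) (fun _ => 0) (by simp)
  simpa using this

/-- Term-by-term integration of the cotangent series around an admissible rectangle; the difference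
`1/2` between `expRatio` and the cotangent contributes nothing, by Cauchy's theorem. -/
theorem hasSum_rectIntegral (h : IsAdmissibleRect X a b c d) (hE : Differentiable ℂ E) :
    HasSum (fun n => rectIntegral (cotSummandComp X E n) a b c d)
      (2 * Real.pi * Complex.I * rectIntegral (fun z => E z * expRatio (X z)) a b c d) := by
  have h1 := ((h.horizontal (Or.inl rfl)).hasSum_integral hE.continuous).2
  have h2 := ((h.horizontal (Or.inr rfl)).hasSum_integral hE.continuous).2
  have h3 := ((h.vertical_segment (Or.inl rfl)).hasSum_integral hE.continuous).2
  have h4 := ((h.vertical_segment (Or.inr rfl)).hasSum_integral hE.continuous).2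
  have h0 := rectIntegral_eq_zero h.hab h.hcd hE
  have hsum := ((h1.sub h2).add (h4.mul_left Complex.I)).sub (h3.mul_left Complex.I)
  have e : ∀ x y : ℂ, x * Complex.I + y * 1 = y + x * Complex.I := fun x y => by ring
  simp only [e] at hsum
  unfold rectIntegral at h0 ⊢
  refine Eq.subst (motive := HasSum _) ?_ hsum
  linear_combination (-Real.pi * Complex.I) * h0

theorem finite_inter_integerLocus (h : IsAdmissibleRect X a b c d) (n : ℕ) :
    ((Icc a b ×ℂ Icc c d) ∩ {z | X z = n ∨ X z = -n}).Finite := by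
  refine (isCompact_Icc.reProdIm isCompact_Icc).finite_inter_of_eventually_notMem fun z hz => ?_
  filter_upwards [h.ne_int z hz n, h.ne_int z hz (-n)] with w hw hw'
  rintro (h1 | h1)
  · exact hw (by exact_mod_cast h1)
  · exact hw' (by push_cast; exact h1)

theorem rectIntegral_cotSummandComp (h : IsAdmissibleRect X a b c d) (hE : Differentiable ℂ E)
    (n : ℕ) (S : Finset ℂ)
    (hS : ∀ z, z ∈ S ↔ z ∈ (Icc a b ×ℂ Icc c d) ∩ integerLocus X ∧ (round (X z).re).natAbs = n) :
    rectIntegral (cotSummandComp X E n) a b c d = 2 * Real.pi * Complex.I *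
      (2 * Real.pi * Complex.I * ∑ p ∈ S, residueAt (fun z => E z * expRatio (X z)) p) := by
  have hint : ∀ z ∈ S, z ∈ Icc a b ×ℂ Icc c d ∧ AnalyticAt ℂ X z ∧
      ∃ k : ℤ, X z = k ∧ k.natAbs = n := by
    intro z hz
    obtain ⟨⟨h1, h2, k, hk⟩, h3⟩ := (hS z).1 hz
    refine ⟨h1, h2, k, hk, ?_⟩
    rwa [hk, round_re_intCast] at h3
  rw [Finset.mul_sum]
  refine rectIntegral_eq_sum_residues h.hab h.hcd S (fun p hp => ?_) (fun p hp => ?_)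
    (fun z hz hzS => ?_) _ fun p hp => ?_
  · obtain ⟨⟨h1, h2⟩, h3, k, hk, -⟩ := hint p hp
    have hnb : p ∉ rectBoundary a b c d := fun hb => h.boundary p hb h3 k hk
    have hnot : ¬ (p.re = a ∨ p.re = b ∨ p.im = c ∨ p.im = d) := fun hb => hnb ⟨⟨h1, h2⟩, hb⟩
    push Not at hnot
    exact ⟨⟨lt_of_le_of_ne h1.1 hnot.1.symm, lt_of_le_of_ne h1.2 hnot.2.1⟩,
      ⟨lt_of_le_of_ne h2.1 hnot.2.2.1.symm, lt_of_le_of_ne h2.2 hnot.2.2.2⟩⟩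
  · exact meromorphicAt_cotSummandComp (hE.analyticAt p) (hint p hp).2.1 n
  · rcases h.cases z hz with h1 | h1
    · refine analyticAt_cotSummandComp (hE.analyticAt z) h1 (fun h2 => hzS ?_) (fun h2 => hzS ?_)
      · refine (hS z).2 ⟨⟨hz, h1, n, by exact_mod_cast h2⟩, ?_⟩
        rw [h2]
        simp
      · refine (hS z).2 ⟨⟨hz, h1, -n, by push_cast; exact h2⟩, ?_⟩
        have e : X z = ((-n : ℤ) : ℂ) := by push_cast; exact h2
        rw [e, round_re_intCast]
        simp
    · exact h1.analyticAt_cotSummandComp hE.analyticAt n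
  · obtain ⟨h1, h2, k, hk, hkn⟩ := hint p hp
    rw [← hkn]
    exact hasResidue_cotSummandComp (hE.analyticAt p) h2 hk (h.ne_int p h1 k)

/-- The residues at the poles in the rectangle are absolutely summable. -/
theorem summable_residueAt (h : IsAdmissibleRect X a b c d) (hE : Differentiable ℂ E) :
    Summable (((Icc a b ×ℂ Icc c d) ∩ integerLocus X).indicator
      (residueAt fun z => E z * expRatio (X z))) := by
  set res := residueAt fun z => E z * expRatio (X z)
  refine (isCompact_Icc.reProdIm isCompact_Icc).induction_on
    (p := fun s => Summable ((s ∩ integerLocus X).indicator res)) ?_ (fun s t hst ht => ?_)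
    (fun s t hs ht => ?_) fun z hz => ?_
  · simp [summable_zero]
  · have h1 := ht.indicator (s ∩ integerLocus X)
    rwa [indicator_indicator, inter_eq_left.2 (inter_subset_inter_left _ hst)] at h1
  · have h1 := ht.indicator ((t ∩ integerLocus X) \ (s ∩ integerLocus X))
    rw [indicator_indicator, inter_eq_left.2 sdiff_subset] at h1
    have h2 := hs.add h1
    rw [union_inter_distrib_right, ← union_sdiff_self]
    convert h2 using 1
    ext w
    rw [indicator_union_of_disjoint disjoint_sdiff_right]
  · rcases h.cases z hz with h1 | h1
    · have h2 := h1.eventually_notMem_integerLocus (h.ne_int z hz)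
      refine ⟨_, mem_nhdsWithin_of_mem_nhds (eventually_nhdsWithin_iff.1 h2), ?_⟩
      refine summable_of_hasFiniteSupport ((finite_singleton z).subset ?_)
      intro w hw
      by_contra hne
      have h3 := mem_of_indicator_ne_zero hw
      exact h3.1 hne h3.2
    · obtain ⟨U, hU, hUs⟩ := h1.exists_summable_residueAt hE.analyticAt
      exact ⟨U, mem_nhdsWithin_of_mem_nhds hU, hUs⟩

/-- The residue theorem for `E e^{2πiX} / (e^{2πiX} - 1)`, whose poles may accumulate at the poles
of `X` in the rectangle and on its horizontal sides. -/
theorem rectIntegral_eq_tsum_residueAt (h : IsAdmissibleRect X a b c d)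
    (hE : Differentiable ℂ E) :
    rectIntegral (fun z => E z * expRatio (X z)) a b c d = 2 * Real.pi * Complex.I *
      ∑' p, ((Icc a b ×ℂ Icc c d) ∩ integerLocus X).indicator
        (residueAt fun z => E z * expRatio (X z)) p := by
  set res := residueAt fun z => E z * expRatio (X z) with hres
  set Q := (Icc a b ×ℂ Icc c d) ∩ integerLocus X with hQ
  set N : ℂ → ℕ := fun z => (round (X z).re).natAbs with hN
  have hfin : ∀ n, (Q ∩ N ⁻¹' {n}).Finite := fun n => by
    refine (h.finite_inter_integerLocus n).subset ?_
    rintro z ⟨⟨hz, -, k, hk⟩, hzN⟩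
    refine ⟨hz, ?_⟩
    simp only [hN, mem_preimage, hk, round_re_intCast, mem_singleton_iff] at hzN
    rcases Int.natAbs_eq k with h1 | h1
    · left
      rw [hk, h1, hzN]
      simp
    · right
      rw [hk, h1, hzN]
      simp
  have h1 := (h.summable_residueAt hE).hasSum.tsum_fiberwise N
  have h2 : ∀ n, ∑' p : ↥(N ⁻¹' {n}), Q.indicator res p = ∑ p ∈ (hfin n).toFinset, res p := by
    intro n
    rw [tsum_subtype (N ⁻¹' {n}) (Q.indicator res), indicator_indicator]
    rw [tsum_eq_sum (s := (hfin n).toFinset) (fun p hp => ?_)]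
    · refine Finset.sum_congr rfl fun p hp => ?_
      have := (hfin n).mem_toFinset.1 hp
      exact indicator_of_mem (show p ∈ N ⁻¹' {n} ∩ Q from ⟨this.2, this.1⟩) _
    · refine indicator_of_notMem (fun hp' => hp ?_) _
      exact (hfin n).mem_toFinset.2 ⟨hp'.2, hp'.1⟩
  have h1' : HasSum (fun n => ∑ p ∈ (hfin n).toFinset, res p) (∑' p, Q.indicator res p) := by
    rw [← funext h2]
    exact h1
  have h3 := h.hasSum_rectIntegral hE
  have h4 := (h1'.mul_left (2 * Real.pi * Complex.I : ℂ)).mul_left (2 * Real.pi * Complex.I : ℂ)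
  have h5 : (fun n => rectIntegral (cotSummandComp X E n) a b c d) = fun n =>
      2 * Real.pi * Complex.I * (2 * Real.pi * Complex.I * ∑ p ∈ (hfin n).toFinset, res p) := by
    ext n
    exact h.rectIntegral_cotSummandComp hE n _ fun z => (hfin n).mem_toFinset
  rw [h5] at h3
  exact mul_left_cancel₀ Complex.two_pi_I_ne_zero (h3.unique h4)

end IsAdmissibleRect

/-! ### The exponent of the relaxation equation -/

section phase

variable {α : ℝ → ℝ} {A : ℂ → ℂ} {lam : ℝ}

/-- The function `X` of `z = log s` with `e^{2πiX} = -s^{sA(s)} / λ`. -/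
noncomputable def relaxationPhase (A : ℂ → ℂ) (lam : ℝ) (z : ℂ) : ℂ :=
  (z * (Complex.exp z * A z) - Real.log lam - Real.pi * Complex.I) / (2 * Real.pi * Complex.I)

theorem exp_relaxationPhase (hlam : 0 < lam) (z : ℂ) :
    Complex.exp (2 * Real.pi * Complex.I * relaxationPhase A lam z) = -(scarpiPower A z / lam) := by
  have h1 : Complex.exp (Real.log lam) = lam := by
    rw [← Complex.ofReal_exp, Real.exp_log hlam]
  rw [relaxationPhase, mul_div_cancel₀ _ Complex.two_pi_I_ne_zero, Complex.exp_sub, Complex.exp_sub,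
    h1, Complex.exp_pi_mul_I, ← scarpiPower, div_neg, div_one]

theorem expRatio_relaxationPhase (hlam : 0 < lam) (z : ℂ) :
    expRatio (relaxationPhase A lam z) = scarpiPower A z / (scarpiPower A z + lam) := by
  have hl : (lam : ℂ) ≠ 0 := by exact_mod_cast hlam.ne'
  rw [expRatio, exp_relaxationPhase hlam,
    show -(scarpiPower A z / lam) - 1 = -((scarpiPower A z + lam) / lam) by field_simp; ring,
    neg_div_neg_eq, div_div_div_cancel_right₀ hl]

theorem exists_relaxationPhase_eq_int_iff (hlam : 0 < lam) {z : ℂ} :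
    (∃ n : ℤ, relaxationPhase A lam z = n) ↔ scarpiPower A z + lam = 0 := by
  have hl : (lam : ℂ) ≠ 0 := by exact_mod_cast hlam.ne'
  have h1 : (∃ n : ℤ, relaxationPhase A lam z = n) ↔
      Complex.exp (2 * Real.pi * Complex.I * relaxationPhase A lam z) = 1 := by
    rw [Complex.exp_eq_one_iff]
    refine exists_congr fun n => ?_
    rw [mul_comm (n : ℂ), mul_right_inj' Complex.two_pi_I_ne_zero]
  rw [h1, exp_relaxationPhase hlam, neg_eq_iff_eq_neg, div_eq_iff hl, neg_one_mul,
    eq_neg_iff_add_eq_zero]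

theorem AnalyticAt.relaxationPhase {z : ℂ} (h : AnalyticAt ℂ A z) (lam : ℝ) :
    AnalyticAt ℂ (relaxationPhase A lam) z := by
  have h1 : AnalyticAt ℂ (fun z => z * (Complex.exp z * A z)) z :=
    analyticAt_id.mul (analyticAt_cexp.mul h)
  exact ((h1.sub analyticAt_const).sub analyticAt_const).div analyticAt_const
    Complex.two_pi_I_ne_zero

theorem MeromorphicAt.relaxationPhase {z : ℂ} (h : MeromorphicAt A z) (lam : ℝ) :
    MeromorphicAt (relaxationPhase A lam) z := by
  have h1 : MeromorphicAt (fun z => z * (Complex.exp z * A z)) z :=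
    analyticAt_id.meromorphicAt.mul (analyticAt_cexp.meromorphicAt.mul h)
  exact ((h1.sub (MeromorphicAt.const _ z)).sub (MeromorphicAt.const _ z)).div
    (MeromorphicAt.const _ z)

theorem IsTransformOnCutPlane.analyticAt_zero (hα : IsTransitionFunction α)
    (hA : IsTransformOnCutPlane α A) : AnalyticAt ℂ A 0 := by
  have hint : IntegrableOn (fun t : ℝ => Real.exp (-(1 / 2) * t)) (Ioi 0) :=
    exp_neg_integrableOn_Ioi 0 (by norm_num)
  refine (hA.meromorphic (ofReal_mem_cutStrip 0)).analyticAt_of_bounded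
    (D := ∫ t in Ioi (0 : ℝ), Real.exp (-(1 / 2) * t)) ?_ |> fun h => by simpa using h
  have h1 : ∀ᶠ x : ℝ in 𝓝[≠] 0, 1 / 2 < Real.exp x :=
    (Real.continuous_exp.continuousAt.eventually
      (lt_mem_nhds (by rw [Real.exp_zero]; norm_num))).filter_mono nhdsWithin_le_nhds
  filter_upwards [h1] with x hx
  rw [Complex.ofReal_zero, zero_add, hA.eq_laplace x (by simpa using Real.pi_pos), laplaceTransform]
  refine norm_integral_le_of_norm_le hint ?_
  filter_upwards [ae_restrict_mem measurableSet_Ioi] with t ht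
  have ht' : (0 : ℝ) < t := ht
  rw [norm_mul, Complex.norm_exp, ← Complex.ofReal_exp, ← Complex.ofReal_mul,
    ← Complex.ofReal_neg, Complex.ofReal_re]
  calc Real.exp (-(Real.exp x * t)) * ‖(α t : ℂ)‖ ≤ Real.exp (-(1 / 2) * t) * 1 := by
        gcongr
        · nlinarith
        · exact hα.norm_le_one ht'.le
    _ = _ := mul_one _

theorem IsTransformOnCutPlane.hasPoleAt_relaxationPhase (hα : IsTransitionFunction α)
    (hA : IsTransformOnCutPlane α A) {z : ℂ} (hz : z ∈ cutStrip) (h : ¬ AnalyticAt ℂ A z)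
    (lam : ℝ) : HasPoleAt (relaxationPhase A lam) z := by
  have hnf := hA.meromorphic hz
  have hz0 : z ≠ 0 := by
    rintro rfl
    exact h (hA.analyticAt_zero hα)
  have hcob : Tendsto A (𝓝[≠] z) (Bornology.cobounded ℂ) :=
    tendsto_cobounded_of_meromorphicOrderAt_neg
      (not_le.1 fun h1 => h (hnf.meromorphicOrderAt_nonneg_iff_analyticAt.1 h1))
  refine ⟨hnf.meromorphicAt.relaxationPhase lam, ?_⟩
  set c : ℂ := (2 * Real.pi * Complex.I)⁻¹ with hc
  have hc0 : c ≠ 0 := inv_ne_zero Complex.two_pi_I_ne_zero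
  have h1 : Tendsto (fun w => ‖c * (w * Complex.exp w)‖ * ‖A w‖) (𝓝[≠] z) atTop := by
    have h2 : ContinuousAt (fun w : ℂ => ‖c * (w * Complex.exp w)‖) z := by fun_prop
    exact (h2.tendsto.mono_left nhdsWithin_le_nhds).pos_mul_atTop
      (norm_pos_iff.2 (mul_ne_zero hc0 (mul_ne_zero hz0 (Complex.exp_ne_zero z))))
      (tendsto_norm_atTop_iff_cobounded.2 hcob)
  have h2 : Tendsto (fun w => c * (w * Complex.exp w) * A w) (𝓝[≠] z) (Bornology.cobounded ℂ) := by
    rw [← tendsto_norm_atTop_iff_cobounded]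
    simpa only [norm_mul] using h1
  have h3 := (tendsto_add_const_cobounded
    (-(Real.log lam + Real.pi * Complex.I) * c)).comp h2
  refine h3.congr fun w => ?_
  rw [relaxationPhase, div_eq_mul_inv, ← hc]
  simp only [Function.comp_apply]
  ring

theorem IsTransformOnCutPlane.analyticAt_relaxationPhase_iff (hα : IsTransitionFunction α)
    (hA : IsTransformOnCutPlane α A) {z : ℂ} (hz : z ∈ cutStrip) (lam : ℝ) :
    AnalyticAt ℂ (relaxationPhase A lam) z ↔ AnalyticAt ℂ A z := by
  refine ⟨fun h => ?_, fun h => h.relaxationPhase lam⟩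
  by_contra h1
  exact (hA.hasPoleAt_relaxationPhase hα hz h1 lam).not_analyticAt h

theorem isPreconnected_cutStrip : IsPreconnected cutStrip := by
  have h : cutStrip = Complex.im ⁻¹' Icc (-Real.pi) Real.pi := by
    ext z
    simp [cutStrip, abs_le]
  rw [h]
  exact ((convex_Icc _ _).is_linear_preimage Complex.imLm.isLinear).isPreconnected

theorem scarpiPower_add_ne_zero_of_norm_le (hlam : 0 < lam) {z : ℂ}
    (h : ‖scarpiPower A z‖ ≤ lam / 2) : scarpiPower A z + lam ≠ 0 := by
  intro h0
  rw [eq_neg_of_add_eq_zero_left h0, norm_neg, Complex.norm_real,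
    Real.norm_of_nonneg hlam.le] at h
  linarith

theorem scarpiPower_add_ne_zero_of_le_norm (hlam : 0 < lam) {z : ℂ}
    (h : 2 * lam ≤ ‖scarpiPower A z‖) : scarpiPower A z + lam ≠ 0 := by
  intro h0
  rw [eq_neg_of_add_eq_zero_left h0, norm_neg, Complex.norm_real,
    Real.norm_of_nonneg hlam.le] at h
  linarith

/-- The phase is not an integer constant, since `s^{sA(s)}` is small near the origin. -/
theorem IsTransformOnCutPlane.eventually_relaxationPhase_ne (hA : IsTransformOnCutPlane α A)
    (hlam : 0 < lam) {z₁ : ℂ} (hz₁ : z₁ ∈ cutStrip) (hA₁ : AnalyticAt ℂ A z₁)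
    (h₁ : ‖scarpiPower A z₁‖ ≤ lam / 2) {z : ℂ} (hz : z ∈ cutStrip) (n : ℤ) :
    ∀ᶠ w in 𝓝[≠] z, relaxationPhase A lam w ≠ n := by
  have hmer : MeromorphicOn (fun w => relaxationPhase A lam w - n) cutStrip := fun w hw =>
    ((hA.meromorphic hw).meromorphicAt.relaxationPhase lam).sub (MeromorphicAt.const _ w)
  have hord₁ : meromorphicOrderAt (fun w => relaxationPhase A lam w - n) z₁ ≠ ⊤ := by
    intro h0
    have h2 := meromorphicOrderAt_eq_top_iff.1 h0
    have hc : ContinuousAt (fun w => relaxationPhase A lam w - n) z₁ :=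
      (hA₁.relaxationPhase lam).continuousAt.sub continuousAt_const
    have h3 : relaxationPhase A lam z₁ - n = 0 :=
      tendsto_nhds_unique (hc.tendsto.mono_left nhdsWithin_le_nhds)
        (tendsto_const_nhds.congr' (h2.mono fun w hw => hw.symm))
    exact scarpiPower_add_ne_zero_of_norm_le hlam h₁
      ((exists_relaxationPhase_eq_int_iff hlam).1 ⟨n, sub_eq_zero.1 h3⟩)
  have hord := hmer.meromorphicOrderAt_ne_top_of_isPreconnected isPreconnected_cutStrip hz₁ hz hord₁
  rcases (hmer z hz).eventually_eq_zero_or_eventually_ne_zero with h | h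
  · exact absurd (meromorphicOrderAt_eq_top_iff.2 h) hord
  · exact h.mono fun w hw => sub_ne_zero.1 hw

end phase

/-! ### The edges of the cut -/

section edge

variable {A : ℂ → ℂ} {lam θ : ℝ}

/-- The integrand of the inversion formula in the variable `z = log s`. -/
noncomputable def relaxationIntegrand (A : ℂ → ℂ) (lam t : ℝ) (z : ℂ) : ℂ :=
  Complex.exp (t * Complex.exp z) * (scarpiPower A z / (scarpiPower A z + lam))

theorem relaxationIntegrand_eq_symbol (t : ℝ) (z : ℂ) : relaxationIntegrand A lam t z =
    Complex.exp (t * Complex.exp z) * (Complex.exp z * relaxationSymbol A lam z) := by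
  rw [relaxationIntegrand, relaxationSymbol, ← mul_assoc (Complex.exp z), ← Complex.exp_add]
  simp

theorem edge_numerator_eq (hθ : θ = Real.pi ∨ θ = -Real.pi) (x : ℝ) :
    ((Real.exp x : ℝ) : ℂ) ^ (-(Real.exp x : ℝ) * A (x + θ * Complex.I)) *
      Complex.exp (-Complex.I * θ * ((Real.exp x : ℝ) * A (x + θ * Complex.I))) =
    scarpiPower A (x + θ * Complex.I) := by
  rw [scarpiPower, exp_edge hθ, Complex.cpow_def_of_ne_zero
    (by exact_mod_cast (Real.exp_pos x).ne'), ← Complex.ofReal_log (Real.exp_pos x).le,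
    Real.log_exp, ← Complex.exp_add]
  congr 1
  ring

theorem edgeDenominator_exp (hθ : θ = Real.pi ∨ θ = -Real.pi) (x : ℝ) :
    edgeDenominator A lam θ (Real.exp x) = scarpiPower A (x + θ * Complex.I) + lam := by
  rw [edgeDenominator, Real.log_exp, edge_numerator_eq hθ]

theorem exp_smul_edgeIntegrand_exp (hθ : θ = Real.pi ∨ θ = -Real.pi) (t x : ℝ) :
    Real.exp x • edgeIntegrand A lam θ t (Real.exp x) =
      -relaxationIntegrand A lam t (x + θ * Complex.I) := by
  have hx : ((Real.exp x : ℝ) : ℂ) ≠ 0 := by exact_mod_cast (Real.exp_pos x).ne'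
  have hI : Complex.exp (-Complex.I * θ) = -1 := by
    rcases hθ with rfl | rfl
    · rw [neg_mul, Complex.exp_neg, mul_comm, Complex.exp_pi_mul_I]
      norm_num
    · rw [Complex.ofReal_neg, neg_mul_neg, mul_comm, Complex.exp_pi_mul_I]
  rw [edgeIntegrand, edgeDenominator_exp hθ, Real.log_exp, relaxationIntegrand, exp_edge hθ,
    Complex.cpow_sub _ _ hx, Complex.cpow_one, mul_add, Complex.exp_add, mul_one, hI,
    ← edge_numerator_eq hθ, Complex.real_smul, mul_neg, mul_comm (t : ℂ)]
  field_simp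

theorem integrable_relaxationIntegrand_iff (hθ : θ = Real.pi ∨ θ = -Real.pi) (t : ℝ) :
    IntegrableOn (edgeIntegrand A lam θ t) (Ioi 0) ↔
      Integrable fun x : ℝ => relaxationIntegrand A lam t (x + θ * Complex.I) := by
  have h1 := integrableOn_image_iff_integrableOn_abs_deriv_smul (s := univ) MeasurableSet.univ
    (fun x _ => (Real.hasDerivAt_exp x).hasDerivWithinAt) Real.exp_injective.injOn
    (edgeIntegrand A lam θ t)
  rw [image_univ, Real.range_exp] at h1
  simp only [abs_of_pos (Real.exp_pos _), exp_smul_edgeIntegrand_exp hθ, integrableOn_univ] at h1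
  rw [h1]
  exact integrable_neg_iff

theorem integral_edgeIntegrand (hθ : θ = Real.pi ∨ θ = -Real.pi) (t : ℝ) :
    ∫ ρ in Ioi (0 : ℝ), edgeIntegrand A lam θ t ρ =
      -∫ x : ℝ, relaxationIntegrand A lam t (x + θ * Complex.I) := by
  have h1 := integral_image_eq_integral_abs_deriv_smul (s := univ) MeasurableSet.univ
    (fun x _ => (Real.hasDerivAt_exp x).hasDerivWithinAt) Real.exp_injective.injOn
    (edgeIntegrand A lam θ t)
  rw [image_univ, Real.range_exp] at h1
  simp only [abs_of_pos (Real.exp_pos _), exp_smul_edgeIntegrand_exp hθ, setIntegral_univ] at h1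
  rw [h1, integral_neg]

end edge

/-! ### The poles and the residues in the cut plane -/

section poles

variable {A : ℂ → ℂ} {lam : ℝ}

theorem exp_log_mul_scarpi {w : ℂ} (hw : w.im ∈ Ioo (-Real.pi) Real.pi) :
    Complex.exp w ^ (Complex.exp w * A (Complex.log (Complex.exp w))) = scarpiPower A w := by
  rw [Complex.cpow_def_of_ne_zero (Complex.exp_ne_zero w), Complex.log_exp hw.1 hw.2.le, scarpiPower]

theorem exp_mem_slitPlane {w : ℂ} (hw : w.im ∈ Ioo (-Real.pi) Real.pi) :
    Complex.exp w ∈ Complex.slitPlane := by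
  rw [Complex.mem_slitPlane_iff_arg]
  refine ⟨?_, Complex.exp_ne_zero w⟩
  have h1 := Complex.log_exp hw.1 hw.2.le
  have h2 : (Complex.exp w).arg = w.im := by rw [← Complex.log_im, h1]
  rw [h2]
  exact hw.2.ne

theorem exp_mem_relaxationPoles_iff {w : ℂ} (hw : w.im ∈ Ioo (-Real.pi) Real.pi) :
    Complex.exp w ∈ relaxationPoles A lam ↔ AnalyticAt ℂ A w ∧ scarpiPower A w + lam = 0 := by
  have h1 := Complex.log_exp hw.1 hw.2.le
  have h2 := exp_log_mul_scarpi (A := A) hw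
  constructor
  · rintro ⟨-, h3, h4⟩
    rw [h2] at h4
    rw [h1] at h3
    exact ⟨h3, h4⟩
  · rintro ⟨h3, h4⟩
    refine ⟨exp_mem_slitPlane hw, by rwa [h1], ?_⟩
    rw [h2, h4]

theorem log_im_mem_of_slitPlane {s : ℂ} (hs : s ∈ Complex.slitPlane) :
    (Complex.log s).im ∈ Ioo (-Real.pi) Real.pi := by
  rw [Complex.log_im]
  exact ⟨Complex.neg_pi_lt_arg s, lt_of_le_of_ne (Complex.arg_le_pi s)
    (Complex.mem_slitPlane_iff_arg.1 hs).1⟩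

theorem relaxationTransform_exp_mul {w : ℂ} (hw : w.im ∈ Ioo (-Real.pi) Real.pi) (t : ℝ) :
    relaxationTransform A lam (Complex.exp w) * Complex.exp (Complex.exp w * t) * Complex.exp w =
      relaxationIntegrand A lam t w := by
  rw [relaxationTransform, Complex.cpow_sub _ _ (Complex.exp_ne_zero w), Complex.cpow_one,
    exp_log_mul_scarpi hw, relaxationIntegrand, mul_comm (Complex.exp w) (t : ℂ)]
  have := Complex.exp_ne_zero w
  field_simp

theorem residueAt_relaxationTransform {w : ℂ} (hw : w.im ∈ Ioo (-Real.pi) Real.pi)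
    (hA : AnalyticAt ℂ A w) (t : ℝ) :
    residueAt (fun s => relaxationTransform A lam s * Complex.exp (s * t)) (Complex.exp w) =
      residueAt (relaxationIntegrand A lam t) w := by
  have hs := exp_mem_slitPlane hw
  have hlog : AnalyticAt ℂ Complex.log (Complex.exp w) := analyticAt_clog hs
  have hA' : AnalyticAt ℂ (fun s => A (Complex.log s)) (Complex.exp w) :=
    AnalyticAt.fun_comp (by rwa [Complex.log_exp hw.1 hw.2.le]) hlog
  have hpow : ∀ c : ℂ, AnalyticAt ℂ (fun s => s ^ (s * A (Complex.log s) - c)) (Complex.exp w) :=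
    fun c => analyticAt_id.cpow ((analyticAt_id.mul hA').sub analyticAt_const) hs
  have hden : AnalyticAt ℂ (fun s => s ^ (s * A (Complex.log s)) + (lam : ℂ)) (Complex.exp w) :=
    (analyticAt_id.cpow (analyticAt_id.mul hA') hs).add analyticAt_const
  have hexp : AnalyticAt ℂ (fun s : ℂ => Complex.exp (s * t)) (Complex.exp w) := by fun_prop
  have hmer : MeromorphicAt (fun s => relaxationTransform A lam s * Complex.exp (s * t))
      (Complex.exp w) :=
    ((hpow 1).meromorphicAt.div hden.meromorphicAt).mul hexp.meromorphicAt
  obtain ⟨c, hc⟩ := hmer.exists_hasResidue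
  rw [hc.residueAt_eq]
  refine (hc.comp_exp.congr ?_).residueAt_eq.symm
  have hev : ∀ᶠ z : ℂ in 𝓝 w, z.im ∈ Ioo (-Real.pi) Real.pi :=
    Complex.continuous_im.continuousAt.eventually (Ioo_mem_nhds hw.1 hw.2)
  filter_upwards [eventually_nhdsWithin_of_eventually_nhds hev] with z hz
  exact relaxationTransform_exp_mul hz t

end poles

/-! ### Closing the contour -/

section closing

variable {α : ℝ → ℝ} {A : ℂ → ℂ} {lam L M : ℝ}

/-- The zeros of `s^{sA(s)} + λ` in the closed cut plane, in terms of `z = log s`. -/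
def relaxationZeros (A : ℂ → ℂ) (lam : ℝ) : Set ℂ :=
  {z | z ∈ cutStrip ∧ AnalyticAt ℂ A z ∧ scarpiPower A z + lam = 0}

theorem relaxationIntegrand_eq_expRatio (hlam : 0 < lam) (t : ℝ) : relaxationIntegrand A lam t =
    fun z => Complex.exp (t * Complex.exp z) * expRatio (relaxationPhase A lam z) := by
  ext z
  rw [relaxationIntegrand, expRatio_relaxationPhase hlam]

/-- The zeros of `s^{sA(s)} + λ` lie in the open cut plane, between the circles `|s| = e^M` and
`|s| = e^L`: near the origin `s^{sA(s)}` is small, far out it is large. -/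
structure IsSeparated (A : ℂ → ℂ) (lam L M : ℝ) : Prop where
  lt : M < L
  right : ∀ z : ℂ, L ≤ z.re → |z.im| ≤ Real.pi → AnalyticAt ℂ A z ∧ 2 * lam ≤ ‖scarpiPower A z‖
  left : ∀ z : ℂ, z.re ≤ M → |z.im| ≤ Real.pi → AnalyticAt ℂ A z ∧ ‖scarpiPower A z‖ ≤ lam / 2
  edge : ∀ θ : ℝ, θ = Real.pi ∨ θ = -Real.pi → ∀ x : ℝ, AnalyticAt ℂ A (x + θ * Complex.I) →
    scarpiPower A (x + θ * Complex.I) + lam ≠ 0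

namespace IsSeparated

theorem re_mem (h : IsSeparated A lam L M) (hlam : 0 < lam) {z : ℂ}
    (hz : z ∈ relaxationZeros A lam) : z.re ∈ Ioo M L := by
  obtain ⟨h1, -, h3⟩ := hz
  constructor
  · by_contra! h4
    exact scarpiPower_add_ne_zero_of_norm_le hlam (h.left z h4 h1).2 h3
  · by_contra! h4
    exact scarpiPower_add_ne_zero_of_le_norm hlam (h.right z h4 h1).2 h3

theorem im_mem (h : IsSeparated A lam L M) {z : ℂ} (hz : z ∈ relaxationZeros A lam) :
    z.im ∈ Ioo (-Real.pi) Real.pi := by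
  obtain ⟨h1, h2, h3⟩ := hz
  have h4 : z.im ∈ Icc (-Real.pi) Real.pi := abs_le.1 h1
  have key : ∀ θ : ℝ, θ = Real.pi ∨ θ = -Real.pi → z.im ≠ θ := by
    rintro θ hθ hzθ
    have e : (z.re + θ * Complex.I : ℂ) = z := by rw [← hzθ, Complex.re_add_im]
    have h5 := h.edge θ hθ z.re
    rw [e] at h5
    exact h5 h2 h3
  exact ⟨lt_of_le_of_ne h4.1 (key _ (Or.inr rfl)).symm, lt_of_le_of_ne h4.2 (key _ (Or.inl rfl))⟩

theorem isAdmissibleRect (h : IsSeparated A lam L M) (hlam : 0 < lam)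
    (hα : IsTransitionFunction α) (hA : IsTransformOnCutPlane α A) {m : ℝ} (hm : m ≤ M) :
    IsAdmissibleRect (relaxationPhase A lam) m L (-Real.pi) Real.pi where
  hab := hm.trans_lt h.lt
  hcd := by linarith [Real.pi_pos]
  cases z hz := by
    have hz' : z ∈ cutStrip := abs_le.2 hz.2
    by_cases h1 : AnalyticAt ℂ A z
    · exact Or.inl (h1.relaxationPhase lam)
    · exact Or.inr (hA.hasPoleAt_relaxationPhase hα hz' h1 lam)
  ne_int z hz n := by
    have h1 := h.left (M : ℂ) (by simp) (by simp [Real.pi_nonneg])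
    exact hA.eventually_relaxationPhase_ne hlam (ofReal_mem_cutStrip M) h1.1 h1.2 (abs_le.2 hz.2) n
  boundary z hz hX n hn := by
    have hz' : |z.im| ≤ Real.pi := abs_le.2 hz.1.2
    have h1 : z ∈ relaxationZeros A lam :=
      ⟨hz', (hA.analyticAt_relaxationPhase_iff hα hz' lam).1 hX,
        (exists_relaxationPhase_eq_int_iff hlam).1 ⟨n, hn⟩⟩
    have h2 := h.re_mem hlam h1
    have h3 := h.im_mem h1
    rcases hz.2 with h4 | h4 | h4 | h4
    · linarith [h2.1]
    · linarith [h2.2]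
    · linarith [h3.1]
    · linarith [h3.2]
  vertical z hz hre := by
    have hz' : |z.im| ≤ Real.pi := abs_le.2 hz.1.2
    rcases hre with h1 | h1
    · exact (h.left z (by linarith) hz').1.relaxationPhase lam
    · exact (h.right z h1.ge hz').1.relaxationPhase lam

theorem inter_integerLocus (h : IsSeparated A lam L M) (hlam : 0 < lam)
    (hα : IsTransitionFunction α) (hA : IsTransformOnCutPlane α A) {m : ℝ} (hm : m ≤ M) :
    (Icc m L ×ℂ Icc (-Real.pi) Real.pi) ∩ integerLocus (relaxationPhase A lam) =
      relaxationZeros A lam := by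
  ext z
  constructor
  · rintro ⟨⟨-, h1⟩, h2, h3⟩
    have h1' : z ∈ cutStrip := abs_le.2 h1
    exact ⟨h1', (hA.analyticAt_relaxationPhase_iff hα h1' lam).1 h2,
      (exists_relaxationPhase_eq_int_iff hlam).1 h3⟩
  · intro hz
    have h1 := h.re_mem hlam hz
    exact ⟨⟨⟨hm.trans h1.1.le, h1.2.le⟩, abs_le.1 hz.1⟩, hz.2.1.relaxationPhase lam,
      (exists_relaxationPhase_eq_int_iff hlam).2 hz.2.2⟩

theorem continuousOn_left (h : IsSeparated A lam L M) (hlam : 0 < lam) {θ : ℝ}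
    (hθ : θ = Real.pi ∨ θ = -Real.pi) (t : ℝ) :
    ContinuousOn (fun x : ℝ => relaxationIntegrand A lam t (x + θ * Complex.I)) (Iic M) := by
  intro x hx
  have h1 := h.left (x + θ * Complex.I) (by simpa using hx)
    (by simpa using abs_le_pi_of_edge hθ)
  have h2 : ContinuousAt (relaxationIntegrand A lam t) (x + θ * Complex.I) :=
    ContinuousAt.mul (by fun_prop) (h1.1.scarpiPower.continuousAt.div
      (h1.1.scarpiPower.continuousAt.add continuousAt_const)
      (scarpiPower_add_ne_zero_of_norm_le hlam h1.2))
  exact (ContinuousAt.comp (g := relaxationIntegrand A lam t)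
    (f := fun x : ℝ => (x + θ * Complex.I : ℂ)) h2 (by fun_prop)).continuousWithinAt

end IsSeparated

theorem norm_relaxationIntegrand_le (hlam : 0 < lam) {t : ℝ} (ht : 0 < t) {z : ℂ} (hz : z.re ≤ 0)
    (h : ‖scarpiPower A z‖ ≤ lam / 2) :
    ‖relaxationIntegrand A lam t z‖ ≤ Real.exp t * (2 / lam) * ‖scarpiPower A z‖ := by
  have h1 : lam / 2 ≤ ‖scarpiPower A z + lam‖ := by
    have h2 := norm_sub_le_norm_add (lam : ℂ) (scarpiPower A z)
    rw [Complex.norm_real, Real.norm_of_nonneg hlam.le, add_comm] at h2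
    linarith
  have h3 : ‖Complex.exp (t * Complex.exp z)‖ ≤ Real.exp t := by
    refine (Complex.norm_exp_le_exp_norm _).trans (Real.exp_le_exp.2 ?_)
    rw [norm_mul, Complex.norm_real, Real.norm_of_nonneg ht.le, Complex.norm_exp]
    exact mul_le_of_le_one_right ht.le (Real.exp_le_one_iff.2 hz)
  rw [relaxationIntegrand, norm_mul, norm_div]
  calc ‖Complex.exp (t * Complex.exp z)‖ * (‖scarpiPower A z‖ / ‖scarpiPower A z + lam‖)
      ≤ Real.exp t * (‖scarpiPower A z‖ / (lam / 2)) := by gcongr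
    _ = _ := by field_simp

variable {β C : ℝ}

/-- The integrals along the edges converge absolutely. -/
theorem IsSeparated.integrable_edge (h : IsSeparated A lam L M) (hlam : 0 < lam)
    (hα : IsTransitionFunction α) (hA : IsTransformOnCutPlane α A) (hM : M ≤ 0) (hβ : 0 < β)
    (hC : ∀ z : ℂ, z.re ≤ M → |z.im| ≤ Real.pi → ‖scarpiPower A z‖ ≤ C * Real.exp (β * z.re))
    {β' C' : ℝ} (hβ' : 0 < β') (hβ1 : β' < 1)
    (hdec : DecaysOnStrip (relaxationSymbol A lam) L β' C') {θ : ℝ}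
    (hθ : θ = Real.pi ∨ θ = -Real.pi) {t : ℝ} (ht : 0 < t) :
    Integrable fun x : ℝ => relaxationIntegrand A lam t (x + θ * Complex.I) := by
  have hleft : IntegrableOn (fun x : ℝ => relaxationIntegrand A lam t (x + θ * Complex.I))
      (Iic M) := by
    refine ((integrableOn_exp_mul_Iic hβ M).const_mul (Real.exp t * (2 / lam) * C)).mono'
      ((h.continuousOn_left hlam hθ t).aestronglyMeasurable measurableSet_Iic) ?_
    filter_upwards [ae_restrict_mem measurableSet_Iic] with x hx
    have hre : (x + θ * Complex.I : ℂ).re = x := re_add_mul_I x θ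
    have him : |(x + θ * Complex.I : ℂ).im| ≤ Real.pi := by
      rw [im_add_mul_I]; exact abs_le_pi_of_edge hθ
    have hx' : (x + θ * Complex.I : ℂ).re ≤ M := by rwa [hre]
    refine (norm_relaxationIntegrand_le hlam ht (hx'.trans hM) (h.left _ hx' him).2).trans ?_
    have h1 := hC _ hx' him
    rw [hre] at h1
    rw [mul_assoc _ C]
    gcongr
  have hmid : IntegrableOn (fun x : ℝ => relaxationIntegrand A lam t (x + θ * Complex.I))
      (Ioc M L) := by
    have h1 := (h.isAdmissibleRect hlam hα hA le_rfl).intervalIntegrable_horizontal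
      (E := fun z => Complex.exp (t * Complex.exp z)) (by fun_prop) (y := θ) hθ.symm
    rw [intervalIntegrable_iff_integrableOn_Ioc_of_le h.lt.le] at h1
    rw [relaxationIntegrand_eq_expRatio hlam]
    exact h1
  have hright : IntegrableOn (fun x : ℝ => relaxationIntegrand A lam t (x + θ * Complex.I))
      (Ioi L) := by
    simp only [relaxationIntegrand_eq_symbol]
    exact hdec.integrableOn_edge hβ' hβ1 hθ ht
  rw [← integrableOn_univ, ← Iic_union_Ioi (a := L), ← Iic_union_Ioc_eq_Iic h.lt.le]
  exact (hleft.union hmid).union hright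

/-- The Hankel integral around all singularities is the sum of the residues and of the integrals
along the edges: the rectangles `[m, L] × [-π, π]` exhaust the region as `m → -∞`. -/
theorem IsSeparated.two_pi_I_mul_hankel (h : IsSeparated A lam L M) (hlam : 0 < lam)
    (hα : IsTransitionFunction α) (hA : IsTransformOnCutPlane α A) (hM : M ≤ 0) (hβ : 0 < β)
    (hC : ∀ z : ℂ, z.re ≤ M → |z.im| ≤ Real.pi → ‖scarpiPower A z‖ ≤ C * Real.exp (β * z.re))
    {β' C' : ℝ} (hβ' : 0 < β') (hβ1 : β' < 1)
    (hdec : DecaysOnStrip (relaxationSymbol A lam) L β' C') {t : ℝ} (ht : 0 < t) :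
    2 * Real.pi * Complex.I * hankel (relaxationSymbol A lam) L t =
      2 * Real.pi * Complex.I *
        ∑' p, (relaxationZeros A lam).indicator (residueAt (relaxationIntegrand A lam t)) p
      + (∫ ρ in Ioi (0 : ℝ), edgeIntegrand A lam (-Real.pi) t ρ)
      - ∫ ρ in Ioi (0 : ℝ), edgeIntegrand A lam Real.pi t ρ := by
  set f := relaxationIntegrand A lam t with hf
  have hint : ∀ {θ : ℝ}, θ = Real.pi ∨ θ = -Real.pi →
      Integrable fun x : ℝ => f (x + θ * Complex.I) := fun hθ =>
    h.integrable_edge hlam hα hA hM hβ hC hβ' hβ1 hdec hθ ht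
  set S := ∑' p, (relaxationZeros A lam).indicator (residueAt f) p with hS
  have hrect : ∀ m ≤ M, rectIntegral f m L (-Real.pi) Real.pi = 2 * Real.pi * Complex.I * S := by
    intro m hm
    have h1 := (h.isAdmissibleRect hlam hα hA hm).rectIntegral_eq_tsum_residueAt
      (E := fun z => Complex.exp (t * Complex.exp z)) (by fun_prop)
    rwa [h.inter_integerLocus hlam hα hA hm, ← relaxationIntegrand_eq_expRatio hlam t] at h1
  have hhor : ∀ {θ : ℝ}, θ = Real.pi ∨ θ = -Real.pi → Tendsto
      (fun m : ℝ => ∫ x in m..L, f (x + θ * Complex.I)) atBot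
        (𝓝 (∫ x in Iic L, f (x + θ * Complex.I))) := fun hθ =>
    intervalIntegral_tendsto_integral_Iic L (hint hθ).integrableOn tendsto_id
  have hvert : Tendsto (fun m : ℝ => ∫ y in (-Real.pi)..Real.pi, f (m + y * Complex.I)) atBot
      (𝓝 0) := by
    have hlim : Tendsto (fun m : ℝ => Real.exp t * (2 / lam) * (C * Real.exp (β * m)) *
        |Real.pi - -Real.pi|) atBot (𝓝 0) := by
      have h1 : Tendsto (fun m : ℝ => Real.exp (β * m)) atBot (𝓝 0) :=
        Real.tendsto_exp_atBot.comp (tendsto_id.const_mul_atBot hβ)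
      have h2 := ((h1.const_mul C).const_mul (Real.exp t * (2 / lam))).mul_const |Real.pi - -Real.pi|
      simpa using h2
    refine squeeze_zero_norm' ?_ hlim
    filter_upwards [eventually_le_atBot M] with m hm
    refine intervalIntegral.norm_integral_le_of_norm_le_const fun y hy => ?_
    rw [uIoc_of_le (by linarith [Real.pi_pos])] at hy
    have hre : (m + y * Complex.I : ℂ).re = m := re_add_mul_I m y
    have him : |(m + y * Complex.I : ℂ).im| ≤ Real.pi := by
      rw [im_add_mul_I]; exact abs_le.2 ⟨hy.1.le, hy.2⟩
    have hm' : (m + y * Complex.I : ℂ).re ≤ M := by rwa [hre]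
    refine (norm_relaxationIntegrand_le hlam ht (hm'.trans hM) (h.left _ hm' him).2).trans ?_
    have h1 := hC _ hm' him
    rw [hre] at h1
    gcongr
  have hlimit := ((((hhor (Or.inr rfl)).sub (hhor (Or.inl rfl))).add
    (tendsto_const_nhds (x := Complex.I * ∫ y in (-Real.pi)..Real.pi, f (L + y * Complex.I)))).sub
      (hvert.const_mul Complex.I))
  have hconst : Tendsto (fun m : ℝ => rectIntegral f m L (-Real.pi) Real.pi) atBot
      (𝓝 (2 * Real.pi * Complex.I * S)) :=
    tendsto_const_nhds.congr' ((eventually_le_atBot M).mono fun m hm => (hrect m hm).symm)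
  have heq := tendsto_nhds_unique hlimit hconst
  have hsplit : ∀ {θ : ℝ}, θ = Real.pi ∨ θ = -Real.pi →
      (∫ x in Iic L, f (x + θ * Complex.I)) + (∫ x in Ioi L, f (x + θ * Complex.I)) =
        ∫ x : ℝ, f (x + θ * Complex.I) := fun hθ =>
    intervalIntegral.integral_Iic_add_Ioi (hint hθ).integrableOn (hint hθ).integrableOn
  have hedge : ∀ θ : ℝ, hankelEdge (relaxationSymbol A lam) L θ t =
      ∫ x in Ioi L, f (x + θ * Complex.I) := fun θ => by
    simp only [hankelEdge, hf, relaxationIntegrand_eq_symbol]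
  have harc : hankelArc (relaxationSymbol A lam) L t =
      Complex.I * ∫ y in (-Real.pi)..Real.pi, f (L + y * Complex.I) := by
    rw [hankelArc, ← intervalIntegral.integral_const_mul]
    congr 1
    ext y
    simp only [hf, relaxationIntegrand_eq_symbol]
    ring
  rw [hankel, mul_inv_cancel_left₀ Complex.two_pi_I_ne_zero, hedge, hedge, harc,
    integral_edgeIntegrand (Or.inl rfl), integral_edgeIntegrand (Or.inr rfl),
    ← hsplit (Or.inl rfl), ← hsplit (Or.inr rfl)]
  linear_combination heq

theorem IsSeparated.relaxationPoles_eq_image (h : IsSeparated A lam L M) :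
    relaxationPoles A lam = Complex.exp '' relaxationZeros A lam := by
  ext s
  constructor
  · intro hs
    have h1 := log_im_mem_of_slitPlane hs.1
    have h2 : Complex.exp (Complex.log s) = s := Complex.exp_log (Complex.slitPlane_ne_zero hs.1)
    have h3 := (exp_mem_relaxationPoles_iff (A := A) (lam := lam) h1).1 (by rwa [h2])
    exact ⟨Complex.log s, ⟨abs_le.2 ⟨h1.1.le, h1.2.le⟩, h3⟩, h2⟩
  · rintro ⟨z, hz, rfl⟩
    exact (exp_mem_relaxationPoles_iff (h.im_mem hz)).2 hz.2

theorem IsSeparated.injOn_exp (h : IsSeparated A lam L M) :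
    InjOn Complex.exp (relaxationZeros A lam) := fun z hz w hw hzw => by
  rw [← Complex.log_exp (h.im_mem hz).1 (h.im_mem hz).2.le,
    ← Complex.log_exp (h.im_mem hw).1 (h.im_mem hw).2.le, hzw]

theorem IsSeparated.norm_mem_Ioo (h : IsSeparated A lam L M) (hlam : 0 < lam) {s : ℂ}
    (hs : s ∈ relaxationPoles A lam) : ‖s‖ ∈ Ioo (Real.exp M) (Real.exp L) := by
  rw [h.relaxationPoles_eq_image] at hs
  obtain ⟨z, hz, rfl⟩ := hs
  have h1 := h.re_mem hlam hz
  rw [Complex.norm_exp]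
  exact ⟨Real.exp_lt_exp.2 h1.1, Real.exp_lt_exp.2 h1.2⟩

/-- The residues in the `s`-plane are those in the plane of `z = log s`. -/
theorem IsSeparated.summable_and_tsum_residueAt (h : IsSeparated A lam L M) (hlam : 0 < lam)
    (hα : IsTransitionFunction α) (hA : IsTransformOnCutPlane α A) (t : ℝ) :
    (Summable fun p : ↥(relaxationPoles A lam) =>
      residueAt (fun s => relaxationTransform A lam s * Complex.exp (s * t)) p) ∧
    ∑' p : ↥(relaxationPoles A lam),
      residueAt (fun s => relaxationTransform A lam s * Complex.exp (s * t)) p =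
    ∑' p, (relaxationZeros A lam).indicator (residueAt (relaxationIntegrand A lam t)) p := by
  set F := fun s => relaxationTransform A lam s * Complex.exp (s * t) with hF
  have hres : ∀ z : ↥(relaxationZeros A lam), residueAt F (Complex.exp z) =
      residueAt (relaxationIntegrand A lam t) z := fun z =>
    residueAt_relaxationTransform (h.im_mem z.2) z.2.2.1 t
  have hsum := (h.isAdmissibleRect hlam hα hA le_rfl).summable_residueAt
    (E := fun z => Complex.exp (t * Complex.exp z)) (by fun_prop)
  rw [h.inter_integerLocus hlam hα hA le_rfl, ← relaxationIntegrand_eq_expRatio hlam t,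
    ← summable_subtype_iff_indicator] at hsum
  rw [h.relaxationPoles_eq_image]
  constructor
  · rw [← (Equiv.Set.imageOfInjOn Complex.exp _ h.injOn_exp).summable_iff]
    exact hsum.congr fun z => (hres z).symm
  · rw [tsum_image (residueAt F) h.injOn_exp, ← tsum_subtype]
    exact tsum_congr hres

end closing

/-! ### The Cauchy problem and its solution -/

theorem mainTheorem1 (α : ℝ → ℝ) (hα : IsTransitionFunction α)
    (A : ℂ → ℂ) (hA : IsTransformOnCutPlane α A)
    (h_infty : ∃ l : ℂ, Tendsto (fun z : ℂ => Complex.exp z * A z)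
      (comap Complex.re atTop ⊓ 𝓟 cutStrip) (𝓝 l))
    (h_zero : ∃ l : ℂ, Tendsto (fun z : ℂ => Complex.exp z * A z)
      (comap Complex.re atBot ⊓ 𝓟 cutStrip) (𝓝 l))
    (lam : ℝ) (hlam : 0 < lam)
    (h_edge : ∀ θ : ℝ, θ = Real.pi ∨ θ = -Real.pi → ∀ ρ : ℝ, 0 < ρ →
      AnalyticAt ℂ A (Real.log ρ + θ * Complex.I) → edgeDenominator A lam θ ρ ≠ 0)
    (u₀ : ℝ) :
    (∃ φ : ℝ → ℝ, IsScarpiKernel α φ) ∧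
    ∀ φ : ℝ → ℝ, IsScarpiKernel α φ →
      ∃ u : ℝ → ℝ, IsRelaxationSolution φ lam u₀ u ∧
        (∀ v : ℝ → ℝ, IsRelaxationSolution φ lam u₀ v → EqOn v u (Ici 0)) ∧
        (∃ s₀ : ℝ, 0 < s₀ ∧ ∀ p ∈ relaxationPoles A lam, p.re < s₀) ∧
        (∀ s₀ : ℝ, 0 < s₀ → (∀ p ∈ relaxationPoles A lam, p.re < s₀) →
          ∀ᶠ R : ℝ in atTop, ∀ᶠ ε : ℝ in 𝓝[>] 0, ∀ t : ℝ, 0 < t →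
            Summable (fun p : ↥(relaxationPoles A lam ∩ keyholeInterior s₀ R ε) =>
              residueAt (fun s => relaxationTransform A lam s * Complex.exp (s * t)) p) ∧
            IntegrableOn (edgeIntegrand A lam (-Real.pi) t) (Ioi 0) ∧
            IntegrableOn (edgeIntegrand A lam Real.pi t) (Ioi 0) ∧
            (u t : ℂ) = u₀ / (2 * Real.pi * Complex.I) *
              (2 * Real.pi * Complex.I *
                  ∑' p : ↥(relaxationPoles A lam ∩ keyholeInterior s₀ R ε),
                    residueAt (fun s => relaxationTransform A lam s * Complex.exp (s * t)) p
                + (∫ ρ in Ioi (0 : ℝ), edgeIntegrand A lam (-Real.pi) t ρ)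
                - ∫ ρ in Ioi (0 : ℝ), edgeIntegrand A lam Real.pi t ρ)) := by
  obtain ⟨L, β', p, hL, hβ', hβ1, hright, hker, hsol, hdec, hp⟩ := hA.exists_solution hα h_infty hlam
  obtain ⟨β, C, M₀, hβ, -, hM₀, hleft⟩ := hA.exists_scarpiPower_bounds_atBot hα h_zero hlam
  set M : ℝ := M₀ - 1 with hM
  have hM0 : M ≤ M₀ := by linarith
  have hsep : IsSeparated A lam L M := by
    refine ⟨by linarith, hright, fun z hz hzi => ?_, fun θ hθ x hx => ?_⟩
    · have h1 := hleft z (hz.trans hM0) hzi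
      exact ⟨h1.1, h1.2.1⟩
    · have h1 := h_edge θ hθ (Real.exp x) (Real.exp_pos x) (by rwa [Real.log_exp])
      rwa [edgeDenominator_exp hθ] at h1
  have hC : ∀ z : ℂ, z.re ≤ M → |z.im| ≤ Real.pi →
      ‖scarpiPower A z‖ ≤ C * Real.exp (β * z.re) := fun z hz hzi =>
    (hleft z (hz.trans hM0) hzi).2.2
  refine ⟨hker, fun φ hφ => ⟨fun t => u₀ * p t, (hsol φ hφ u₀).1, (hsol φ hφ u₀).2, ?_, ?_⟩⟩
  · exact ⟨Real.exp L, Real.exp_pos L, fun s hs =>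
      (Complex.re_le_norm s).trans_lt (hsep.norm_mem_Ioo hlam hs).2⟩
  intro s₀ _ hs₀
  filter_upwards [eventually_ge_atTop (Real.exp L)] with R hR
  filter_upwards [Ioo_mem_nhdsGT (Real.exp_pos M)] with ε hε t ht
  -- the contour encloses all poles
  have hinside : relaxationPoles A lam ∩ keyholeInterior s₀ R ε = relaxationPoles A lam := by
    refine inter_eq_left.2 fun s hs => ?_
    have h1 := hsep.norm_mem_Ioo hlam hs
    refine ⟨hs.1, hε.2.trans h1.1, ?_⟩
    rcases le_or_gt s.re 0 with h2 | h2
    · exact Or.inl ⟨h2, h1.2.trans_le hR⟩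
    · exact Or.inr ⟨h2, hs₀ s hs, (Complex.abs_im_le_norm s).trans_lt (h1.2.trans_le hR)⟩
  rw [hinside]
  obtain ⟨hsum, htsum⟩ := hsep.summable_and_tsum_residueAt hlam hα hA t
  have hM' : M ≤ 0 := by linarith
  have hint : ∀ θ : ℝ, θ = Real.pi ∨ θ = -Real.pi →
      IntegrableOn (edgeIntegrand A lam θ t) (Ioi 0) := fun θ hθ =>
    (integrable_relaxationIntegrand_iff hθ t).2
      (hsep.integrable_edge hlam hα hA hM' hβ hC hβ' hβ1 hdec hθ ht)
  refine ⟨hsum, hint _ (Or.inr rfl), hint _ (Or.inl rfl), ?_⟩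
  rw [htsum, ← hsep.two_pi_I_mul_hankel hlam hα hA hM' hβ hC hβ' hβ1 hdec ht, ← hp t ht,
    div_mul_eq_mul_div, mul_left_comm, mul_div_cancel_left₀ _ Complex.two_pi_I_ne_zero]
  push_cast
  rfl
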